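/- \textbf{Setting.} A 2-bridge knot is written $K_{p/q}$ with $p,q$ coprime integers, $q>0$ odd; knots are taken up to isotopy and mirror image, so that $K_{p/q}=K_{p'/q'}$ if and only if $q=q'$ and $p'\equiv p^{\pm1}$ or $p'\equiv -p^{\pm 1} \pmod q$ (the unknot is $K_{0/1}$). An \emph{expanded even vector} is a finite sequence $\mathbf a=(a_1,\dots,a_n)$ with all $a_i\in\{-2,0,2\}$, $a_1\neq0$, $a_n\neq 0$, and $a_{i-1}=a_{i+1}=\pm2$ whenever $a_i=0$; let $\mathcal S_{even}$ be the set of those of even length, the empty vector included. Write $\mathbf a^{-1}$ for $\mathbf a$ read backwards, let $\hat{\mathbf a}=\{\pm\mathbf a,\pm\mathbf a^{-1}\}$, and let $\Phi(\hat{\mathbf a})=K_{p/q}$, where $\frac pq=\cfrac{1}{a_1+\cfrac{1}{\ddots+\cfrac1{a_n}}}$ (which is $0$ for the empty vector). For an even integer $m$ let $\mathbf m$ be the vector $\pm(2,0,2,0,\dots,0,2)$ whose entries add up to $m$, with $\mathbf m=(0)$ if $m=0$. Commas denote concatenation. A vector $\mathbf c$ \emph{parses with respect to} $\mathbf a$ if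 $$\mathbf c=(\epsilon_1\mathbf a,\mathbf{2c_1},\epsilon_2\mathbf a^{-1},\mathbf{2c_2},\epsilon_3\mathbf a,\dots,\epsilon_n\mathbf a^{(-1)^{n-1}})$$ for some $n\ge1$, signs $\epsilon_i\in\{1,-1\}$ with $\epsilon_1=1$, and integers $c_i$ such that $c_i=0$ implies $\epsilon_i=\epsilon_{i+1}$; and $\hat{\mathbf c}$ parses with respect to $\hat{\mathbf a}$ if some representative of $\hat{\mathbf c}$ parses with respect to some representative of $\hat{\mathbf a}$. The Ohtsuki--Riley--Sakuma order on 2-bridge knots is given by: $J\ge K$ if $J=\Phi(\hat{\mathbf c})$ and $K=\Phi(\hat{\mathbf a})$ for some $\mathbf c,\mathbf a\in\mathcal S_{even}$ such that $\hat{\mathbf c}$ parses with respect to $\hat{\mathbf a}$. \textbf{Theorem.} Let $K_1=\Phi(\hat{\mathbf a})$ and $K_2=\Phi(\hat{\mathbf b})$ be 2-bridge knots, with $\mathbf a,\mathbf b\in\mathcal S_{even}$. Then $K_1$ and $K_2$ are incomparable and $\{K_1,K_2\}$ has an upper bound (a 2-bridge knot $J$ with $J\ge K_1$ and $J\ge K_2$)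 with respect to the Ohtsuki--Riley--Sakuma order if and only if there are representatives $\mathbf a'$ of $\hat{\mathbf a}$ and $\mathbf b'$ of $\hat{\mathbf b}$, a (possibly empty) vector $\mathbf e\in\mathcal S_{even}$, even integers $m,n$ (possibly zero or negative) and integers $p,q\ge0$ such that, with $\mathbf w=(\mathbf e,\mathbf m,\mathbf e^{-1},\mathbf n)$, $$\mathbf a'=(\overbrace{\mathbf w,\dots,\mathbf w}^{p},\mathbf e)\quad\text{and}\quad \mathbf b'=(\overbrace{\mathbf w,\dots,\mathbf w}^{q},\mathbf e),$$ and neither of $2p+1$, $2q+1$ divides the other. -/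

import Mathlib

namespace TwoBridge

/-! ### Two-bridge knots -/

/-- Reduced fractions `p/q` with `q` odd; `r.num / r.den` is the reduced form of `r : ℚ`. -/
abbrev OddFraction : Type := {r : ℚ // Odd r.den}

/-- The knots `K_{p/q}` and `K_{p'/q'}` are equivalent (a knot is not distinguished from its
mirror image): `q = q'` and `p' ≡ p^{±1}` or `p' ≡ -p^{±1}` modulo `q`. -/
def SameKnot (r s : OddFraction) : Prop :=
  r.1.den = s.1.den ∧
    (r.1.num ≡ s.1.num [ZMOD r.1.den] ∨ r.1.num ≡ -s.1.num [ZMOD r.1.den] ∨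
      r.1.num * s.1.num ≡ 1 [ZMOD r.1.den] ∨ r.1.num * s.1.num ≡ -1 [ZMOD r.1.den])

theorem modEq_trans_aux {n x y z : ℤ}
    (h₁ : x ≡ y [ZMOD n] ∨ x ≡ -y [ZMOD n] ∨ x * y ≡ 1 [ZMOD n] ∨ x * y ≡ -1 [ZMOD n])
    (h₂ : y ≡ z [ZMOD n] ∨ y ≡ -z [ZMOD n] ∨ y * z ≡ 1 [ZMOD n] ∨ y * z ≡ -1 [ZMOD n]) :
    x ≡ z [ZMOD n] ∨ x ≡ -z [ZMOD n] ∨ x * z ≡ 1 [ZMOD n] ∨ x * z ≡ -1 [ZMOD n] := by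
  simp only [Int.modEq_iff_dvd] at *
  obtain ⟨u, hu⟩ | ⟨u, hu⟩ | ⟨u, hu⟩ | ⟨u, hu⟩ := h₁ <;>
  obtain ⟨v, hv⟩ | ⟨v, hv⟩ | ⟨v, hv⟩ | ⟨v, hv⟩ := h₂
  · exact Or.inl ⟨u + v, by linear_combination hu + hv⟩
  · exact Or.inr (Or.inl ⟨u + v, by linear_combination hu + hv⟩)
  · exact Or.inr (Or.inr (Or.inl ⟨z * u + v, by linear_combination z * hu + hv⟩))
  · exact Or.inr (Or.inr (Or.inr ⟨z * u + v, by linear_combination z * hu + hv⟩))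
  · exact Or.inr (Or.inl ⟨u - v, by linear_combination hu - hv⟩)
  · exact Or.inl ⟨u - v, by linear_combination hu - hv⟩
  · exact Or.inr (Or.inr (Or.inr ⟨z * u - v, by linear_combination z * hu - hv⟩))
  · exact Or.inr (Or.inr (Or.inl ⟨z * u - v, by linear_combination z * hu - hv⟩))
  · exact Or.inr (Or.inr (Or.inl ⟨u - x * v, by linear_combination hu - x * hv⟩))
  · exact Or.inr (Or.inr (Or.inr ⟨x * v - u, by linear_combination x * hv - hu⟩))
  · exact Or.inl ⟨z * u - x * v, by linear_combination z * hu - x * hv⟩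
  · exact Or.inr (Or.inl ⟨x * v - z * u, by linear_combination x * hv - z * hu⟩)
  · exact Or.inr (Or.inr (Or.inr ⟨u - x * v, by linear_combination hu - x * hv⟩))
  · exact Or.inr (Or.inr (Or.inl ⟨x * v - u, by linear_combination x * hv - hu⟩))
  · exact Or.inr (Or.inl ⟨z * u - x * v, by linear_combination z * hu - x * hv⟩)
  · exact Or.inl ⟨x * v - z * u, by linear_combination x * hv - z * hu⟩

theorem sameKnot_symm {r s : OddFraction} (h : SameKnot r s) : SameKnot s r := by
  obtain ⟨hd, h⟩ := h
  refine ⟨hd.symm, ?_⟩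
  rw [← hd]
  rcases h with h | h | h | h
  · exact Or.inl h.symm
  · exact Or.inr (Or.inl (by simpa using h.neg.symm))
  · exact Or.inr (Or.inr (Or.inl (by rwa [mul_comm])))
  · exact Or.inr (Or.inr (Or.inr (by rwa [mul_comm])))

theorem sameKnot_trans {r s t : OddFraction} (h₁ : SameKnot r s) (h₂ : SameKnot s t) :
    SameKnot r t := by
  obtain ⟨hd, h₁⟩ := h₁
  obtain ⟨hd', h₂⟩ := h₂
  rw [← hd] at h₂
  exact ⟨hd.trans (hd ▸ hd'), modEq_trans_aux h₁ h₂⟩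

instance knotSetoid : Setoid OddFraction where
  r := SameKnot
  iseqv := ⟨fun _ => ⟨rfl, Or.inl rfl⟩, sameKnot_symm, sameKnot_trans⟩

/-- The set of (equivalence classes of) 2-bridge knots, the unknot `K_{0/1}` included. -/
def Knot : Type := Quotient knotSetoid

/-! ### Expanded even vectors -/

/-- Expanded even vectors: all entries are `-2`, `0` or `2`, neither the first nor the last
entry is `0`, and the two neighbours of an entry `0` are equal and nonzero. -/
def IsExpandedEven (a : List ℤ) : Prop :=
  (∀ x ∈ a, x = -2 ∨ x = 0 ∨ x = 2) ∧ a.head? ≠ some 0 ∧ a.getLast? ≠ some 0 ∧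
    ∀ x y : ℤ, [x, 0, y] <:+: a → x = y ∧ x ≠ 0 ∧ y ≠ 0

/-- Expanded even vectors of even length; the empty vector is one of them. -/
abbrev EvenVec : Type := {a : List ℤ // IsExpandedEven a ∧ Even a.length}

/-- The vector with every entry multiplied by the sign `ε`. -/
def signed (ε : ℤˣ) (a : List ℤ) : List ℤ := a.map fun x => (ε : ℤ) * x

/-- Two vectors represent the same class: `a = ± b` or `a = ± b⁻¹`, where `b⁻¹` is `b` read
backwards. -/
def SameClass (a b : List ℤ) : Prop :=
  ∃ ε : ℤˣ, a = signed ε b ∨ a = signed ε b.reverse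

/-- The continued fraction `0 + [a₁, …, aₙ] = 1 / (a₁ + 1 / (a₂ + ⋯ + 1 / aₙ))`. -/
def cfrac : List ℤ → ℚ
  | [] => 0
  | x :: l => 1 / ((x : ℚ) + cfrac l)

/-- What is left of `IsExpandedEven` for a final segment of an expanded even vector. -/
def TailGood (l : List ℤ) : Prop :=
  (∀ x ∈ l, x = -2 ∨ x = 0 ∨ x = 2) ∧ l.getLast? ≠ some 0 ∧
    ∀ x y : ℤ, [x, 0, y] <:+: l → x = y ∧ x ≠ 0 ∧ y ≠ 0

theorem TailGood.tail {x : ℤ} {l : List ℤ} (h : TailGood (x :: l)) : TailGood l := by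
  obtain ⟨h₁, h₂, h₃⟩ := h
  refine ⟨fun y hy => h₁ y (List.mem_cons_of_mem _ hy), ?_, fun y z hyz => h₃ y z ?_⟩
  · cases l with
    | nil => simp
    | cons y t => simpa [List.getLast?_cons_cons] using h₂
  · exact hyz.trans (List.suffix_cons x l).isInfix

theorem cfrac_bound (l : List ℤ) : TailGood l → ∀ x t, l = x :: t →
    (x : ℚ) + cfrac t ≠ 0 ∧
    (x ≠ 0 → 0 < (x : ℚ) * cfrac l ∧ (x : ℚ) * cfrac l < 2) ∧
    (x = 0 → ∃ z t', t = z :: t' ∧ z ≠ 0 ∧ 0 < (z : ℚ) * cfrac l) := by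
  induction l with
  | nil => intro _ x t h; cases h
  | cons x t ih =>
    intro hg x' t' h
    obtain ⟨rfl, rfl⟩ := List.cons.inj h
    have ih := ih hg.tail
    have hx := hg.1 x (by simp)
    by_cases hx0 : x = 0
    · subst hx0
      cases t with
      | nil => exact absurd rfl hg.2.1
      | cons z t =>
        have hz : z ≠ 0 := by
          rintro rfl
          cases t with
          | nil => exact hg.2.1 (by simp)
          | cons w t => exact (hg.2.2 0 w (List.prefix_append [0, 0, w] t).isInfix).2.1 rfl
        obtain ⟨-, h2, -⟩ := ih z t rfl
        obtain ⟨h2, -⟩ := h2 hz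
        have hc : cfrac (z :: t) ≠ 0 := by
          intro h0; rw [h0] at h2; simp at h2
        refine ⟨by simpa using hc, fun h => absurd rfl h, fun _ => ⟨z, t, rfl, hz, ?_⟩⟩
        have : (z : ℚ) * cfrac (0 :: z :: t)
            = (z * cfrac (z :: t)) / (cfrac (z :: t)) ^ 2 := by
          rw [cfrac.eq_2 0]
          simp only [Int.cast_zero, zero_add]
          field_simp
        rw [this]
        positivity
    · have key : 1 < (x : ℚ) / 2 * (x + cfrac t) := by
        have hxx : (x : ℚ) / 2 * x = 2 := by
          rcases hx with rfl | rfl | rfl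
          · norm_num
          · exact absurd rfl hx0
          · norm_num
        cases t with
        | nil => simp only [cfrac, add_zero]; linarith
        | cons y t =>
          obtain ⟨-, h2, h3⟩ := ih y t rfl
          have hy := hg.1 y (by simp)
          by_cases hy0 : y = 0
          · subst hy0
            obtain ⟨z, t', rfl, hz, h3⟩ := h3 rfl
            have hxz := (hg.2.2 x z (List.prefix_append [x, 0, z] t').isInfix).1
            subst hxz
            nlinarith
          · obtain ⟨h2, h2'⟩ := h2 hy0
            rcases hx with rfl | rfl | rfl
            · rcases hy with rfl | rfl | rfl
              · push_cast at *; linarith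
              · exact absurd rfl hy0
              · push_cast at *; linarith
            · exact absurd rfl hx0
            · rcases hy with rfl | rfl | rfl
              · push_cast at *; linarith
              · exact absurd rfl hy0
              · push_cast at *; linarith
      have hne : (x : ℚ) + cfrac t ≠ 0 := by
        intro h0; rw [h0] at key; norm_num at key
      refine ⟨hne, fun _ => ?_, fun h => absurd h hx0⟩
      have hc : (x : ℚ) * cfrac (x :: t) = 2 / ((x : ℚ) / 2 * (x + cfrac t)) := by
        have hxx : (x : ℚ) * x = 4 := by
          rcases hx with rfl | rfl | rfl
          · norm_num
          · exact absurd rfl hx0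
          · norm_num
        have hx0' : (x : ℚ) ≠ 0 := by exact_mod_cast hx0
        rw [cfrac.eq_2]
        field_simp
        linarith
      rw [hc]
      exact ⟨by positivity, by rw [div_lt_iff₀ (by linarith)]; linarith⟩

theorem cfrac_parity (l : List ℤ) : TailGood l →
    (Even l.length → ∃ u v : ℤ, Odd v ∧ cfrac l = 2 * u / v) ∧
    (¬ Even l.length → ∃ u v : ℤ, u ≠ 0 ∧ Odd v ∧ cfrac l = v / (2 * u)) := by
  induction l with
  | nil => exact fun _ => ⟨fun _ => ⟨0, 1, odd_one, by simp [cfrac]⟩, fun h => absurd (by simp) h⟩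
  | cons x t ih =>
    intro hg
    have hne := (cfrac_bound _ hg x t rfl).1
    obtain ⟨ih₁, ih₂⟩ := ih hg.tail
    obtain ⟨k, rfl⟩ : ∃ k, x = 2 * k := by
      rcases hg.1 x (by simp) with rfl | rfl | rfl
      · exact ⟨-1, rfl⟩
      · exact ⟨0, rfl⟩
      · exact ⟨1, rfl⟩
    simp only [List.length_cons, Nat.even_add_one, not_not]
    refine ⟨fun h => ?_, fun h => ?_⟩
    · obtain ⟨u, v, hu, hv, he⟩ := ih₂ h
      have hw : Odd (4 * k * u + v) := by
        rw [show 4 * k * u + v = 2 * (2 * k * u) + v by ring]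
        exact (even_two_mul _).add_odd hv
      refine ⟨u, 4 * k * u + v, hw, ?_⟩
      have hu' : (u : ℚ) ≠ 0 := by exact_mod_cast hu
      rw [cfrac, he, show ((2 * k : ℤ) : ℚ) + v / (2 * u) = ((4 * k * u + v : ℤ) : ℚ) / (2 * u) by
        push_cast; field_simp; ring, one_div_div]
    · obtain ⟨u, v, hv, he⟩ := ih₁ h
      have hv' : (v : ℚ) ≠ 0 := by
        intro h0
        have : v = 0 := by exact_mod_cast h0
        rw [this] at hv; exact absurd hv (by decide)
      have e : ((2 * k : ℤ) : ℚ) + cfrac t = (2 * ((k * v + u : ℤ) : ℚ)) / v := by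
        rw [he]; push_cast; field_simp
      refine ⟨k * v + u, v, ?_, hv, ?_⟩
      · intro h0
        rw [e, h0] at hne
        simp at hne
      · rw [cfrac, e, one_div_div]

theorem odd_den_cfrac (a : EvenVec) : Odd (cfrac a.1).den := by
  obtain ⟨a, ⟨h₁, -, h₃, h₄⟩, hl⟩ := a
  obtain ⟨u, v, hv, he⟩ := (cfrac_parity a ⟨h₁, h₃, h₄⟩).1 hl
  have hd : ((cfrac a).den : ℤ) ∣ v := by
    rw [he, show (2 * (u : ℚ) / v) = Rat.divInt (2 * u) v by
      rw [Rat.divInt_eq_div]; push_cast; rfl]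
    exact Rat.den_dvd _ _
  obtain ⟨k, rfl⟩ := hd
  exact_mod_cast (Int.odd_mul.mp hv).1

/-- `Φ(â)` is the 2-bridge knot `K_{p/q}` with `p/q = 0 + [a]`. -/
def Phi (a : EvenVec) : Knot := Quotient.mk knotSetoid ⟨cfrac a.1, odd_den_cfrac a⟩

/-! ### Parsings and the Ohtsuki–Riley–Sakuma order -/

/-- The vector `±(2, 0, 2, 0, …, 0, 2)` with entries of sum `2 * c`; it is `(0)` for `c = 0`. -/
def connector (c : ℤ) : List ℤ :=
  if c = 0 then [0] else (List.replicate c.natAbs (2 * c.sign)).intersperse 0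

/-- `Tiling a ε c`: there are signs `ε₁ = ε, ε₂, …, εₙ` (`n ≥ 1`) and integers `c₁, …, cₙ₋₁`
with `c = (ε₁ a, 2c₁, ε₂ a⁻¹, 2c₂, ε₃ a, …, εₙ a^{±1})` such that `cᵢ = 0` implies
`εᵢ = εᵢ₊₁`. -/
inductive Tiling : List ℤ → ℤˣ → List ℤ → Prop
  | last (a : List ℤ) (ε : ℤˣ) : Tiling a ε (signed ε a)
  | step (a : List ℤ) (ε ε' : ℤˣ) (k : ℤ) (c : List ℤ) (hk : k = 0 → ε = ε')
      (h : Tiling a.reverse ε' c) : Tiling a ε (signed ε a ++ connector k ++ c)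

/-- `c` admits a parsing with respect to `a` (the first sign is `1`). -/
def Parses (c a : List ℤ) : Prop := Tiling a 1 c

/-- `ĉ` admits a parsing with respect to `â`: some representatives do. -/
def ClassParses (c a : EvenVec) : Prop :=
  ∃ c' a' : EvenVec, SameClass c'.1 c.1 ∧ SameClass a'.1 a.1 ∧ Parses c'.1 a'.1

/-- The Ohtsuki–Riley–Sakuma order: `J ≥ K` when `J = Φ(ĉ)` and `K = Φ(â)` for some `c`, `a`
such that `ĉ` admits a parsing with respect to `â`. -/
instance : LE Knot where
  le K J := ∃ c a : EvenVec, J = Phi c ∧ K = Phi a ∧ ClassParses c a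

/-- The vector `w = (e, m, e⁻¹, n)` for the even integers `m = 2 * c` and `n = 2 * d`. -/
def wVec (e : List ℤ) (c d : ℤ) : List ℤ := e ++ connector c ++ e.reverse ++ connector d

/-- The vector `(w, …, w, e)` with `p` copies of `w`. -/
def wPow (w : List ℤ) (p : ℕ) (e : List ℤ) : List ℤ := (List.replicate p w).flatten ++ e

end TwoBridge

/-!
An expanded even vector splits into blocks `±(2, 0, 2, …, 0, 2)`, so it is the expansion of a list
of nonzero integers, its labels (`expand`, `exists_labels`). A tiling of `c` by `a` becomes a list
made of copies of the labels of `a`, alternately read forwards and backwards, with single entries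
between the copies (`Unf`, `exists_unf_of_tiling`, `tiling_of_unf`). An entry `0` between two
copies merges the two equal labels beside it into one doubled label. Hence the absolute values of
the labels of `c` are read by an automaton that moves forwards and backwards along the labels of
`a` and turns either at an end, reading anything, or one letter before an end, reading that letter
doubled (`Step`, `Unf.accRun`).

Suppose that `a` and `b` tile a common vector. Then two label words accept a common word. The core
of the proof is `common_cell`: in this case the two words are both unfoldings of one nonempty word,
or both alternate between the same two labels. For this, one shortens the common word until the two
runs never turn at the same letter (`DRun.exists_noncommon`). The text is mirrored at each turn, so
two consecutive turns of one run around the first turn of the other generate many mirrors, at the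
distance of a greatest common divisor, and these cut one of the two words into equal cells
(`exists_cell`). The cell replaces this word, and one proceeds by induction (`common_cell_step`).

In the first case of `common_cell`, splitting the doubled labels gives lists for `a` and `b` which
are cut into copies of the common word, and both tilings then unfold to the same list, because its
zeros can only stand at known places (`exists_cells`, `Cells.unique`). In the second case parity
rules out doubled labels in a shortest common word (`Run.phase_of_alternating`). Either way, the
absolute values and the changes of sign of both lists occur periodically in one word (`Hosted`). If
the lists have lengths `M - 1` and `N - 1` then, by the Chinese remainder theorem, these data
depend only on the place up to sign modulo `2 * gcd M N` (`Hosted.matched`, `Matched`). So both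
lists are periodic and symmetric. If one of `M`, `N` divides the other, then one vector tiles the
other, and the knots are comparable; otherwise both vectors are of the form `(w, …, w, e)`
(`Matched.dichotomy`, `tilings_dichotomy`).

To pass between knots and vectors one needs that the knot determines the class of the vector
(`sameClass_of_phi_eq`): the numerator of its continued fraction is even and smaller than the odd
denominator, and reading the vector backwards inverts the numerator up to sign.

Conversely, `(w, …, w, e)` with `p` copies of `w` tiles the vector with `r` copies as soon as
`2 * p + 1` divides `2 * r + 1` (`unf_xPow`), which gives an upper bound for `p` and `q`. A tiling
of the vector with `q` copies by the one with `p` copies forces `2 * p + 1` to divide `2 * q + 1`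
(`dvd_of_tiling_xPow`), so that the knots are incomparable.
-/

namespace TwoBridge

/-! ### The automaton of a word of labels -/

/-- One step of the automaton of the label word `A 0, …, A (m - 1)`. A state `(e, d)` is a position
`e ≤ m` between letters, together with a direction of reading, `true` for forwards. Forwards, the
automaton reads the next letter; or reads the last letter doubled and turns before it, which is what
a zero connector does to the two copies of that letter around it; or, at the end, reads an arbitrary
label, a nonzero connector, and turns. The other three cases are the mirror images at the start of
the word. -/
def Step (m : ℕ) (A : ℕ → ℕ) (r : ℕ × Bool) (y : ℕ) (s : ℕ × Bool) : Prop :=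
  (r.2 = true ∧ r.1 < m ∧ y = A r.1 ∧ s = (r.1 + 1, true)) ∨
  (r.2 = true ∧ r.1 + 1 = m ∧ y = 2 * A r.1 ∧ s = (r.1, false)) ∨
  (r.2 = true ∧ r.1 = m ∧ s = (m, false)) ∨
  (r.2 = false ∧ 1 ≤ r.1 ∧ r.1 ≤ m ∧ y = A (r.1 - 1) ∧ s = (r.1 - 1, false)) ∨
  (r.2 = false ∧ r.1 = 1 ∧ y = 2 * A 0 ∧ s = (1, true)) ∨
  (r.2 = false ∧ r.1 = 0 ∧ s = (0, true))

/-- The state with the opposite direction. A step from `r` to `rev r` is a turn. -/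
def rev (s : ℕ × Bool) : ℕ × Bool := (s.1, !s.2)

@[simp] theorem rev_rev (s : ℕ × Bool) : rev (rev s) = s := by simp [rev]

theorem rev_inj {s t : ℕ × Bool} (h : rev s = rev t) : s = t := by
  rw [← rev_rev s, h, rev_rev]

theorem Step.symm {m : ℕ} {A : ℕ → ℕ} {r s : ℕ × Bool} {y : ℕ}
    (h : Step m A r y s) : Step m A (rev s) y (rev r) := by
  obtain ⟨e, d⟩ := r
  rcases h with ⟨h1, h2, h3, rfl⟩ | ⟨h1, h2, h3, rfl⟩ | ⟨h1, h2, rfl⟩ | ⟨h1, h2, h2', h3, rfl⟩ |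
    ⟨h1, h2, h3, rfl⟩ | ⟨h1, h2, rfl⟩ <;> simp only at h1 h2 <;> subst h1
  · right; right; right; left; simp_all [rev]
  · right; left; simp_all [rev]
  · right; right; left; simp_all [rev]
  · left; simp_all [rev]; omega
  · right; right; right; right; left; simp_all [rev]
  · right; right; right; right; right; simp_all [rev]

theorem Step.det {m : ℕ} {A : ℕ → ℕ} {r s s' : ℕ × Bool} {y : ℕ} (hm : 2 ≤ m)
    (hA : ∀ i < m, 0 < A i) (h : Step m A r y s) (h' : Step m A r y s') : s = s' := by
  obtain ⟨e, d⟩ := r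
  have h0 := hA 0 (by omega)
  rcases h with ⟨h1, h2, h3, rfl⟩ | ⟨h1, h2, h3, rfl⟩ | ⟨h1, h2, rfl⟩ | ⟨h1, h2, h2', h3, rfl⟩ |
    ⟨h1, h2, h3, rfl⟩ | ⟨h1, h2, rfl⟩ <;>
  rcases h' with ⟨k1, k2, k3, rfl⟩ | ⟨k1, k2, k3, rfl⟩ | ⟨k1, k2, rfl⟩ | ⟨k1, k2, k2', k3, rfl⟩ |
    ⟨k1, k2, k3, rfl⟩ | ⟨k1, k2, rfl⟩ <;> simp only at h1 h2 k1 k2 <;>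
  first
  | rfl
  | (exfalso; omega)
  | (exfalso; have := hA e (by omega); simp only at h3 k3; omega)
  | (exfalso; simp only at h3 k3; subst h2; simp at h3 k3; omega)
  | (exfalso; simp only at h3 k3; subst k2; simp at h3 k3; omega)
  | (exfalso; rw [h1] at k1; exact absurd k1 (by decide))

/-- Two different labels leaving one state are either a last letter and its double, or are both read
at an end. In each case their distance leads from the reverse of one target to the other. -/
theorem Step.bridge {m : ℕ} {A : ℕ → ℕ} {r s s' : ℕ × Bool} {y y' : ℕ} (hm : 2 ≤ m)
    (h : Step m A r y s) (h' : Step m A r y' s') (hy : y ≠ y') :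
    Step m A (rev s) (max y y' - min y y') s' := by
  obtain ⟨e, d⟩ := r
  rcases h with ⟨h1, h2, h3, rfl⟩ | ⟨h1, h2, h3, rfl⟩ | ⟨h1, h2, rfl⟩ | ⟨h1, h2, h2', h3, rfl⟩ |
    ⟨h1, h2, h3, rfl⟩ | ⟨h1, h2, rfl⟩ <;>
  rcases h' with ⟨k1, k2, k3, rfl⟩ | ⟨k1, k2, k3, rfl⟩ | ⟨k1, k2, rfl⟩ | ⟨k1, k2, k2', k3, rfl⟩ |
    ⟨k1, k2, k3, rfl⟩ | ⟨k1, k2, rfl⟩ <;> simp only at h1 h2 k1 k2 <;>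
  first
  | (exfalso; simp only at h3 k3; omega)
  | (exfalso; omega)
  | (exfalso; rw [h1] at k1; exact absurd k1 (by decide))
  | skip
  · right; right; right; left
    simp only at h3 k3; simp [rev]; refine ⟨by omega, ?_⟩; omega
  · left
    simp only at h3 k3; simp [rev]; omega
  · right; right; left; simp [rev]
  · left
    subst k2; simp at h3 k3; simp [rev]; omega
  · subst h2; simp at h3 k3
    right; right; right; left; simp [rev]; omega
  · right; right; right; right; right; simp [rev]

/-- A state whose outgoing step is forced: at least two letters are ahead. -/
def Deep (m : ℕ) (s : ℕ × Bool) : Prop :=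
  (s.2 = true ∧ s.1 + 1 < m) ∨ (s.2 = false ∧ 1 < s.1)

theorem Step.deep {m : ℕ} {A : ℕ → ℕ} {r s s' : ℕ × Bool} {y y' : ℕ} (hr : Deep m r)
    (h : Step m A r y s) (h' : Step m A r y' s') : y = y' ∧ s = s' := by
  obtain ⟨e, d⟩ := r
  simp only [Deep] at hr
  rcases h with ⟨h1, h2, h3, rfl⟩ | ⟨h1, h2, h3, rfl⟩ | ⟨h1, h2, rfl⟩ | ⟨h1, h2, h2', h3, rfl⟩ |
    ⟨h1, h2, h3, rfl⟩ | ⟨h1, h2, rfl⟩ <;>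
  rcases h' with ⟨k1, k2, k3, rfl⟩ | ⟨k1, k2, k3, rfl⟩ | ⟨k1, k2, rfl⟩ | ⟨k1, k2, k2', k3, rfl⟩ |
    ⟨k1, k2, k3, rfl⟩ | ⟨k1, k2, rfl⟩ <;> simp only at h1 h2 k1 k2 <;>
  first
  | exact ⟨h3.trans k3.symm, rfl⟩
  | (exfalso; simp_all)

/-- `α` is a run of the automaton of `A` reading `F 0, …, F (n - 1)`. -/
def Run (m : ℕ) (A : ℕ → ℕ) (n : ℕ) (F : ℕ → ℕ) (α : ℕ → ℕ × Bool) : Prop :=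
  ∀ t < n, Step m A (α t) (F t) (α (t + 1))

/-- The bits `b` of the edges of the word that is read agree with the bits `a` of the inner edges of
`A` that the run passes. The edge `t` of a word lies between its letters `t - 1` and `t`; the bits
will record whether these letters have the same sign. -/
def BitOK (m : ℕ) (a : ℕ → Bool) (n : ℕ) (b : ℕ → Bool) (α : ℕ → ℕ × Bool) : Prop :=
  ∀ t, 1 ≤ t → t < n → 1 ≤ (α t).1 → (α t).1 < m → b t = a (α t).1

/-- An accepting run with bits: it leads from the start of `A`, forwards, to the end of `A`,
forwards, so that `A` is run through an odd number of times. -/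
structure AccRun (m : ℕ) (A : ℕ → ℕ) (a : ℕ → Bool) (n : ℕ) (F : ℕ → ℕ) (b : ℕ → Bool)
    (α : ℕ → ℕ × Bool) : Prop where
  start : α 0 = (0, true)
  finish : α n = (m, true)
  run : Run m A n F α
  bit : BitOK m a n b α

/-- `F 0, …, F (n - 1)` is accepted by the automaton of `A`. -/
def Acc (m : ℕ) (A : ℕ → ℕ) (n : ℕ) (F : ℕ → ℕ) : Prop :=
  ∃ α, α 0 = (0, true) ∧ α n = (m, true) ∧ Run m A n F α

theorem AccRun.suffix {m n : ℕ} {A F : ℕ → ℕ} {a b : ℕ → Bool} {α : ℕ → ℕ × Bool}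
    (h : AccRun m A a n F b α) {k : ℕ} (hk : k ≤ n) (h0 : α k = (0, true)) :
    AccRun m A a (n - k) (fun t => F (t + k)) (fun t => b (t + k)) (fun t => α (t + k)) := by
  refine ⟨by simpa using h0, ?_, fun t ht => ?_, fun t h1 ht h2 h3 => ?_⟩
  · simpa [Nat.sub_add_cancel hk] using h.finish
  · have := h.run (t + k) (by omega)
    simpa [show t + 1 + k = t + k + 1 by omega] using this
  · exact h.bit (t + k) (by omega) (by omega) h2 h3

theorem AccRun.take {m n : ℕ} {A F : ℕ → ℕ} {a b : ℕ → Bool} {α : ℕ → ℕ × Bool}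
    (h : AccRun m A a n F b α) {k : ℕ} (hk : k ≤ n) (h0 : α k = (m, true)) :
    AccRun m A a k F b α :=
  ⟨h.start, h0, fun t ht => h.run t (by omega), fun t h1 ht => h.bit t h1 (by omega)⟩

/-- Cutting out a stretch of the word and bridging the gap by one label. -/
theorem AccRun.splice {m n : ℕ} {A F : ℕ → ℕ} {a b : ℕ → Bool} {α : ℕ → ℕ × Bool}
    (h : AccRun m A a n F b α) {v k y : ℕ} (hk : v + k < n)
    (hs : Step m A (α v) y (α (v + k + 1))) :
    AccRun m A a (n - k) (fun t => if t < v then F t else if t = v then y else F (t + k))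
      (fun t => if t ≤ v then b t else b (t + k))
      (fun t => if t ≤ v then α t else α (t + k)) := by
  refine ⟨by simpa using h.start, ?_, fun t ht => ?_, fun t h1 ht h2 h3 => ?_⟩
  · rw [if_neg (by omega), Nat.sub_add_cancel (by omega)]; exact h.finish
  · rcases lt_trichotomy t v with hv | rfl | hv
    · rw [if_pos hv, if_pos hv.le, if_pos (by omega)]; exact h.run t (by omega)
    · rw [if_neg (lt_irrefl t), if_pos rfl, if_pos le_rfl, if_neg (by omega)]
      rwa [show t + 1 + k = t + k + 1 by omega]
    · rw [if_neg (by omega), if_neg (by omega), if_neg (by omega), if_neg (by omega)]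
      have := h.run (t + k) (by omega)
      rwa [show t + 1 + k = t + k + 1 by omega]
  · by_cases hv : t ≤ v
    · simp only [if_pos hv] at h2 h3 ⊢; exact h.bit t h1 (by omega) h2 h3
    · simp only [if_neg hv] at h2 h3 ⊢; exact h.bit (t + k) (by omega) (by omega) h2 h3

/-- From a turn on, a run retraces its steps as long as the labels on both sides agree. -/
theorem Run.retrace {m n : ℕ} {A F : ℕ → ℕ} {α : ℕ → ℕ × Bool} (hm : 2 ≤ m)
    (hA : ∀ i < m, 0 < A i) (h : Run m A n F α) {u v : ℕ} (hu : 1 ≤ u) (hv : v < n)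
    (hr : α v = rev (α u)) (hun : u ≤ n) (hF : F (u - 1) = F v) :
    α (v + 1) = rev (α (u - 1)) := by
  have h1 := (h (u - 1) (by omega)).symm
  rw [Nat.sub_add_cancel hu, hF, ← hr] at h1
  exact (h v hv).det hm hA h1

/-- Where the labels on both sides of a turn first differ, the distance of the two labels bridges
the part in between. -/
theorem Run.bridge {m n : ℕ} {A F : ℕ → ℕ} {α : ℕ → ℕ × Bool} (hm : 2 ≤ m)
    (h : Run m A n F α) {u v : ℕ} (hu : 1 ≤ u) (hv : v < n)
    (hr : α v = rev (α u)) (hun : u ≤ n) (hF : F (u - 1) ≠ F v) :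
    Step m A (α (u - 1)) (max (F (u - 1)) (F v) - min (F (u - 1)) (F v)) (α (v + 1)) := by
  have h1 := (h (u - 1) (by omega)).symm
  rw [Nat.sub_add_cancel hu, ← hr] at h1
  simpa using h1.bridge hm (h v hv) hF

/-- A common word of two automata, with positive letters and with bits, together with the two runs.
-/
structure DRun (m : ℕ) (A : ℕ → ℕ) (a : ℕ → Bool) (l : ℕ) (B : ℕ → ℕ) (b : ℕ → Bool)
    (n : ℕ) (F : ℕ → ℕ) (c : ℕ → Bool) (α β : ℕ → ℕ × Bool) : Prop where
  left : AccRun m A a n F c α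
  right : AccRun l B b n F c β
  pos : ∀ t < n, 0 < F t

/-- A common word in which both runs turn at the same letter can be shortened. Going outwards from
that letter, both runs retrace their steps while the labels on the two sides agree. If the labels
differ, their distance bridges the part in between for both runs at once; if an end of the word is
reached, then what remains on the other side is a common word. -/
theorem DRun.shorten {m l n : ℕ} {A B F : ℕ → ℕ} {a b c : ℕ → Bool} {α β : ℕ → ℕ × Bool}
    (hm : 2 ≤ m) (hl : 2 ≤ l) (hA : ∀ i < m, 0 < A i) (hB : ∀ i < l, 0 < B i)
    (h : DRun m A a l B b n F c α β) {p : ℕ} (hp : p < n)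
    (hα : α (p + 1) = rev (α p)) (hβ : β (p + 1) = rev (β p)) :
    ∃ n' < n, ∃ F' c' α' β', DRun m A a l B b n' F' c' α' β' := by
  by_contra hno
  have key : ∀ w, w ≤ p ∧ p + 1 + w ≤ n ∧ α (p + 1 + w) = rev (α (p - w)) ∧
      β (p + 1 + w) = rev (β (p - w)) := by
    intro w
    induction w with
    | zero => exact ⟨by omega, by omega, hα, hβ⟩
    | succ w ih =>
      obtain ⟨hw, hn, h1, h2⟩ := ih
      have hw' : p + 1 + w ≠ n := by
        intro hn'
        apply hno
        rw [hn', h.left.finish] at h1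
        rw [hn', h.right.finish] at h2
        have hpw : p - w ≠ 0 := by
          intro h0; rw [h0, h.left.start] at h1; simp [rev] at h1
        have e1 : α (p - w) = (m, false) := by rw [← rev_rev (α _), ← h1]; rfl
        have e2 : β (p - w) = (l, false) := by rw [← rev_rev (β _), ← h2]; rfl
        have s1 := h.left.run (p - w - 1) (by omega)
        have s2 := h.right.run (p - w - 1) (by omega)
        rw [Nat.sub_add_cancel (by omega), e1] at s1
        rw [Nat.sub_add_cancel (by omega), e2] at s2
        have f1 : α (p - w - 1) = (m, true) := by
          rcases s1 with ⟨g1, g2, g3, g⟩ | ⟨g1, g2, g3, g⟩ | ⟨g1, g2, g⟩ | ⟨g1, g2, g2', g3, g⟩ |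
            ⟨g1, g2, g3, g⟩ | ⟨g1, g2, g⟩ <;> simp at g <;> first | omega | exact Prod.ext g2 g1
        have f2 : β (p - w - 1) = (l, true) := by
          rcases s2 with ⟨g1, g2, g3, g⟩ | ⟨g1, g2, g3, g⟩ | ⟨g1, g2, g⟩ | ⟨g1, g2, g2', g3, g⟩ |
            ⟨g1, g2, g3, g⟩ | ⟨g1, g2, g⟩ <;> simp at g <;> first | omega | exact Prod.ext g2 g1
        exact ⟨p - w - 1, by omega, _, _, _, _, h.left.take (by omega) f1,
          h.right.take (by omega) f2, fun t ht => h.pos t (by omega)⟩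
      have hwp : w ≠ p := by
        rintro rfl
        apply hno
        rw [Nat.sub_self, h.left.start] at h1
        rw [Nat.sub_self, h.right.start] at h2
        have s1 := h.left.run _ (by omega : w + 1 + w < n)
        have s2 := h.right.run _ (by omega : w + 1 + w < n)
        have f1 : α (w + 1 + w + 1) = (0, true) := by
          rw [h1] at s1
          rcases s1 with ⟨g1, g2, g3, g⟩ | ⟨g1, g2, g3, g⟩ | ⟨g1, g2, g⟩ | ⟨g1, g2, g2', g3, g⟩ |
            ⟨g1, g2, g3, g⟩ | ⟨g1, g2, g⟩ <;> simp [rev] at g1 g2 <;> exact g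
        have f2 : β (w + 1 + w + 1) = (0, true) := by
          rw [h2] at s2
          rcases s2 with ⟨g1, g2, g3, g⟩ | ⟨g1, g2, g3, g⟩ | ⟨g1, g2, g⟩ | ⟨g1, g2, g2', g3, g⟩ |
            ⟨g1, g2, g3, g⟩ | ⟨g1, g2, g⟩ <;> simp [rev] at g1 g2 <;> exact g
        exact ⟨n - (w + 1 + w + 1), by omega, _, _, _, _, h.left.suffix (by omega) f1,
          h.right.suffix (by omega) f2, fun t ht => h.pos _ (by omega)⟩
      by_cases hF : F (p - w - 1) = F (p + 1 + w)
      · exact ⟨by omega, by omega,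
          h.left.run.retrace hm hA (u := p - w) (v := p + 1 + w) (by omega) (by omega)
            h1 (by omega) hF,
          h.right.run.retrace hl hB (u := p - w) (v := p + 1 + w) (by omega) (by omega)
            h2 (by omega) hF⟩
      · exfalso
        apply hno
        have b1 := h.left.run.bridge hm (u := p - w) (v := p + 1 + w) (by omega) (by omega)
            h1 (by omega) hF
        have b2 := h.right.run.bridge hl (u := p - w) (v := p + 1 + w) (by omega) (by omega)
            h2 (by omega) hF
        have e : p + 1 + w + 1 = p - w - 1 + (2 * w + 2) + 1 := by omega
        rw [e] at b1 b2
        refine ⟨n - (2 * w + 2), by omega, _, _, _, _, h.left.splice (by omega) b1,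
          h.right.splice (by omega) b2, fun t ht => ?_⟩
        split_ifs
        · exact h.pos t (by omega)
        · omega
        · exact h.pos _ (by omega)
  have := (key (p + 1)).1
  omega

/-- Two automata with a common word have one in which the two runs never turn at the same letter. -/
theorem DRun.exists_noncommon {m l n : ℕ} {A B F : ℕ → ℕ} {a b c : ℕ → Bool}
    {α β : ℕ → ℕ × Bool}
    (hm : 2 ≤ m) (hl : 2 ≤ l) (hA : ∀ i < m, 0 < A i) (hB : ∀ i < l, 0 < B i)
    (h : DRun m A a l B b n F c α β) :
    ∃ n F c α β, DRun m A a l B b n F c α β ∧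
      ∀ p < n, ¬ (α (p + 1) = rev (α p) ∧ β (p + 1) = rev (β p)) := by
  classical
  have hex : ∃ n, ∃ F c α β, DRun m A a l B b n F c α β := ⟨n, F, c, α, β, h⟩
  obtain ⟨F, c, α, β, h⟩ := Nat.find_spec hex
  refine ⟨_, F, c, α, β, h, fun p hp ⟨h1, h2⟩ => ?_⟩
  obtain ⟨n', hn', h'⟩ := h.shorten hm hl hA hB hp h1 h2
  exact Nat.find_min hex hn' h'


theorem Step.le {m : ℕ} {A : ℕ → ℕ} {r s : ℕ × Bool} {y : ℕ} (hm : 2 ≤ m) (h : Step m A r y s) :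
    r.1 ≤ m ∧ s.1 ≤ m := by
  rcases h with ⟨h1, h2, h3, rfl⟩ | ⟨h1, h2, h3, rfl⟩ | ⟨h1, h2, rfl⟩ | ⟨h1, h2, h2', h3, rfl⟩ |
    ⟨h1, h2, h3, rfl⟩ | ⟨h1, h2, rfl⟩ <;> simp only <;> omega

/-- A step that is not a turn. -/
theorem Step.pass {m : ℕ} {A : ℕ → ℕ} {r s : ℕ × Bool} {y : ℕ} (hm : 2 ≤ m)
    (h : Step m A r y s) (hn : s ≠ rev r) :
    (r.2 = true ∧ r.1 < m ∧ y = A r.1 ∧ s = (r.1 + 1, true)) ∨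
    (r.2 = false ∧ 1 ≤ r.1 ∧ r.1 ≤ m ∧ y = A (r.1 - 1) ∧ s = (r.1 - 1, false)) := by
  rcases h with h | ⟨h1, h2, h3, rfl⟩ | ⟨h1, h2, rfl⟩ | h |
    ⟨h1, h2, h3, rfl⟩ | ⟨h1, h2, rfl⟩
  · exact Or.inl h
  · exact absurd (by simp [rev, h1]) hn
  · exact absurd (by simp [rev, h1, h2]) hn
  · exact Or.inr h
  · exact absurd (by simp [rev, h1, h2]) hn
  · exact absurd (by simp [rev, h1, h2]) hn

/-- The possible turns. -/
theorem Step.turn {m : ℕ} {A : ℕ → ℕ} {r : ℕ × Bool} {y : ℕ}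
    (h : Step m A r y (rev r)) :
    (r.2 = true ∧ r.1 + 1 = m ∧ y = 2 * A (m - 1)) ∨ r = (m, true) ∨
    (r = (1, false) ∧ y = 2 * A 0) ∨ r = (0, false) := by
  obtain ⟨e, d⟩ := r
  simp only [rev] at h
  rcases h with ⟨h1, h2, h3, h4⟩ | ⟨h1, h2, h3, h4⟩ | ⟨h1, h2, h4⟩ | ⟨h1, h2, h2', h3, h4⟩ |
    ⟨h1, h2, h3, h4⟩ | ⟨h1, h2, h4⟩ <;> simp only at h1 h2 <;> subst h1
  · simp at h4
  · left; refine ⟨rfl, h2, ?_⟩; rw [h3, ← h2]; rfl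
  · right; left; rw [h2]
  · simp at h4
  · right; right; left; exact ⟨by rw [h2], h3⟩
  · right; right; right; rw [h2]

theorem Step.to_end {m : ℕ} {A : ℕ → ℕ} {r : ℕ × Bool} {y : ℕ} (hm : 2 ≤ m)
    (h : Step m A r y (m, true)) : r = (m - 1, true) ∧ y = A (m - 1) := by
  obtain ⟨e, d⟩ := r
  rcases h with ⟨h1, h2, h3, h4⟩ | ⟨h1, h2, h3, h4⟩ | ⟨h1, h2, h4⟩ | ⟨h1, h2, h2', h3, h4⟩ |
    ⟨h1, h2, h3, h4⟩ | ⟨h1, h2, h4⟩ <;> simp at h1 h2 h4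
  · subst h1 h4; simp [h3]
  · omega
  · omega

theorem Step.from_start {m : ℕ} {A : ℕ → ℕ} {s : ℕ × Bool} {y : ℕ} (hm : 2 ≤ m)
    (h : Step m A (0, true) y s) : s = (1, true) ∧ y = A 0 := by
  rcases h with ⟨h1, h2, h3, h4⟩ | ⟨h1, h2, h3, h4⟩ | ⟨h1, h2, h4⟩ | ⟨h1, h2, h2', h3, h4⟩ |
    ⟨h1, h2, h3, h4⟩ | ⟨h1, h2, h4⟩ <;> simp at h1 h2
  · exact ⟨h4, h3⟩
  · omega
  · omega

/-- The word read backwards. -/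
def flipW (m : ℕ) (A : ℕ → ℕ) : ℕ → ℕ := fun i => A (m - 1 - i)

/-- The state of the reversed word that corresponds to a given state. -/
def flipS (m : ℕ) (s : ℕ × Bool) : ℕ × Bool := (m - s.1, !s.2)

theorem flipS_rev (m : ℕ) (s : ℕ × Bool) : flipS m (rev s) = rev (flipS m s) := rfl

theorem Step.flip {m : ℕ} {A : ℕ → ℕ} {r s : ℕ × Bool} {y : ℕ} (hm : 2 ≤ m)
    (h : Step m A r y s) : Step m (flipW m A) (flipS m r) y (flipS m s) := by
  obtain ⟨e, d⟩ := r
  simp only [flipS]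
  rcases h with ⟨h1, h2, h3, rfl⟩ | ⟨h1, h2, h3, rfl⟩ | ⟨h1, h2, rfl⟩ | ⟨h1, h2, h2', h3, rfl⟩ |
    ⟨h1, h2, h3, rfl⟩ | ⟨h1, h2, rfl⟩ <;> simp only at h1 h2 <;> subst h1
  · right; right; right; left
    refine ⟨rfl, by simp only; omega, by simp only; omega, ?_, ?_⟩
    · simp only at h3 ⊢; rw [h3]; congr 1; omega
    · simp only [Bool.not_true, Prod.mk.injEq, and_true]; omega
  · right; right; right; right; left
    refine ⟨rfl, by simp only; omega, ?_, ?_⟩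
    · simp only at h3 ⊢; rw [h3]; congr 2; omega
    · simp only [Bool.not_false, Prod.mk.injEq, and_true]; omega
  · right; right; right; right; right
    subst h2
    exact ⟨rfl, by simp, by simp⟩
  · left
    refine ⟨rfl, by simp only; omega, ?_, ?_⟩
    · simp only at h3 ⊢; rw [h3]; congr 1; omega
    · simp only [Bool.not_false, Prod.mk.injEq, and_true]; omega
  · right; left
    refine ⟨rfl, by simp only; omega, ?_, ?_⟩
    · simp only at h3 ⊢; rw [h3]; congr 2; omega
    · simp only [Bool.not_true, Prod.mk.injEq, and_true]; omega
  · right; right; left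
    subst h2
    exact ⟨rfl, by simp, by simp⟩

theorem flipW_flipW {m : ℕ} {A : ℕ → ℕ} {i : ℕ} (hi : i < m) : flipW m (flipW m A) i = A i := by
  simp only [flipW]; congr 1; omega

theorem Run.flip {m n : ℕ} {A F : ℕ → ℕ} {α : ℕ → ℕ × Bool} (hm : 2 ≤ m)
    (h : Run m A n F α) : Run m (flipW m A) n F (fun t => flipS m (α t)) :=
  fun t ht => (h t ht).flip hm

theorem Step.congr {m : ℕ} {A A' : ℕ → ℕ} {r s : ℕ × Bool} {y : ℕ} (hm : 2 ≤ m)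
    (hA : ∀ i < m, A i = A' i) (h : Step m A r y s) : Step m A' r y s := by
  obtain ⟨e, d⟩ := r
  rcases h with ⟨h1, h2, h3, rfl⟩ | ⟨h1, h2, h3, rfl⟩ | ⟨h1, h2, rfl⟩ | ⟨h1, h2, h2', h3, rfl⟩ |
    ⟨h1, h2, h3, rfl⟩ | ⟨h1, h2, rfl⟩ <;> simp only at h1 h2
  · exact Or.inl ⟨h1, h2, by rw [h3]; exact hA _ h2, rfl⟩
  · exact Or.inr (Or.inl ⟨h1, h2, by rw [h3, hA _ (by omega)], rfl⟩)
  · exact Or.inr (Or.inr (Or.inl ⟨h1, h2, rfl⟩))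
  · exact Or.inr (Or.inr (Or.inr (Or.inl ⟨h1, h2, h2',
      by rw [h3]; exact hA _ (by simp only at *; omega), rfl⟩)))
  · exact Or.inr (Or.inr (Or.inr (Or.inr (Or.inl ⟨h1, h2, by rw [h3, hA _ (by omega)], rfl⟩))))
  · exact Or.inr (Or.inr (Or.inr (Or.inr (Or.inr ⟨h1, h2, rfl⟩))))

theorem Acc.congr {m n : ℕ} {A A' F F' : ℕ → ℕ} (hm : 2 ≤ m) (hA : ∀ i < m, A i = A' i)
    (hF : ∀ i < n, F i = F' i) (h : Acc m A n F) : Acc m A' n F' := by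
  obtain ⟨α, h0, h1, h2⟩ := h
  exact ⟨α, h0, h1, fun t ht => by rw [← hF t ht]; exact (h2 t ht).congr hm hA⟩

theorem Acc.refl (m : ℕ) (A : ℕ → ℕ) : Acc m A m A :=
  ⟨fun t => (t, true), rfl, rfl, fun t ht => Or.inl ⟨rfl, ht, rfl, rfl⟩⟩

/-- The word read backwards is accepted by the automaton of the reversed word. -/
theorem Acc.flip {m n : ℕ} {A F : ℕ → ℕ} (hm : 2 ≤ m) (h : Acc m A n F) :
    Acc m (flipW m A) n (flipW n F) := by
  obtain ⟨α, h0, h1, h2⟩ := h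
  refine ⟨fun t => flipS m (rev (α (n - t))), ?_, ?_, fun t ht => ?_⟩
  · simp [h1, flipS, rev]
  · simp [h0, flipS, rev]
  · have := ((h2 (n - 1 - t) (by omega)).symm).flip hm
    rw [show n - 1 - t + 1 = n - t by omega, show n - 1 - t = n - (t + 1) by omega] at this
    simpa [flipW, show n - (t + 1) = n - 1 - t by omega] using this

/-- If `A` is accepted by the automaton of `e`, then so is everything accepted by the automaton of
`A`: a pass through `A` is replaced by the run of `e` along it, and a letter of `A` that is read
doubled is the first or the last letter of `e`, doubled as well. -/
theorem Acc.trans {k m n : ℕ} {e A F : ℕ → ℕ} (hk : 2 ≤ k) (hm : 2 ≤ m) (h : Acc k e m A)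
    (h' : Acc m A n F) : Acc k e n F := by
  obtain ⟨σ, s0, s1, s2⟩ := h
  obtain ⟨α, h0, h1, h2⟩ := h'
  have e0 : σ 1 = (1, true) ∧ A 0 = e 0 := by
    have := s2 0 (by omega); rw [s0] at this; exact this.from_start hk
  have e1 : σ (m - 1) = (k - 1, true) ∧ A (m - 1) = e (k - 1) := by
    have := s2 (m - 1) (by omega)
    rw [Nat.sub_add_cancel (by omega), s1] at this; exact this.to_end hk
  refine ⟨fun t => if (α t).2 then σ (α t).1 else rev (σ (α t).1), by simp [h0, s0],
    by simp [h1, s1], fun t ht => ?_⟩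
  have hs := h2 t ht
  beta_reduce
  generalize α t = r at hs ⊢
  generalize α (t + 1) = s at hs ⊢
  generalize F t = y at hs ⊢
  obtain ⟨i, d⟩ := r
  rcases hs with ⟨g1, g2, g3, rfl⟩ | ⟨g1, g2, g3, rfl⟩ | ⟨g1, g2, rfl⟩ | ⟨g1, g2, g2', g3, rfl⟩ |
    ⟨g1, g2, g3, rfl⟩ | ⟨g1, g2, rfl⟩ <;> simp only at g1 g2 <;> subst g1
  · simp only at g3; rw [g3]; exact s2 i g2
  · simp only at g3
    obtain rfl : i = m - 1 := by omega
    simp only [if_true, Bool.false_eq_true, if_false]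
    rw [e1.1, g3, e1.2]
    exact Or.inr (Or.inl ⟨rfl, by simp only; omega, rfl, rfl⟩)
  · subst g2
    simp only [if_true, Bool.false_eq_true, if_false]
    rw [s1]
    exact Or.inr (Or.inr (Or.inl ⟨rfl, rfl, rfl⟩))
  · simp only at g3 g2'
    simp only [Bool.false_eq_true, if_false]
    rw [g3]
    have := (s2 (i - 1) (by omega)).symm
    rwa [Nat.sub_add_cancel g2] at this
  · subst g2
    rw [e0.1, g3, e0.2]
    exact Or.inr (Or.inr (Or.inr (Or.inr (Or.inl ⟨rfl, rfl, rfl, rfl⟩))))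
  · subst g2
    simp only [if_true, Bool.false_eq_true, if_false]
    rw [s0]
    exact Or.inr (Or.inr (Or.inr (Or.inr (Or.inr ⟨rfl, rfl, rfl⟩))))

/-- The position of a state has the parity of the time, up to the direction. -/
theorem Run.parity {m n : ℕ} {A F : ℕ → ℕ} {α : ℕ → ℕ × Bool} (hm2 : Even m)
    (h : Run m A n F α) (h0 : α 0 = (0, true)) : ∀ t ≤ n,
    ((α t).2 = true → (α t).1 % 2 = t % 2) ∧ ((α t).2 = false → ((α t).1 + 1) % 2 = t % 2) := by
  obtain ⟨q, rfl⟩ := hm2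
  intro t
  induction t with
  | zero => intro _; rw [h0]; simp
  | succ t ih =>
    intro ht
    obtain ⟨i1, i2⟩ := ih (by omega)
    have hs := h t (by omega)
    rcases hs with ⟨g1, g2, g3, g⟩ | ⟨g1, g2, g3, g⟩ | ⟨g1, g2, g⟩ | ⟨g1, g2, g2', g3, g⟩ |
      ⟨g1, g2, g3, g⟩ | ⟨g1, g2, g⟩ <;> rw [g] <;> simp only <;>
      first | have i := i1 g1 | have i := i2 g1
    all_goals first
      | exact ⟨fun h => absurd h (by decide), fun _ => by omega⟩
      | exact ⟨fun _ => by omega, fun h => absurd h (by decide)⟩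

/-- Without turns the run goes straight. -/
theorem Run.straight {m n : ℕ} {A F : ℕ → ℕ} {α : ℕ → ℕ × Bool} (hm : 2 ≤ m)
    (h : Run m A n F α) {a e : ℕ} (h0 : α a = (e, true)) {k : ℕ} (hk : a + k ≤ n)
    (hn : ∀ t, a ≤ t → t < a + k → α (t + 1) ≠ rev (α t)) :
    (∀ i ≤ k, α (a + i) = (e + i, true)) ∧ (∀ i < k, e + i < m ∧ F (a + i) = A (e + i)) := by
  have key : ∀ i ≤ k, α (a + i) = (e + i, true) := by
    intro i
    induction i with
    | zero => intro _; simpa using h0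
    | succ i ih =>
      intro hi
      have ih := ih (by omega)
      rcases (h (a + i) (by omega)).pass hm (hn _ (by omega) (by omega)) with
        ⟨g1, g2, g3, g⟩ | ⟨g1, g2, g2', g3, g⟩
      · rw [← add_assoc, g, ih]; rfl
      · rw [ih] at g1; simp at g1
  refine ⟨key, fun i hi => ?_⟩
  have ih := key i hi.le
  rcases (h (a + i) (by omega)).pass hm (hn _ (by omega) (by omega)) with
    ⟨g1, g2, g3, g⟩ | ⟨g1, g2, g2', g3, g⟩
  · rw [ih] at g2 g3; exact ⟨g2, g3⟩
  · rw [ih] at g1; simp at g1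

theorem Run.straight_neg {m n : ℕ} {A F : ℕ → ℕ} {α : ℕ → ℕ × Bool} (hm : 2 ≤ m)
    (h : Run m A n F α) {a e : ℕ} (h0 : α a = (e, false)) {k : ℕ} (hk : a + k ≤ n)
    (hn : ∀ t, a ≤ t → t < a + k → α (t + 1) ≠ rev (α t)) :
    (∀ i ≤ k, i ≤ e ∧ α (a + i) = (e - i, false)) ∧
      (∀ i < k, i < e ∧ e - i ≤ m ∧ F (a + i) = A (e - i - 1)) := by
  have key : ∀ i ≤ k, i ≤ e ∧ α (a + i) = (e - i, false) := by
    intro i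
    induction i with
    | zero => intro _; simpa using h0
    | succ i ih =>
      intro hi
      have ih := ih (by omega)
      rcases (h (a + i) (by omega)).pass hm (hn _ (by omega) (by omega)) with
        ⟨g1, g2, g3, g⟩ | ⟨g1, g2, g2', g3, g⟩
      · rw [ih.2] at g1; simp at g1
      · rw [ih.2] at g2
        simp only at g2
        refine ⟨by omega, ?_⟩
        rw [← add_assoc, g, ih.2]; rfl
  refine ⟨key, fun i hi => ?_⟩
  have ih := key i hi.le
  rcases (h (a + i) (by omega)).pass hm (hn _ (by omega) (by omega)) with
    ⟨g1, g2, g3, g⟩ | ⟨g1, g2, g2', g3, g⟩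
  · rw [ih.2] at g1; simp at g1
  · rw [ih.2] at g2 g2' g3; exact ⟨by simp only at g2; omega, g2', g3⟩

/-- Forced steps after a turn are mirrored before it. -/
theorem Run.mirror_before {m n : ℕ} {A F : ℕ → ℕ} {α : ℕ → ℕ × Bool}
    (h : Run m A n F α) (h0 : ¬ Deep m (rev (α 0))) {v X : ℕ} (hv : v < n)
    (ht : α (v + 1) = rev (α v)) (hd : ∀ x, 1 ≤ x → x ≤ X → v + x < n ∧ Deep m (α (v + x))) :
    ∀ x ≤ X, x ≤ v ∧ α (v + x + 1) = rev (α (v - x)) ∧ F (v - x) = F (v + x) := by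
  intro x
  induction x with
  | zero => intro _; simpa using ht
  | succ x ih =>
    intro hx
    obtain ⟨i1, i2, -⟩ := ih (by omega)
    obtain ⟨d1, d2⟩ := hd (x + 1) (by omega) hx
    have hxv : x ≠ v := by
      rintro rfl
      rw [Nat.sub_self] at i2
      rw [← add_assoc, i2] at d2
      exact h0 d2
    have s1 := (h (v - x - 1) (by omega)).symm
    rw [Nat.sub_add_cancel (by omega), ← i2] at s1
    have s2 := h (v + (x + 1)) d1
    obtain ⟨g1, g2⟩ := Step.deep d2 s1 s2
    exact ⟨by omega, g2.symm, g1⟩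

/-- Forced steps before a turn are mirrored after it. -/
theorem Run.mirror_after {m n : ℕ} {A F : ℕ → ℕ} {α : ℕ → ℕ × Bool}
    (h : Run m A n F α) (h0 : ¬ Deep m (α n)) {v X : ℕ} (hv : v < n)
    (ht : α (v + 1) = rev (α v))
    (hd : ∀ x, 1 ≤ x → x ≤ X → x ≤ v ∧ Deep m (rev (α (v - x + 1)))) :
    ∀ x ≤ X, v + x < n ∧ α (v + x + 1) = rev (α (v - x)) ∧ F (v - x) = F (v + x) := by
  intro x
  induction x with
  | zero => intro _; simpa using ⟨hv, ht⟩
  | succ x ih =>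
    intro hx
    obtain ⟨i1, i2, -⟩ := ih (by omega)
    obtain ⟨d1, d2⟩ := hd (x + 1) (by omega) hx
    rw [show v - (x + 1) + 1 = v - x by omega, ← i2] at d2
    have hxv : v + x + 1 ≠ n := by
      intro hn
      rw [hn] at d2
      exact h0 d2
    have s1 := (h (v - (x + 1)) (by omega)).symm
    rw [show v - (x + 1) + 1 = v - x by omega, ← i2] at s1
    have s2 := h (v + x + 1) (by omega)
    obtain ⟨g1, g2⟩ := Step.deep d2 s1 s2
    exact ⟨by omega, g2.symm, g1⟩

/-- Through forced states the run goes straight and reads the letters of the word. -/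
theorem Run.forced {m n : ℕ} {A F : ℕ → ℕ} {α : ℕ → ℕ × Bool}
    (h : Run m A n F α) {a e : ℕ} (h0 : α a = (e, true)) {k : ℕ} (hk : a + k ≤ n)
    (he : e + k < m) :
    (∀ i ≤ k, α (a + i) = (e + i, true)) ∧ (∀ i < k, F (a + i) = A (e + i)) := by
  have st : ∀ i < k, α (a + i) = (e + i, true) →
      F (a + i) = A (e + i) ∧ α (a + i + 1) = (e + i + 1, true) := by
    intro i hi h1
    have s := h (a + i) (by omega)
    rw [h1] at s
    exact Step.deep (Or.inl ⟨rfl, by simp only; omega⟩) s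
      (Or.inl ⟨rfl, by simp only; omega, rfl, rfl⟩)
  have key : ∀ i ≤ k, α (a + i) = (e + i, true) := by
    intro i
    induction i with
    | zero => intro _; simpa using h0
    | succ i ih => exact fun hi => (st i (by omega) (ih (by omega))).2
  exact ⟨key, fun i hi => (st i hi (key i hi.le)).1⟩

theorem Run.forced_neg {m n : ℕ} {A F : ℕ → ℕ} {α : ℕ → ℕ × Bool}
    (h : Run m A n F α) {a e : ℕ} (h0 : α a = (e, false)) {k : ℕ} (hk : a + k ≤ n)
    (he : k < e) (hem : e ≤ m) :
    (∀ i ≤ k, α (a + i) = (e - i, false)) ∧ (∀ i < k, F (a + i) = A (e - i - 1)) := by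
  have st : ∀ i < k, α (a + i) = (e - i, false) →
      F (a + i) = A (e - i - 1) ∧ α (a + i + 1) = (e - i - 1, false) := by
    intro i hi h1
    have s := h (a + i) (by omega)
    rw [h1] at s
    exact Step.deep (Or.inr ⟨rfl, by simp only; omega⟩) s
      (Or.inr (Or.inr (Or.inr (Or.inl ⟨rfl, by simp only; omega, by simp only; omega, rfl, rfl⟩))))
  have key : ∀ i ≤ k, α (a + i) = (e - i, false) := by
    intro i
    induction i with
    | zero => intro _; simpa using h0
    | succ i ih => exact fun hi => (st i (by omega) (ih (by omega))).2
  exact ⟨key, fun i hi => (st i hi (key i hi.le)).1⟩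

/-! ### Cutting a mirror-symmetric word into cells -/

/-- The state of the automaton of a cell of length `g` after the mirror-symmetric word has been read
up to position `j`; the first mirror is at position `0`, and `z₀` shifts the letters of the cell. -/
def phase (g z₀ : ℕ) (j : ℤ) : ℕ × Bool :=
  if j % (2 * g) < g then ((j % (2 * g)).toNat + z₀, true)
  else ((2 * g - 1 - j % (2 * g)).toNat + z₀, false)

theorem phase_add_period (g z₀ : ℕ) (j : ℤ) : phase g z₀ (j + 2 * g) = phase g z₀ j := by
  simp [phase]

theorem phase_congr {g z₀ : ℕ} {i j : ℤ} (h : (2 * g : ℤ) ∣ i - j) :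
    phase g z₀ i = phase g z₀ j := by
  have : i % (2 * g) = j % (2 * g) :=
      Int.emod_eq_emod_iff_emod_sub_eq_zero.mpr (Int.emod_eq_zero_of_dvd h)
  simp [phase, this]

theorem periodic_emod {P : ℤ → ℕ} {c : ℤ} (hper : ∀ j, P (j + c) = P j) (j : ℤ) :
    P (j % c) = P j := by
  have h : Function.Periodic P c := hper
  have := h.sub_int_mul_eq (x := j) (j / c)
  rw [← this]
  congr 1
  have := Int.emod_add_mul_ediv j c
  simp only [Int.cast_id]
  linarith [mul_comm c (j / c)]

/-- The automaton of a cell runs regularly along an even function of period `2 * g` whose values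
between two neighbouring mirrors are the letters of the cell. -/
theorem step_phase {P : ℤ → ℕ} {g : ℕ} (hg : 0 < g) (heven : ∀ j, P (-j) = P j)
    (hper : ∀ j, P (j + 2 * g) = P j) {z₀ z₁ E : ℕ} {e : ℕ → ℕ} (hz₀ : z₀ ≤ 1) (hz₁ : z₁ ≤ 1)
    (hE : E + 1 = g + z₀ + z₁) (hE2 : 2 ≤ E)
    (he : ∀ r : ℕ, r + 1 < g → e (r + z₀) = P (r + 1))
    (h0 : z₀ = 1 → P 0 = 2 * e 0) (h1 : z₁ = 1 → P g = 2 * e (E - 1)) (j : ℤ) :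
    Step E e (phase g z₀ j) (P (j + 1)) (phase g z₀ (j + 1)) := by
  have hr0 := Int.emod_nonneg j (show (2 * g : ℤ) ≠ 0 by omega)
  have hr1 := Int.emod_lt_of_pos j (show (0 : ℤ) < 2 * g by omega)
  have hj : j = 2 * g * (j / (2 * g)) + j % (2 * g) := (Int.mul_ediv_add_emod j (2 * g)).symm
  set r := j % (2 * g) with hr
  have hP : P (j + 1) = P (r + 1) := by
    rw [← periodic_emod hper (j + 1), ← periodic_emod hper (r + 1), hr, Int.emod_add_emod]
  have hr' : (j + 1) % (2 * g) = (r + 1) % (2 * g) := by rw [hr, Int.emod_add_emod]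
  obtain ⟨q, hq⟩ : ∃ q : ℕ, r = q := ⟨r.toNat, by omega⟩
  rw [hP]
  unfold phase
  rw [← hr, hr']
  clear_value r
  subst hq
  by_cases c1 : q + 1 < 2 * g
  · rw [Int.emod_eq_of_lt (by omega) (by omega : ((q : ℤ) + 1) < 2 * g)]
    rcases lt_trichotomy (q + 1) g with c | c | c
    · rw [if_pos (by omega), if_pos (by omega)]
      left
      refine ⟨rfl, by simp only; omega, ?_, ?_⟩
      · simp only [Int.toNat_natCast]; rw [he q c]
      · simp only [Int.toNat_natCast, Prod.mk.injEq, and_true]; omega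
    · rw [if_pos (by omega), if_neg (by omega)]
      rcases (by omega : z₁ = 0 ∨ z₁ = 1) with hz | hz
      · right; right; left
        refine ⟨rfl, by simp only [Int.toNat_natCast]; omega, ?_⟩
        simp only [Prod.mk.injEq, and_true]; omega
      · right; left
        refine ⟨rfl, by simp only [Int.toNat_natCast]; omega, ?_, ?_⟩
        · simp only [Int.toNat_natCast]
          rw [show ((q : ℤ) + 1) = g by omega, h1 hz]
          congr 2; omega
        · simp only [Int.toNat_natCast, Prod.mk.injEq, and_true]; omega
    · rw [if_neg (by omega), if_neg (by omega)]
      right; right; right; left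
      refine ⟨rfl, by simp only; omega, by simp only; omega, ?_, ?_⟩
      · simp only
        have h2 : P ((q : ℤ) + 1) = P (((2 * g - 2 - q : ℕ) : ℤ) + 1) := by
          rw [← heven, ← hper]; congr 1; omega
        rw [h2, ← he _ (by omega)]
        congr 1; omega
      · simp only [Prod.mk.injEq, and_true]; omega
  · have c2 : (q : ℤ) + 1 = 2 * g := by omega
    rw [c2, Int.emod_self, if_neg (by omega), if_pos (by omega)]
    rcases (by omega : z₀ = 0 ∨ z₀ = 1) with hz | hz
    · right; right; right; right; right
      refine ⟨rfl, by simp only; omega, ?_⟩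
      simp only [Prod.mk.injEq, and_true]; omega
    · right; right; right; right; left
      refine ⟨rfl, by simp only; omega, ?_, ?_⟩
      · have := hper 0
        rw [zero_add] at this
        rw [this, h0 hz]
      · simp only [Prod.mk.injEq, and_true]; omega

/-- A word that reads an even function of period `2 * g` along an odd number of cells of length
`g` is accepted by the automaton of its first cell. The numbers `z₀`, `z₁` tell whether a letter
at an end is only half of the value at the mirror. -/
theorem acc_cell {P : ℤ → ℕ} {g : ℕ} (hg : 0 < g) (heven : ∀ j, P (-j) = P j)
    (hper : ∀ j, P (j + 2 * g) = P j) {z₀ z₁ k n E : ℕ} {w : ℕ → ℕ} (hz₀ : z₀ ≤ 1) (hz₁ : z₁ ≤ 1)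
    (hn : n + 1 = (2 * k + 1) * g + z₀ + z₁) (hE : E + 1 = g + z₀ + z₁) (hE2 : 2 ≤ E)
    (hw : ∀ i : ℕ, z₀ < i + 1 → i + 1 < (2 * k + 1) * g + z₀ → w i = P ((i : ℤ) + 1 - z₀))
    (h0 : z₀ = 1 → P 0 = 2 * w 0) (h1 : z₁ = 1 → P ((2 * k + 1) * g : ℕ) = 2 * w (n - 1)) :
    Acc E (fun i => if z₁ = 1 ∧ i + 1 = E then w (n - 1) else w i) n w := by
  have hgk : g ≤ (2 * k + 1) * g := Nat.le_mul_of_pos_left g (by omega)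
  have hst := step_phase hg heven hper (e := fun i => if z₁ = 1 ∧ i + 1 = E then w (n - 1) else w i)
    hz₀ hz₁ hE hE2 (fun r hr => by
      rw [if_neg (by omega), hw _ (by omega) (by omega)]
      congr 1; push_cast; ring)
    (fun h => by rw [if_neg (by omega)]; exact h0 h)
    (fun h => by
      rw [if_pos ⟨h, by omega⟩, ← h1 h, ← periodic_emod hper, ← periodic_emod hper (_ : ℕ)]
      congr 1
      push_cast
      rw [show (2 * (k : ℤ) + 1) * g = g + (2 * g) * k by ring, Int.add_mul_emod_self_left])
  have hend : phase g z₀ (((2 * k + 1) * g : ℕ) - 1) = (g - 1 + z₀, true) := by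
    have : phase g z₀ (((2 * k + 1) * g : ℕ) - 1) = phase g z₀ ((g : ℤ) - 1) :=
      phase_congr ⟨k, by push_cast; ring⟩
    rw [this, phase, Int.emod_eq_of_lt (by omega) (by omega), if_pos (by omega)]
    simp only [Prod.mk.injEq, and_true]; omega
  have hbeg : phase g z₀ 0 = (z₀, true) := by
    simp [phase, hg]
  refine ⟨fun i => if i = 0 then (0, true) else if i = n then (E, true)
    else phase g z₀ ((i : ℤ) - z₀), by simp, by simp; omega, fun i hi => ?_⟩
  have hn1 : 2 ≤ n := by omega
  -- the step is regular unless it leaves or enters a halved end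
  have reg : ∀ i : ℕ, z₀ < i + 1 → i + 1 < (2 * k + 1) * g + z₀ →
      Step E _ (phase g z₀ ((i : ℤ) - z₀)) (w i)
      (phase g z₀ ((i : ℤ) + 1 - z₀)) := fun i h1 h2 => by
    have := hst ((i : ℤ) - z₀)
    rwa [show (i : ℤ) - z₀ + 1 = i + 1 - z₀ by ring, ← hw i h1 h2] at this
  have e0 : z₀ = 0 → (0, true) = phase g z₀ (((0 : ℕ) : ℤ) - z₀) := by
    rintro rfl; simp [hbeg]
  have e1 : z₁ = 0 → (E, true) = phase g z₀ ((n : ℤ) - z₀) := by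
    intro h
    rw [show (n : ℤ) - z₀ = ((2 * k + 1) * g : ℕ) - 1 by omega, hend]
    simp only [Prod.mk.injEq, and_true]; omega
  beta_reduce
  rw [if_neg (by omega : i + 1 ≠ 0), if_neg (by omega : i ≠ n)]
  by_cases hi0 : i = 0
  · subst hi0
    rw [if_pos rfl, if_neg (by omega)]
    rcases (by omega : z₀ = 0 ∨ z₀ = 1) with hz | hz
    · rw [e0 hz]
      exact_mod_cast reg 0 (by omega) (by omega)
    · left
      refine ⟨rfl, by simp only; omega, ?_, ?_⟩
      · simp only; rw [if_neg (by omega)]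
      · rw [hz] at hbeg ⊢; simpa using hbeg
  · rw [if_neg hi0]
    by_cases hin : i + 1 = n
    · rw [if_pos hin]
      rcases (by omega : z₁ = 0 ∨ z₁ = 1) with hz | hz
      · rw [e1 hz]
        have := reg i (by omega) (by omega)
        rwa [show (i : ℤ) + 1 = n by omega] at this
      · rw [show (i : ℤ) - z₀ = ((2 * k + 1) * g : ℕ) - 1 by omega, hend]
        left
        refine ⟨rfl, by simp only; omega, ?_, ?_⟩
        · simp only; rw [if_pos (by omega)]; congr 1; omega
        · simp only [Prod.mk.injEq, and_true]; omega
    · rw [if_neg hin]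
      exact_mod_cast reg i (by omega) (by omega)


/-! ### Reading a word around a mirror -/

/-- The run to the left of a letter, read backwards. -/
theorem Run.left {m : ℕ} {A F : ℕ → ℕ} {n : ℕ} {α : ℕ → ℕ × Bool} (h : Run m A n F α) {v k : ℕ}
    (hv : v < n) (hk : k ≤ v + 1) :
    Run m A k (fun j => F (v - j)) (fun j => rev (α (v + 1 - j))) := by
  intro j hj
  have := (h (v - j) (by omega)).symm
  simpa [show v - j + 1 = v + 1 - j by omega, show v + 1 - (j + 1) = v - j by omega] using this

theorem Run.right {m : ℕ} {A F : ℕ → ℕ} {n : ℕ} {α : ℕ → ℕ × Bool} (h : Run m A n F α) {v k : ℕ}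
    (hk : v + k ≤ n) :
    Run m A k (fun j => F (v + j)) (fun j => α (v + j)) :=
  fun j hj => h (v + j) (by omega)

theorem Run.eq_F {m : ℕ} {A F G : ℕ → ℕ} {n : ℕ} {α : ℕ → ℕ × Bool} (h : Run m A n F α)
    (hF : ∀ t < n, F t = G t) : Run m A n G α := fun t ht => by rw [← hF t ht]; exact h t ht

theorem Step.start_neg {m : ℕ} {A : ℕ → ℕ} {s : ℕ × Bool} {y : ℕ}
    (h : Step m A (0, false) y s) : s = (0, true) := by
  rcases h with ⟨h1, h2, h3, h4⟩ | ⟨h1, h2, h3, h4⟩ | ⟨h1, h2, h4⟩ | ⟨h1, h2, h2', h3, h4⟩ |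
    ⟨h1, h2, h3, h4⟩ | ⟨h1, h2, h4⟩ <;> simp at h1 h2
  exact h4

theorem Step.end_pos {m : ℕ} {A : ℕ → ℕ} {s : ℕ × Bool} {y : ℕ}
    (h : Step m A (m, true) y s) : s = (m, false) := by
  rcases h with ⟨h1, h2, h3, h4⟩ | ⟨h1, h2, h3, h4⟩ | ⟨h1, h2, h4⟩ | ⟨h1, h2, h2', h3, h4⟩ |
    ⟨h1, h2, h3, h4⟩ | ⟨h1, h2, h4⟩ <;> simp at h1 h2
  exact h4

/-- The last letter can be read as a step past it or, doubled, as a turn. -/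
theorem Step.before_end {m : ℕ} {A : ℕ → ℕ} {s : ℕ × Bool} {y : ℕ} (hm : 2 ≤ m)
    (h : Step m A (m - 1, true) y s) : (y = A (m - 1) ∧ s = (m, true)) ∨ y = 2 * A (m - 1) := by
  rcases h with ⟨h1, h2, h3, h4⟩ | ⟨h1, h2, h3, h4⟩ | ⟨h1, h2, h4⟩ | ⟨h1, h2, h2', h3, h4⟩ |
    ⟨h1, h2, h3, h4⟩ | ⟨h1, h2, h4⟩ <;> simp only at h1 h2
  · left; refine ⟨h3, ?_⟩; rw [h4]; simp only [Prod.mk.injEq, and_true]; omega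
  · right; exact h3
  · omega
  · simp at h1
  · simp at h1
  · simp at h1

/-- If the same word can be read from the last letter, undoubled, and from the start after a turn,
then the letters of `A` between the first one and the last one are symmetric. -/
theorem defect_symm {m k : ℕ} {A G : ℕ → ℕ} {ρ σ : ℕ → ℕ × Bool} (hm : 2 ≤ m)
    (hρ : Run m A k G ρ) (hσ : Run m A k G σ) (hρ1 : ρ 1 = (m, true))
    (hσ0 : σ 0 = (0, false)) (hk : m ≤ k) :
    ∀ i, 1 ≤ i → i + 2 ≤ m → A i = A (m - i) := by
  have r2 : ρ 2 = (m, false) := by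
    have := hρ 1 (by omega); rw [hρ1] at this; exact this.end_pos
  have s1 : σ 1 = (0, true) := by
    have := hσ 0 (by omega); rw [hσ0] at this; exact this.start_neg
  obtain ⟨-, f1⟩ := hρ.forced_neg r2 (k := m - 2) (by omega) (by omega) le_rfl
  obtain ⟨-, f2⟩ := hσ.forced s1 (k := m - 1) (by omega) (by omega)
  intro i h1 h2
  have a1 := f1 (i - 1) (by omega)
  have a2 := f2 i (by omega)
  rw [zero_add] at a2
  rw [← a2, show m - i = m - (i - 1) - 1 by omega, ← a1]
  congr 1; omega

/-- A run that turns at the end of `A` passes all of `A` before it reaches an end again. -/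
theorem defect_bound_end {m k : ℕ} {A G : ℕ → ℕ} {ρ : ℕ → ℕ × Bool} (hk : 1 ≤ k)
    (hρ : Run m A (k + 1) G ρ) (hρ1 : ρ 1 = (m, true))
    (he : ρ (k + 1) = (0, false) ∨ ρ (k + 1) = (m, true)) : m ≤ k := by
  by_contra hlt
  have r2 : ρ 2 = (m, false) := by
    have := hρ 1 (by omega); rw [hρ1] at this; exact this.end_pos
  have := (hρ.forced_neg r2 (k := k - 1) (by omega) (by omega) le_rfl).1 (k - 1) le_rfl
  rw [show 2 + (k - 1) = k + 1 by omega] at this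
  rw [this] at he
  simp at he
  omega

/-- A run that turns at the start of `A` passes all of `A` before it reaches an end again. -/
theorem defect_bound_start {m k : ℕ} {A G : ℕ → ℕ} {σ : ℕ → ℕ × Bool}
    (hσ : Run m A (k + 1) G σ) (hσ0 : σ 0 = (0, false))
    (he : σ (k + 1) = (0, false) ∨ σ (k + 1) = (m, true)) : m ≤ k := by
  by_contra hlt
  have s1 : σ 1 = (0, true) := by
    have := hσ 0 (by omega); rw [hσ0] at this; exact this.start_neg
  have := (hσ.forced s1 (k := k) (by omega) (by omega)).1 k le_rfl
  rw [show 1 + k = k + 1 by omega] at this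
  rw [this] at he
  simp at he
  omega

theorem not_deep_phase {m : ℕ} (hm : 2 ≤ m) {t : ℤ} (h : ¬ Deep m (phase m 0 (t - 1))) :
    t % (2 * m) = m ∨ t % (2 * m) = 2 * m - 1 ∨ t % (2 * m) = 0 := by
  have hr0 := Int.emod_nonneg (t - 1) (show (2 * m : ℤ) ≠ 0 by omega)
  have hr1 := Int.emod_lt_of_pos (t - 1) (show (0 : ℤ) < 2 * m by omega)
  have ht : t % (2 * m) = ((t - 1) % (2 * m) + 1) % (2 * m) := by
    rw [Int.emod_add_emod]; congr 1; ring
  rw [ht]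
  unfold phase at h
  generalize (t - 1) % (2 * m) = r at *
  by_cases c : r + 1 < 2 * m
  · rw [Int.emod_eq_of_lt (by omega) c]
    split_ifs at h with h1
    · simp only [Deep, Bool.true_eq_false, false_and, or_false, true_and] at h
      omega
    · simp only [Deep, Bool.false_eq_true, false_and, false_or, true_and] at h
      omega
  · have : r + 1 = 2 * m := by omega
    rw [this, Int.emod_self]
    omega

theorem not_deep_rev_phase {m : ℕ} (hm : 2 ≤ m) {t : ℤ} (h : ¬ Deep m (rev (phase m 0 t))) :
    t % (2 * m) = 0 ∨ t % (2 * m) = 1 ∨ t % (2 * m) = m := by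
  have hr0 := Int.emod_nonneg t (show (2 * m : ℤ) ≠ 0 by omega)
  have hr1 := Int.emod_lt_of_pos t (show (0 : ℤ) < 2 * m by omega)
  unfold phase at h
  generalize t % (2 * m) = r at *
  split_ifs at h with h1
  · simp only [Deep, rev, Bool.not_true, Bool.false_eq_true, false_and, false_or, true_and] at h
    omega
  · simp only [Deep, rev, Bool.not_false, Bool.true_eq_false, false_and, or_false, true_and] at h
    omega

theorem eq_of_emod_eq {P : ℤ → ℕ} {c : ℤ} (hper : ∀ j, P (j + c) = P j) {i j : ℤ}
    (h : c ∣ i - j) : P i = P j := by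
  rw [← periodic_emod hper i, ← periodic_emod hper j,
    Int.emod_eq_emod_iff_emod_sub_eq_zero.mpr (Int.emod_eq_zero_of_dvd h)]

/-- Around a vertex `τ` at which the word is mirrored, the word and the run stay regular: the
letters are those of the mirror-symmetric function `P` whose mirrors are `q + m ℤ`. -/
theorem Run.window {m n τ : ℕ} {A F : ℕ → ℕ} {α : ℕ → ℕ × Bool} {P : ℤ → ℕ} {q : ℤ} (hm : 2 ≤ m)
    (hm2 : Even m) (hA : ∀ i < m, 0 < A i) (hrun : Run m A n F α)
    (hα0 : rev (α 0) = (0, false) ∨ rev (α 0) = (m, true))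
    (hq : ∀ j, P (q - j) = P (q + j)) (hper : ∀ j, P (j + 2 * m) = P j)
    (hPA : ∀ i : ℕ, i + 1 < m → P (q + 1 + i) = A i) (hPZ : P (q + m) = 2 * A (m - 1))
    (hτ : ∀ j, P (τ - j) = P (τ + j)) (hF : F τ = P τ) (hα : α τ = phase m 0 (τ - q - 1))
    (hα' : α (τ + 1) = phase m 0 (τ - q))
    (hmir : ∀ x, x + 1 ≤ τ → τ + x < n ∧ F (τ - x) = F (τ + x))
    (hnd : ¬ (m : ℤ) ∣ τ - q) (hnalt : ¬ ∀ i, i + 2 < m → A i = A (i + 2)) :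
    ∀ x, x + 1 ≤ τ → α (τ - x) = phase m 0 (τ - x - q - 1) ∧
      α (τ + x + 1) = phase m 0 (τ + x - q) ∧ F (τ - x) = P (τ - x) ∧ F (τ + x) = P (τ + x) := by
  have reg : ∀ t : ℤ, Step m A (phase m 0 (t - q - 1)) (P t) (phase m 0 (t - q)) := by
    intro t
    have := step_phase (P := fun j => P (q + j)) (g := m) (z₀ := 0) (z₁ := 1) (E := m) (e := A)
      (by omega) (fun j => by rw [← sub_eq_add_neg, hq]) (fun j => by rw [← add_assoc, hper])
      (by omega) le_rfl rfl hm (fun r hr => by rw [add_zero, ← hPA r hr]; congr 1; ring)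
      (by omega) (fun _ => hPZ) (t - q - 1)
    simpa [show t - q - 1 + 1 = t - q by ring] using this
  -- the second symmetry of `A` when both sides of the window reach a mirror
  have symA : (∃ s : ℤ, 2 * (τ - q) = 2 * m * s + m) → ∀ i, i + 1 < m → A i = A (m - 2 - i) := by
    rintro ⟨s, hs⟩ i hi
    rw [← hPA i hi, ← hPA (m - 2 - i) (by omega)]
    have := hτ (τ - (q + 1 + i))
    rw [sub_sub_cancel] at this
    rw [this]
    apply eq_of_emod_eq hper
    refine ⟨s, ?_⟩
    rw [Nat.sub_sub, Nat.cast_sub (by omega)]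
    push_cast
    linarith
  have contra : (∃ s : ℤ, 2 * (τ - q) = 2 * m * s + m) →
      (∀ i, 1 ≤ i → i + 2 ≤ m → A i = A (m - i)) → False := by
    intro hs hd
    apply hnalt
    intro i hi
    rw [symA hs i (by omega)]
    by_cases h : i + 4 ≤ m
    · rw [hd (i + 2) (by omega) (by omega)]; congr 1; omega
    · rw [show m - 2 - i = 1 by omega, hd 1 le_rfl (by omega)]; congr 1; omega
  intro x
  induction x with
  | zero =>
    intro _
    simp only [Nat.sub_zero, Nat.cast_zero, sub_zero, add_zero]
    exact ⟨hα, hα', hF, hF⟩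
  | succ x ih =>
    intro hx
    obtain ⟨i1, i2, -, -⟩ := ih (by omega)
    obtain ⟨hn, hFF⟩ := hmir (x + 1) hx
    -- the two vertices read next
    obtain ⟨p, hp⟩ : ∃ p, p = τ + x + 1 := ⟨_, rfl⟩
    obtain ⟨p', hp'⟩ : ∃ p', p' = τ - x - 1 := ⟨_, rfl⟩
    have e1 : τ + (x + 1) = p := by omega
    have e2 : τ - (x + 1) = p' := by omega
    have z1 : ((τ : ℤ) + (x + 1 : ℕ)) = p := by omega
    have z2 : ((τ : ℤ) - (x + 1 : ℕ)) = p' := by omega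
    rw [e1, e2] at hFF ⊢
    rw [e1] at hn
    rw [z1, z2]
    have i1 : α (p' + 1) = phase m 0 (p' - q) := by
      rw [show p' + 1 = τ - x by omega, i1]; congr 1; omega
    have i2 : α p = phase m 0 (p - q - 1) := by
      rw [hp, i2]; congr 1; push_cast; ring
    have hPP : P p' = P p := by
      rw [← z1, ← z2]; exact hτ _
    have s1 := hrun p hn
    have s2 := (hrun p' (by omega)).symm
    have r1 := reg p
    have r2 := (reg p').symm
    rw [← i2] at r1
    rw [← i1] at r2
    have lefts : ∀ j < p', p + j < n ∧ F (p' - j) = F (p + j) := by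
      intro j hj
      obtain ⟨h1, h2⟩ := hmir (x + 1 + j) (by omega)
      refine ⟨by omega, ?_⟩
      rw [show p' - j = τ - (x + 1 + j) by omega, h2]; congr 1; omega
    have RL := (hrun.left (v := p') (k := p') (by omega) (by omega)).eq_F
      (G := fun j => F (p + j)) (fun j hj => (lefts j hj).2)
    have RL' := hrun.left (v := p') (k := p' + 1) (by omega) le_rfl
    have RR := hrun.right (v := p) (k := p') (by have := lefts (p' - 1) (by omega); omega)
    have hFP : F p = P p := by
      by_cases d1 : Deep m (α p)
      · exact (Step.deep d1 s1 r1).1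
      by_cases d2 : Deep m (rev (α (p' + 1)))
      · rw [← hFF, ← hPP]
        exact (Step.deep d2 s2 r2).1
      rw [i2] at d1
      rw [i1] at d2
      have c1 := not_deep_phase hm d1
      have c2 := not_deep_rev_phase hm d2
      have m1 := Int.mul_ediv_add_emod ((p : ℤ) - q) (2 * m)
      have m2 := Int.mul_ediv_add_emod ((p' : ℤ) - q) (2 * m)
      have hsum : (p : ℤ) + p' = 2 * τ := by omega
      obtain ⟨h, rfl⟩ := hm2
      generalize hs1 : ((p : ℤ) - q) / (2 * (h + h : ℕ)) = u at m1
      generalize hs2 : ((p' : ℤ) - q) / (2 * (h + h : ℕ)) = u' at m2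
      generalize ha : ((p : ℤ) - q) % (2 * (h + h : ℕ)) = a at *
      generalize hb : ((p' : ℤ) - q) % (2 * (h + h : ℕ)) = b at *
      have hh : 1 ≤ h := by omega
      have hM : 2 * ((h + h : ℕ) : ℤ) * u + 2 * (h + h : ℕ) * u' =
          2 * ((h + h : ℕ) * (u + u')) := by ring
      have hdiv : ∀ z : ℤ, (τ : ℤ) - q ≠ (h + h : ℕ) * z := fun z hz => hnd ⟨z, hz⟩
      have d0 := hdiv (u + u')
      have d1 := hdiv (u + u' + 1)
      have hM' : ((h + h : ℕ) : ℤ) * (u + u' + 1) = (h + h : ℕ) * (u + u') + (h + h : ℕ) := by ring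
      have hcase : (a = (h + h : ℕ) ∧ b = 0) ∨ (a = 0 ∧ b = (h + h : ℕ)) := by
        generalize ((h + h : ℕ) : ℤ) * (u + u') = M at *
        generalize 2 * ((h + h : ℕ) : ℤ) * u = M1 at *
        generalize 2 * ((h + h : ℕ) : ℤ) * u' = M2 at *
        omega
      have hhalf : ∃ s : ℤ, 2 * ((τ : ℤ) - q) = 2 * (h + h : ℕ) * s + (h + h : ℕ) := by
        refine ⟨u + u', ?_⟩
        rcases hcase with ⟨h1, h2⟩ | ⟨h1, h2⟩ <;> linarith
      rcases hcase with ⟨h1, h2⟩ | ⟨h1, h2⟩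
      · have t1 : α p = (h + h - 1, true) := by
          rw [i2, phase_congr (j := ((h + h : ℕ) : ℤ) - 1) ⟨u, by linarith⟩, phase,
            Int.emod_eq_of_lt (by omega) (by omega), if_pos (by omega)]
          simp only [Prod.mk.injEq, and_true]; omega
        have t2 : rev (α (p' + 1)) = (0, false) := by
          rw [i1, phase_congr (j := 0) ⟨u', by linarith⟩, phase, Int.zero_emod,
            if_pos (by omega)]
          rfl
        have hPp : P p = 2 * A (h + h - 1) := by
          rw [← hPZ]
          exact eq_of_emod_eq hper ⟨u, by linarith⟩
        rw [t1] at s1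
        rcases s1.before_end hm with ⟨-, hs⟩ | hs
        · exfalso
          refine contra hhalf (defect_symm hm RR RL ?_ ?_ ?_)
          · simpa using hs
          · simpa using t2
          · exact defect_bound_start RL' (by simpa using t2) (by simpa using hα0)
        · rw [hs, hPp]
      · have t1 : α p = (0, false) := by
          rw [i2, phase_congr (j := 2 * (h + h : ℕ) - 1) ⟨u - 1, by linarith⟩, phase,
            Int.emod_eq_of_lt (by omega) (by omega), if_neg (by omega)]
          simp only [Prod.mk.injEq, and_true]; omega
        have t2 : rev (α (p' + 1)) = (h + h - 1, true) := by
          rw [i1, phase_congr (j := ((h + h : ℕ) : ℤ)) ⟨u', by linarith⟩, phase,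
            Int.emod_eq_of_lt (by omega) (by omega), if_neg (by omega)]
          simp only [rev, Bool.not_false, Prod.mk.injEq, and_true]; omega
        have hPp : P p' = 2 * A (h + h - 1) := by
          rw [← hPZ]
          exact eq_of_emod_eq hper ⟨u', by linarith⟩
        rw [t2] at s2
        rcases s2.before_end hm with ⟨-, hs⟩ | hs
        · exfalso
          refine contra hhalf (defect_symm hm RL RR ?_ ?_ ?_)
          · simpa using hs
          · simpa using t1
          · exact defect_bound_end (by omega) RL' (by simpa using hs) (by simpa using hα0)
        · rw [← hFF, hs, ← hPp, hPP]
    refine ⟨?_, ?_, ?_, hFP⟩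
    · rw [hFF, hFP, ← hPP] at s2
      exact rev_inj (s2.det hm hA r2)
    · rw [hFP] at s1
      exact s1.det hm hA r1
    · rw [hFF, hFP, hPP]


theorem phase_eq_true {m e : ℕ} (hm : 0 < m) {j : ℤ} (h : phase m 0 j = (e, true)) :
    j % (2 * m) = e := by
  unfold phase at h
  have hr0 := Int.emod_nonneg j (show (2 * m : ℤ) ≠ 0 by omega)
  split_ifs at h
  · have := congrArg Prod.fst h; simp at this; omega
  · have := congrArg Prod.snd h; simp at this

theorem phase_eq_false {m e : ℕ} (hm : 0 < m) {j : ℤ} (h : phase m 0 j = (e, false)) :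
    j % (2 * m) = 2 * m - 1 - e := by
  unfold phase at h
  have hr1 := Int.emod_lt_of_pos j (show (0 : ℤ) < 2 * m by omega)
  split_ifs at h
  · have := congrArg Prod.snd h; simp at this
  · have := congrArg Prod.fst h; simp at this; omega

/-- When the window lemma applies, the second word is cut into an odd number of mirrored cells. -/
theorem window_cell {m n l τ y g h : ℕ} {A B F : ℕ → ℕ} {α : ℕ → ℕ × Bool} {P : ℤ → ℕ} {q s : ℤ}
    (hm : 2 ≤ m) (hA : ∀ i < m, 0 < A i) (hrun : Run m A n F α) (hτn : τ < n)
    (hα0 : α 0 = (0, true) ∨ α 0 = (m, false))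
    (hq : ∀ j, P (q - j) = P (q + j))
    (hPA : ∀ i : ℕ, i + 1 < m → P (q + 1 + i) = A i) (hPZ : P (q + m) = 2 * A (m - 1))
    (hτ : ∀ j, P (τ - j) = P (τ + j)) (hF : F τ = P τ) (hα : α τ = phase m 0 (τ - q - 1))
    (hα' : α (τ + 1) = phase m 0 (τ - q))
    (hmir : ∀ x, x + 1 ≤ τ → τ + x < n ∧ F (τ - x) = F (τ + x))
    (hnalt : ¬ ∀ i, i + 2 < m → A i = A (i + 2))
    (hB : ∀ i < τ, B i = F i) (hBpos : ∀ i < l, 0 < B i) (hl2 : Even l) (hy : y ≤ 1)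
    (hyl : τ + y = l) (hy1 : y = 1 → F τ = 2 * B (l - 1)) (hmτ : m ≤ τ)
    (hC : α 0 = (0, true) → B (l - 1) ≠ 2 * A (m - 1))
    (hg : 0 < g) (hperg : ∀ j, P (j + 2 * g) = P j) (hmg : m = 2 * h * g)
    (hs : (τ : ℤ) - q = (2 * s + 1) * g) :
    ∃ E e, Even E ∧ 2 ≤ E ∧ E < l ∧ (∀ i < E, 0 < e i) ∧ Acc E e l B := by
  have hm2 : Even m := ⟨h * g, by rw [hmg]; ring⟩
  have hh : 1 ≤ h := by
    rcases Nat.eq_zero_or_pos h with rfl | hh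
    · simp at hmg; omega
    · exact hh
  have hper : ∀ j, P (j + 2 * m) = P j := by
    intro j
    exact eq_of_emod_eq hperg ⟨2 * h, by rw [hmg]; push_cast; ring⟩
  have hnd : ¬ (m : ℤ) ∣ τ - q := by
    rintro ⟨z, hz⟩
    rw [hs, hmg] at hz
    push_cast at hz
    have : (2 * s + 1) * (g : ℤ) = (2 * (h * z)) * g := by rw [hz]; ring
    have := mul_right_cancel₀ (by omega : (g : ℤ) ≠ 0) this
    generalize (h : ℤ) * z = z' at this
    omega
  have hgτ : 2 * g ≤ τ := by
    have : g ≤ h * g := Nat.le_mul_of_pos_left g hh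
    have : m = 2 * (h * g) := by rw [hmg]; ring
    omega
  have win := hrun.window hm hm2 hA (by rcases hα0 with h | h <;> simp [rev, h]) hq hper hPA hPZ hτ
    hF hα hα' hmir hnd hnalt
  have hFP : ∀ t, 1 ≤ t → t ≤ τ → F t = P t := by
    intro t h1 h2
    have := (win (τ - t) (by omega)).2.2.1
    rw [show τ - (τ - t) = t by omega] at this
    rw [this]; congr 1; omega
  have hα1 : α 1 = phase m 0 (-q) := by
    have := (win (τ - 1) (by omega)).1
    rw [show τ - (τ - 1) = 1 by omega] at this
    rw [this]; congr 1; omega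
  have st := hrun 0 (by omega)
  rcases hα0 with h0 | h0
  · rw [h0] at st
    obtain ⟨a1, a2⟩ := st.from_start hm
    rw [zero_add] at a1
    rw [a1] at hα1
    have hr := phase_eq_true (by omega) hα1.symm
    have hdv : (2 * m : ℤ) ∣ -q - 1 := by
      rw [Int.dvd_iff_emod_eq_zero, ← Int.emod_eq_emod_iff_emod_sub_eq_zero, hr,
        Int.emod_eq_of_lt (by omega) (by omega)]; rfl
    obtain ⟨w, hw⟩ := hdv
    have hD : ((τ + 1 : ℕ) : ℤ) = (2 * (s - 2 * h * w) + 1) * g + 2 * (2 * h * g + q + 1) * 0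
        + (-q - 1 + (τ + 1) - (τ - q)) := by
      have : q = -1 - 2 * m * w := by linarith
      push_cast
      have h3 : (τ : ℤ) = (2 * s + 1) * g + q := by linarith
      rw [h3, this, hmg]; push_cast; ring
    have hD' : ((τ + 1 : ℕ) : ℤ) = (2 * (s - 2 * h * w) + 1) * g := by
      rw [hD]; ring
    have hk0 : 0 ≤ s - 2 * h * w := by
      by_contra hneg
      have : (2 * (s - 2 * h * w) + 1) * (g : ℤ) ≤ 0 :=
        mul_nonpos_of_nonpos_of_nonneg (by omega) (by omega)
      omega
    obtain ⟨k, hk⟩ := Int.eq_ofNat_of_zero_le hk0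
    rw [hk] at hD'
    have hD2 : τ + 1 = (2 * k + 1) * g := by exact_mod_cast hD'
    have hE2 : Even (g + y - 1) := by
      have : l + 1 = 2 * (k * g) + g + y := by
        have : (2 * k + 1) * g = 2 * (k * g) + g := by ring
        omega
      rw [Nat.even_iff] at hl2 ⊢
      omega
    have hE0 : g + y - 1 ≠ 0 := by
      intro h1
      have g1 : g = 1 := by omega
      have y0 : y = 0 := by omega
      apply hC h0
      rw [← hPZ, hB _ (by omega), hFP _ (by omega) (by omega)]
      apply eq_of_emod_eq hperg
      refine ⟨s - h, ?_⟩
      rw [Nat.cast_sub (by omega), hmg, g1]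
      rw [g1] at hs
      have : (τ : ℤ) = l := by omega
      push_cast at hs ⊢
      linarith
    have hE3 : 2 ≤ g + y - 1 := by
      rw [Nat.even_iff] at hE2; omega
    refine ⟨g + y - 1, _, hE2, hE3, by omega, ?_, acc_cell (P := fun j => P (-1 + j)) (k := k) hg
      (fun j => ?_) (fun j => by rw [← add_assoc, hperg]) (z₀ := 0) (z₁ := y) (by omega) hy
      (by omega) (by omega) hE3 (fun i _ hi => ?_) (by omega) (fun hy' => ?_)⟩
    · intro i hi; split_ifs
      · exact hBpos _ (by omega)
      · exact hBpos _ (by omega)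
    · have := hq (-1 + -j - q)
      rw [show q + (-1 + -j - q) = -1 + -j by ring] at this
      rw [← this]
      apply eq_of_emod_eq hper
      exact ⟨-2 * w, by linarith⟩
    · rw [hB i (by omega)]
      by_cases hi0 : i = 0
      · subst hi0
        rw [a2, ← hPA 0 (by omega)]
        exact eq_of_emod_eq hper ⟨-w, by push_cast; linarith⟩
      · rw [hFP i (by omega) (by omega)]
        congr 1; push_cast; ring
    · rw [← hy1 hy', hF, ← hD2]
      congr 1; push_cast; ring
  · rw [h0] at st
    obtain ⟨a2, a1⟩ := Step.deep (Or.inr ⟨rfl, by simp only; omega⟩) st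
      (Or.inr (Or.inr (Or.inr (Or.inl ⟨rfl, by simp only; omega, le_rfl, rfl, rfl⟩))))
    rw [zero_add] at a1
    simp only at a1 a2
    rw [a1] at hα1
    have hr := phase_eq_false (by omega) hα1.symm
    have hdv : (2 * m : ℤ) ∣ -q - m := by
      rw [Int.dvd_iff_emod_eq_zero, ← Int.emod_eq_emod_iff_emod_sub_eq_zero, hr,
        Int.emod_eq_of_lt (by omega) (by omega)]
      rw [Nat.cast_sub (by omega)]; push_cast; ring
    obtain ⟨w, hw⟩ := hdv
    have hD' : (τ : ℤ) = (2 * (s - h - 2 * h * w) + 1) * g := by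
      have h4 : q = - m - 2 * m * w := by linarith
      have h3 : (τ : ℤ) = (2 * s + 1) * g + q := by linarith
      rw [h3, h4, hmg]; push_cast; ring
    have hk0 : 0 ≤ s - h - 2 * h * w := by
      by_contra hneg
      have : (2 * (s - h - 2 * h * w) + 1) * (g : ℤ) ≤ 0 :=
        mul_nonpos_of_nonpos_of_nonneg (by omega) (by omega)
      omega
    obtain ⟨k, hk⟩ := Int.eq_ofNat_of_zero_le hk0
    rw [hk] at hD'
    have hD2 : τ = (2 * k + 1) * g := by exact_mod_cast hD'
    have hE2 : Even (g + y) := by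
      have : l = 2 * (k * g) + g + y := by
        have : (2 * k + 1) * g = 2 * (k * g) + g := by ring
        omega
      rw [Nat.even_iff] at hl2 ⊢
      omega
    have hE3 : 2 ≤ g + y := by
      rw [Nat.even_iff] at hE2; omega
    refine ⟨g + y, _, hE2, hE3, by omega, ?_, acc_cell (P := P) (k := k) hg
      (fun j => ?_) hperg (z₀ := 1) (z₁ := y) (by omega) hy
      (by omega) (by omega) hE3 (fun i hi' hi => ?_) (fun _ => ?_) (fun hy' => ?_)⟩
    · intro i hi; split_ifs
      · exact hBpos _ (by omega)
      · exact hBpos _ (by omega)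
    · have := hq (-j - q)
      rw [show q + (-j - q) = -j by ring] at this
      rw [← this]
      apply eq_of_emod_eq hper
      exact ⟨-2 * w - 1, by linarith⟩
    · rw [hB i (by omega), hFP i (by omega) (by omega)]
      congr 1; push_cast; ring
    · rw [hB 0 (by omega), a2, ← hPZ]
      exact eq_of_emod_eq hper ⟨w, by linarith⟩
    · rw [← hy1 hy', hF, ← hD2]

/-- The even function of period `2 * T` with given values on `0, …, T`. -/
def mirrorExt (f : ℕ → ℕ) (T : ℕ) (j : ℤ) : ℕ :=
  if j % (2 * T) ≤ T then f (j % (2 * T)).toNat else f (2 * T - (j % (2 * T)).toNat)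

theorem mirrorExt_add (f : ℕ → ℕ) (T : ℕ) (j : ℤ) :
    mirrorExt f T (j + 2 * T) = mirrorExt f T j := by simp [mirrorExt]

theorem mirrorExt_of_le {f : ℕ → ℕ} {T j : ℕ} (hT : 0 < T) (hj : j ≤ T) :
    mirrorExt f T j = f j := by
  rw [mirrorExt, Int.emod_eq_of_lt (by omega) (by omega), if_pos (by omega)]
  rfl

theorem mirrorExt_neg {f : ℕ → ℕ} {T : ℕ} (hT : 0 < T) (j : ℤ) :
    mirrorExt f T (-j) = mirrorExt f T j := by
  have hr0 := Int.emod_nonneg j (show (2 * T : ℤ) ≠ 0 by omega)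
  have hr1 := Int.emod_lt_of_pos j (show (0 : ℤ) < 2 * T by omega)
  have h1 : (-j) % (2 * T) = (-(j % (2 * T))) % (2 * T) := (Int.mod_modEq j (2 * T)).neg.symm
  unfold mirrorExt
  rw [h1]
  generalize j % (2 * T) = r at *
  by_cases h0 : r = 0
  · subst h0; simp
  · have : (-r) % (2 * T) = 2 * T - r := by
      rw [← Int.add_emod_right, Int.emod_eq_of_lt (by omega) (by omega)]; ring
    rw [this]
    split_ifs
    · congr 1; omega
    · congr 1; omega
    · congr 1; omega
    · omega

theorem period_gcd {P : ℤ → ℕ} {a b : ℕ} (ha : ∀ j, P (j + 2 * a) = P j)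
    (hb : ∀ j, P (j + 2 * b) = P j) (j : ℤ) : P (j + 2 * (Nat.gcd a b : ℕ)) = P j := by
  have h1 : Function.Periodic P (2 * a : ℤ) := ha
  have h2 : Function.Periodic P (2 * b : ℤ) := hb
  rw [Nat.gcd_eq_gcd_ab]
  have h3 := (h1.int_mul (Nat.gcdA a b)).add_period (h2.int_mul (Nat.gcdB a b))
  have := h3 j
  rw [← this]
  congr 1
  simp only [Int.cast_id]
  ring


/-! ### Cells between consecutive turns -/

/-- The first letters of a word, with the data of a turn at the vertex `τ` after them: either all
`l` letters have been read (`y = 0`), or the last letter, doubled, is about to be read (`y = 1`);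
the steps around `τ` are mirrored. -/
structure MirrorAt (l : ℕ) (B : ℕ → ℕ) (n : ℕ) (F : ℕ → ℕ) (τ y : ℕ) : Prop where
  lt : τ < n
  init : ∀ i < τ, B i = F i
  le_one : y ≤ 1
  add_eq : τ + y = l
  double : y = 1 → F τ = 2 * B (l - 1)
  mirror : ∀ x, x + 1 ≤ τ → τ + x < n ∧ F (τ - x) = F (τ + x)

/-- Let `κ < κ'` be consecutive turns of one run, with `A` read forwards between them, and let the
other run make its first turn at `τ` between them. The word is mirrored at `κ`, `κ'` and `τ`, hence
coincides there with an even function whose mirrors have the distance `g = gcd (κ' - κ) (τ - κ)`. If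
`κ' - κ` is an odd multiple of `g` then `A` is cut into an odd number of cells of length `g`;
otherwise `τ - κ` is such a multiple, and the regular pattern around `τ` cuts `B`. -/
theorem exists_cell_of_forward {m n l τ y κ κ' : ℕ} {A B F : ℕ → ℕ} {α : ℕ → ℕ × Bool}
    (hm : 2 ≤ m) (hm2 : Even m) (hl2 : Even l) (hA : ∀ i < m, 0 < A i) (hB : ∀ i < l, 0 < B i)
    (hrun : Run m A n F α)
    (hα0 : α 0 = (0, true) ∨ α 0 = (m, false)) (hαn : α n = (0, false) ∨ α n = (m, true))
    (hτ : MirrorAt l B n F τ y) (hκ : κ < τ) (hκ' : τ < κ') (hκn : κ' < n)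
    (ht : α (κ + 1) = rev (α κ)) (ht' : α (κ' + 1) = rev (α κ'))
    (hno : ∀ t, κ < t → t < κ' → α (t + 1) ≠ rev (α t)) (hdir : (α (κ + 1)).2 = true)
    (hT : κ' - κ ≤ τ) (hnalt : ¬ ∀ i, i + 2 < m → A i = A (i + 2))
    (hC : α 0 = (0, true) → B (l - 1) ≠ 2 * A (m - 1))
    (hC' : α 0 = (m, false) → B (l - 1) ≠ 2 * A 0) :
    ∃ E e, Even E ∧ 2 ≤ E ∧ (∀ i < E, 0 < e i) ∧
      ((E < m ∧ Acc E e m A) ∨ (E < l ∧ Acc E e l B)) := by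
  -- the turn at `κ`
  obtain ⟨ζ, hζ1, hζ, hζF⟩ : ∃ ζ : ℕ, ζ ≤ 1 ∧ α (κ + 1) = (ζ, true) ∧ (ζ = 1 → F κ = 2 * A 0) := by
    have h1 := hrun κ (by omega)
    rw [ht] at h1 hdir
    rcases h1.turn with ⟨h2, -⟩ | h2 | ⟨h2, h3⟩ | h2
    · simp [rev, h2] at hdir
    · simp [rev, h2] at hdir
    · exact ⟨1, le_rfl, by rw [ht, h2]; rfl, fun _ => h3⟩
    · exact ⟨0, by omega, by rw [ht, h2]; rfl, by omega⟩
  obtain ⟨T, hTe⟩ : ∃ T, κ + T = κ' := ⟨κ' - κ, by omega⟩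
  obtain ⟨u, hue⟩ : ∃ u, κ + u = τ := ⟨τ - κ, by omega⟩
  obtain ⟨s1, s2⟩ := hrun.straight hm hζ (k := T - 1) (by omega)
    (fun t h1 h2 => hno t (by omega) (by omega))
  have hst : ∀ j, 1 ≤ j → j ≤ T → α (κ + j) = (ζ + (j - 1), true) := by
    intro j h1 h2
    rw [← s1 (j - 1) (by omega)]; congr 1; omega
  have hFA : ∀ j, 1 ≤ j → j < T → ζ + (j - 1) < m ∧ F (κ + j) = A (ζ + (j - 1)) := by
    intro j h1 h2
    have := s2 (j - 1) (by omega)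
    rwa [show κ + 1 + (j - 1) = κ + j by omega] at this
  -- the turn at `κ'`
  obtain ⟨ζ', hζ'1, hζ', hζ'F⟩ : ∃ ζ' : ℕ, ζ' ≤ 1 ∧ T + ζ + ζ' = m + 1 ∧
      (ζ' = 1 → F κ' = 2 * A (m - 1)) := by
    have h1 := hrun κ' (by omega)
    rw [ht'] at h1
    have h0 := hst T (by omega) le_rfl
    rw [hTe] at h0
    rw [h0] at h1
    rcases h1.turn with ⟨-, h2, h3⟩ | h2 | ⟨h2, h3⟩ | h2
    · simp only at h2
      exact ⟨1, le_rfl, by omega, fun _ => h3⟩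
    · simp at h2
      exact ⟨0, by omega, by omega, by omega⟩
    · simp at h2
    · simp at h2
  have hTpos : 0 < T := by omega
  -- the word is mirrored at `κ` and at `κ'`
  have mb : ∀ x ≤ T - 2, x ≤ κ ∧ F (κ - x) = F (κ + x) := by
    intro x hx
    have := hrun.mirror_before (v := κ) (X := T - 2) (by
      rcases hα0 with h | h <;> simp [h, rev, Deep]) (by omega) ht
      (fun x h1 h2 => ⟨by omega, by
        rw [hst x h1 (by omega)]; left; refine ⟨rfl, ?_⟩; simp only; omega⟩) x hx
    exact ⟨this.1, this.2.2⟩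
  have ma : ∀ x ≤ T - 2, κ' + x < n ∧ F (κ' - x) = F (κ' + x) := by
    intro x hx
    have := hrun.mirror_after (v := κ') (X := T - 2) (by
      rcases hαn with h | h <;> simp [h, Deep]) (by omega) ht'
      (fun x h1 h2 => ⟨by omega, by
        rw [show κ' - x + 1 = κ + (T - x + 1) by omega, hst _ (by omega) (by omega)]
        right; refine ⟨rfl, ?_⟩; simp only [rev]; omega⟩) x hx
    exact ⟨this.1, this.2.2⟩
  -- the mirror-symmetric extension
  obtain ⟨P, hP⟩ : ∃ P, P = mirrorExt (fun i => F (κ + i)) T := ⟨_, rfl⟩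
  have hPneg : ∀ j, P (-j) = P j := by rw [hP]; exact mirrorExt_neg hTpos
  have hPper : ∀ j, P (j + 2 * T) = P j := by rw [hP]; exact mirrorExt_add _ T
  have hPF : ∀ j ≤ T, P j = F (κ + j) := by
    intro j hj; rw [hP]; exact mirrorExt_of_le hTpos hj
  have hPR : ∀ j, j + 2 ≤ 2 * T → P j = F (κ + j) := by
    intro j hj
    rcases le_or_gt j T with h | h
    · exact hPF j h
    · have := (ma (j - T) (by omega)).2
      rw [show κ + j = κ' + (j - T) by omega, ← this, ← hPneg, ← hPper,
        show -(j : ℤ) + 2 * T = ((2 * T - j : ℕ) : ℤ) by omega, hPF _ (by omega)]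
      congr 1; omega
  have hPL : ∀ j, j + 2 ≤ T → P (-j) = F (κ - j) := by
    intro j hj
    rw [(mb j (by omega)).2, hPneg, hPF j (by omega)]
  have hPu' : ∀ x : ℕ, x ≤ T → P (u - x) = P (u + x) := by
    intro x hx
    rcases Nat.lt_or_ge x T with h | h
    · have := (hτ.mirror x (by omega)).2
      have hR := hPR (u + x) (by omega)
      push_cast at hR
      rw [hR, show κ + (u + x) = τ + x by omega, ← this]
      rcases le_or_gt x u with h1 | h1
      · have := hPF (u - x) (by omega)
        rw [Nat.cast_sub h1] at this
        rw [this]; congr 1; omega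
      · have := hPL (x - u) (by omega)
        rw [Nat.cast_sub h1.le, neg_sub] at this
        rw [this]; congr 1; omega
    · obtain rfl : x = T := by omega
      rw [← hPper]; congr 1; ring
  have hPu : ∀ j : ℤ, P (u - j) = P (u + j) := by
    intro j
    have hr0 := Int.emod_nonneg j (show (2 * T : ℤ) ≠ 0 by omega)
    have hr1 := Int.emod_lt_of_pos j (show (0 : ℤ) < 2 * T by omega)
    have hj := Int.mul_ediv_add_emod j (2 * T)
    obtain ⟨r, hr⟩ : ∃ r : ℕ, j % (2 * T) = r := ⟨(j % (2 * T)).toNat, by omega⟩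
    rw [hr] at hj hr1
    have e1 : P (u - j) = P (u - r) := eq_of_emod_eq hPper ⟨-(j / (2 * T)), by linarith⟩
    have e2 : P (u + j) = P (u + r) := eq_of_emod_eq hPper ⟨j / (2 * T), by linarith⟩
    rw [e1, e2]
    rcases le_or_gt r T with h | h
    · exact hPu' r h
    · have := hPu' (2 * T - r) (by omega)
      rw [Nat.cast_sub (by omega)] at this
      rw [← hPper (u - r), ← hPper (u - _)] at *
      rw [show (u : ℤ) - r + 2 * T = u + ((2 * T : ℕ) - r : ℤ) by push_cast; ring, ← this]
      congr 1; push_cast; ring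
  have hper2 : ∀ j, P (j + 2 * u) = P j := by
    intro j
    have := hPu (-u - j)
    rw [show (u : ℤ) - (-u - j) = j + 2 * u by ring, show (u : ℤ) + (-u - j) = -j by ring,
      hPneg] at this
    exact this
  obtain ⟨g, hg⟩ : ∃ g, g = Nat.gcd u T := ⟨_, rfl⟩
  have hgper : ∀ j, P (j + 2 * g) = P j := by rw [hg]; exact period_gcd hper2 hPper
  have hgu : g ∣ u := hg ▸ Nat.gcd_dvd_left u T
  have hgT : g ∣ T := hg ▸ Nat.gcd_dvd_right u T
  have hg0 : 0 < g := Nat.pos_of_dvd_of_pos hgT hTpos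
  have hgu' : g ≤ u := Nat.le_of_dvd (by omega) hgu
  obtain ⟨c, hc⟩ := hgT
  obtain ⟨d, hd⟩ := hgu
  have hcop : Nat.Coprime d c := by
    have : g * Nat.gcd d c = g * 1 := by rw [← Nat.gcd_mul_left, ← hc, ← hd, mul_one, hg]
    exact Nat.eq_of_mul_eq_mul_left hg0 this
  rcases Nat.even_or_odd c with ⟨h, hch⟩ | ⟨k, hck⟩
  · -- an even number of cells: exactly one of the turns reads a doubled letter
    have hTm : T = 2 * h * g := by rw [hc, hch]; ring
    have hd2 : Odd d := by
      rw [← Nat.not_even_iff_odd]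
      rintro ⟨d', hd'⟩
      have : 2 ∣ Nat.gcd d c := Nat.dvd_gcd ⟨d', by omega⟩ ⟨h, by omega⟩
      rw [hcop] at this
      omega
    obtain ⟨d', hd'⟩ := hd2
    have hTeven : T = 2 * (h * g) := by rw [hTm]; ring
    have hTm' : T = m := by rw [Nat.even_iff] at hm2; omega
    subst hTm'
    have hu1 : α τ = (ζ + (u - 1), true) := by rw [← hue]; exact hst u (by omega) (by omega)
    have hu2 : α (τ + 1) = (ζ + u, true) := by
      have := hst (u + 1) (by omega) (by omega)
      rwa [← add_assoc, hue, Nat.add_sub_cancel] at this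
    rcases (by omega : (ζ = 0 ∧ ζ' = 1) ∨ (ζ = 1 ∧ ζ' = 0)) with ⟨z0, z1⟩ | ⟨z0, z1⟩
    · subst z0
      obtain ⟨E, e, w1, w2, w3, w4, w5⟩ := window_cell (P := fun t => P (t - κ)) (q := κ) (s := d')
        (g := g) (h := h) hm hA hrun hτ.lt
        hα0 (fun j => by
          rw [show (κ : ℤ) - j - κ = -j by ring, hPneg]; congr 1; ring)
        (fun i hi => by
          rw [show (κ : ℤ) + 1 + i - κ = ((i + 1 : ℕ) : ℤ) by push_cast; ring, hPF _ (by omega),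
            (hFA (i + 1) (by omega) (by omega)).2]
          congr 1; omega)
        (by
          rw [show (κ : ℤ) + T - κ = T by ring, hPF _ le_rfl, hTe, hζ'F z1])
        (fun j => by
          rw [show (τ : ℤ) - j - κ = u - j by omega, show (τ : ℤ) + j - κ = u + j by omega, hPu])
        (by
          rw [show (τ : ℤ) - κ = u by omega, hPF _ (by omega), hue])
        (by
          rw [hu1, show (τ : ℤ) - κ - 1 = ((u - 1 : ℕ) : ℤ) by omega, phase,
            Int.emod_eq_of_lt (by omega) (by omega), if_pos (by omega)]
          simp)
        (by
          rw [hu2, show (τ : ℤ) - κ = u by omega, phase,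
            Int.emod_eq_of_lt (by omega) (by omega), if_pos (by omega)]
          simp)
        hτ.mirror hnalt hτ.init hB hl2 hτ.le_one hτ.add_eq hτ.double (by omega) hC hg0
        (fun j => by
          rw [show j + 2 * (g : ℤ) - κ = j - κ + 2 * g by ring, hgper])
        hTm (by rw [show (τ : ℤ) - κ = u by omega, hd, hd']; push_cast; ring)
      exact ⟨E, e, w1, w2, w4, Or.inr ⟨w3, w5⟩⟩
    · subst z0
      have hfl : ∀ i, flipW T A (T - 1 - i) = A (T - 1 - (T - 1 - i)) := fun i => rfl
      obtain ⟨E, e, w1, w2, w3, w4, w5⟩ := window_cell (P := fun t => P (t - κ)) (q := κ')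
        (s := (d' : ℤ) - h) (A := flipW T A) (α := fun t => flipS T (α t))
        (g := g) (h := h) hm (fun i hi => hA _ (by omega)) (hrun.flip hm) hτ.lt
        (by rcases hα0 with h | h <;> simp [flipS, h])
        (fun j => by
          rw [show (κ' : ℤ) - j - κ = -(j - T) by omega, hPneg, ← hPper]; congr 1; omega)
        (fun i hi => by
          rw [← hPneg, ← hPper, show -((κ' : ℤ) + 1 + i - κ) + 2 * T =
            ((T - 1 - i : ℕ) : ℤ) by omega,
            hPF _ (by omega), (hFA _ (by omega) (by omega)).2, flipW]
          congr 1; omega)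
        (by
          rw [show (κ' : ℤ) + T - κ = ((0 : ℕ) : ℤ) + 2 * T by omega, hPper, hPF _ (by omega),
            add_zero, hζF rfl, flipW]
          congr 2; omega)
        (fun j => by
          rw [show (τ : ℤ) - j - κ = u - j by omega, show (τ : ℤ) + j - κ = u + j by omega, hPu])
        (by
          rw [show (τ : ℤ) - κ = u by omega, hPF _ (by omega), hue])
        (by
          rw [hu1, ← phase_add_period, show (τ : ℤ) - κ' - 1 + 2 * T =
            ((u + T - 1 : ℕ) : ℤ) by omega,
            phase, Int.emod_eq_of_lt (by omega) (by omega), if_neg (by omega)]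
          simp only [flipS, Bool.not_true, Prod.mk.injEq, and_true]; omega)
        (by
          rw [hu2, ← phase_add_period, show (τ : ℤ) - κ' + 2 * T = ((u + T : ℕ) : ℤ) by omega,
            phase, Int.emod_eq_of_lt (by omega) (by omega), if_neg (by omega)]
          simp only [flipS, Bool.not_true, Prod.mk.injEq, and_true]; omega)
        hτ.mirror (fun hall => hnalt fun i hi => by
          have := hall (T - 3 - i) (by omega)
          simp only [flipW] at this
          rw [show T - 1 - (T - 3 - i) = i + 2 by omega,
            show T - 1 - (T - 3 - i + 2) = i by omega] at this
          exact this.symm)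
        hτ.init hB hl2 hτ.le_one hτ.add_eq hτ.double (by omega)
        (fun h0 => by
          have h1 := hC' (by
            rcases hα0 with h | h
            · simp [flipS, h] at h0
            · exact h)
          simpa [flipW] using h1) hg0
        (fun j => by
          rw [show j + 2 * (g : ℤ) - κ = j - κ + 2 * g by ring, hgper])
        hTm (by
          have : (T : ℤ) = 2 * h * g := by rw [hTm]; push_cast; ring
          rw [show (τ : ℤ) - κ' = u - T by omega, this, hd, hd']; push_cast; ring)
      exact ⟨E, e, w1, w2, w4, Or.inr ⟨w3, w5⟩⟩
  · -- an odd number of cells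
    have hTg : T = (2 * k + 1) * g := by rw [hc, hck]; ring
    have hTg' : T = 2 * (k * g) + g := by rw [hTg]; ring
    have hE2 : Even (g + ζ + ζ' - 1) := by
      rw [Nat.even_iff] at hm2 ⊢; omega
    have hE3 : 2 ≤ g + ζ + ζ' - 1 := by
      by_contra hlt
      rw [Nat.even_iff] at hE2
      have g1 : g = 1 := by omega
      apply hnalt
      intro i hi
      have a1 := hFA (i + 1) (by omega) (by omega)
      have a2 := hFA (i + 3) (by omega) (by omega)
      rw [show ζ + (i + 1 - 1) = i by omega] at a1
      rw [show ζ + (i + 3 - 1) = i + 2 by omega] at a2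
      rw [← a1.2, ← a2.2, ← hPF _ (by omega), ← hPF _ (by omega), ← hgper, g1]
      congr 1
    refine ⟨g + ζ + ζ' - 1, _, hE2, hE3, ?_, Or.inl ⟨by omega, acc_cell (P := P) (k := k) hg0 hPneg
      hgper (z₀ := ζ) (z₁ := ζ') hζ1 hζ'1 (by omega) (by omega) hE3 (fun i h1 h2 => ?_)
      (fun h => ?_) (fun h => ?_)⟩⟩
    · intro i hi; split_ifs
      · exact hA _ (by omega)
      · exact hA _ (by omega)
    · have := hFA (i + 1 - ζ) (by omega) (by omega)
      rw [show (i : ℤ) + 1 - ζ = ((i + 1 - ζ : ℕ) : ℤ) by omega, hPF _ (by omega), this.2]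
      congr 1; omega
    · have := hPF 0 (by omega)
      rw [Nat.cast_zero] at this
      rw [this, add_zero, hζF h]
    · rw [← hTg, hPF _ le_rfl, hTe, hζ'F h]

/-- The case in which `A` is read backwards between the two turns is reduced to the other one by
reversing `A`. -/
theorem exists_cell {m n l τ y κ κ' : ℕ} {A B F : ℕ → ℕ} {α : ℕ → ℕ × Bool}
    (hm : 2 ≤ m) (hm2 : Even m) (hl2 : Even l) (hA : ∀ i < m, 0 < A i) (hB : ∀ i < l, 0 < B i)
    (hrun : Run m A n F α) (hα0 : α 0 = (0, true)) (hαn : α n = (m, true))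
    (hτ : MirrorAt l B n F τ y) (hκ : κ < τ) (hκ' : τ < κ') (hκn : κ' < n)
    (ht : α (κ + 1) = rev (α κ)) (ht' : α (κ' + 1) = rev (α κ'))
    (hno : ∀ t, κ < t → t < κ' → α (t + 1) ≠ rev (α t))
    (hT : κ' - κ ≤ τ) (hnalt : ¬ ∀ i, i + 2 < m → A i = A (i + 2))
    (hC : B (l - 1) ≠ 2 * A (m - 1)) :
    ∃ E e, Even E ∧ 2 ≤ E ∧ (∀ i < E, 0 < e i) ∧
      ((E < m ∧ Acc E e m A) ∨ (E < l ∧ Acc E e l B)) := by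
  by_cases hdir : (α (κ + 1)).2 = true
  · exact exists_cell_of_forward hm hm2 hl2 hA hB hrun (Or.inl hα0) (Or.inr hαn)
      hτ hκ hκ' hκn ht ht'
      hno hdir hT hnalt (fun _ => hC) (fun h => by rw [hα0] at h; simp at h)
  · obtain ⟨E, e, h1, h2, h3, h4⟩ := exists_cell_of_forward (A := flipW m A)
      (α := fun t => flipS m (α t)) hm hm2 hl2 (fun i hi => hA _ (by omega)) hB (hrun.flip hm)
      (Or.inr (by simp [flipS, hα0])) (Or.inl (by simp [flipS, hαn])) hτ hκ hκ' hκn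
      (by rw [ht, flipS_rev]) (by rw [ht', flipS_rev])
      (fun t h1 h2 h => by
        rw [← flipS_rev] at h
        have ha := (hrun t (by omega)).le hm
        refine hno t h1 h2 (Prod.ext ?_ ?_)
        · have := congrArg Prod.fst h
          simp only [flipS, rev] at this ⊢
          omega
        · have := congrArg Prod.snd h
          simpa [flipS] using this)
      (by simpa [flipS] using hdir) hT
      (fun hall => hnalt fun i hi => by
          have := hall (m - 3 - i) (by omega)
          simp only [flipW] at this
          rw [show m - 1 - (m - 3 - i) = i + 2 by omega,
            show m - 1 - (m - 3 - i + 2) = i by omega] at this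
          exact this.symm)
      (fun h => by simp [flipS, hα0] at h)
      (fun _ => by simpa [flipW] using hC)
    rcases h4 with ⟨h4, h5⟩ | h4
    · refine ⟨E, flipW E e, h1, h2, fun i hi => h3 _ (by omega), Or.inl ⟨h4, ?_⟩⟩
      exact (h5.flip h2).congr h2 (fun _ _ => rfl) (fun i hi => flipW_flipW hi)
    · exact ⟨E, e, h1, h2, h3, Or.inr h4⟩


/-! ### The first turns of a run -/

theorem acc_pos {m n : ℕ} {α : ℕ → ℕ × Bool} (hm : 2 ≤ m)
    (h0 : α 0 = (0, true)) (hn : α n = (m, true)) : 0 < n := by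
  rcases Nat.eq_zero_or_pos n with rfl | h
  · rw [h0] at hn; simp at hn; omega
  · exact h

theorem Run.last_eq {m n : ℕ} {A F : ℕ → ℕ} {α : ℕ → ℕ × Bool} (hm : 2 ≤ m)
    (h : Run m A n F α) (h0 : α 0 = (0, true)) (hn : α n = (m, true)) :
    F (n - 1) = A (m - 1) := by
  have hp := acc_pos hm h0 hn
  have := h (n - 1) (by omega)
  rw [Nat.sub_add_cancel (by omega), hn] at this
  exact (this.to_end hm).2

theorem Run.first_eq {m n : ℕ} {A F : ℕ → ℕ} {α : ℕ → ℕ × Bool} (hm : 2 ≤ m)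
    (h : Run m A n F α) (h0 : α 0 = (0, true)) (hn : α n = (m, true)) : F 0 = A 0 := by
  have := h 0 (acc_pos hm h0 hn)
  rw [h0] at this
  exact (this.from_start hm).2

/-- Up to its first turn a run reads the word itself. -/
theorem Run.first_turn {l n τ : ℕ} {B F : ℕ → ℕ} {β : ℕ → ℕ × Bool} (hl : 2 ≤ l)
    (h : Run l B n F β) (h0 : β 0 = (0, true)) (hn : β n = (l, true)) (hτ : τ < n)
    (ht : β (τ + 1) = rev (β τ)) (hno : ∀ t < τ, β (t + 1) ≠ rev (β t)) :
    β τ = (τ, true) ∧ ∃ y, MirrorAt l B n F τ y := by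
  obtain ⟨s1, s2⟩ := h.straight hl h0 (k := τ) (by omega) (fun t _ ht => hno t (by omega))
  simp only [zero_add] at s1 s2
  have hτ' := s1 τ le_rfl
  have hmir := h.mirror_after (v := τ) (X := τ - 1) (by rw [hn]; simp [Deep]) hτ ht
    (fun x h1 h2 => ⟨by omega, by rw [s1 _ (by omega)]; right; simp [rev]; omega⟩)
  have st := h τ hτ
  rw [ht] at st
  refine ⟨hτ', ?_⟩
  obtain ⟨y, hy1, hy2, hy3⟩ : ∃ y, y ≤ 1 ∧ τ + y = l ∧ (y = 1 → F τ = 2 * B (l - 1)) := by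
    rw [hτ'] at st
    rcases st.turn with ⟨-, h1, h2⟩ | h1 | ⟨h1, -⟩ | h1
    · exact ⟨1, le_rfl, h1, fun _ => h2⟩
    · simp at h1; exact ⟨0, by omega, by omega, by omega⟩
    · simp at h1
    · simp at h1
  exact ⟨y, hτ, fun i hi => (s2 i hi).2.symm, hy1, hy2, hy3,
    fun x hx => ⟨(hmir x (by omega)).1, (hmir x (by omega)).2.2⟩⟩

/-- After its first turn a run goes back to the start of the word and turns there, either reading
the first letter doubled or reading a connector. -/
theorem Run.second_turn {l n τ : ℕ} {B F : ℕ → ℕ} {β : ℕ → ℕ × Bool} (hl : 2 ≤ l)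
    (h : Run l B n F β) (hn : β n = (l, true)) (hτ : τ < n)
    (ht : β (τ + 1) = rev (β τ)) (hβ : β τ = (τ, true)) :
    ∃ O, τ < O ∧ O < n ∧ β (O + 1) = rev (β O) ∧ O + l ≤ n ∧
      ((O = 2 * τ ∧ β O = (1, false) ∧ F O = 2 * B 0) ∨
        (O = 2 * τ + 1 ∧ β O = (0, false) ∧ ∀ j < τ, F (2 * τ - j) = B j)) ∧
      ∀ i, i + 1 < l → β O = (0, false) → F (O + 1 + i) = B i := by
  classical
  have hβ' : β (τ + 1) = (τ, false) := by rw [ht, hβ]; rfl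
  have hex : ∃ t, τ < t ∧ t < n ∧ β (t + 1) = rev (β t) := by
    by_contra hno
    push Not at hno
    have := (h.straight_neg hl hβ' (k := n - (τ + 1)) (by omega)
      (fun t h1 h2 => hno t (by omega) (by omega))).1 _ le_rfl
    rw [show τ + 1 + (n - (τ + 1)) = n by omega, hn] at this
    simp at this
  obtain ⟨O, hO⟩ : ∃ O, O = Nat.find hex := ⟨_, rfl⟩
  obtain ⟨h1, h2, h3⟩ := Nat.find_spec hex
  have hmin := fun t => Nat.find_min hex (m := t)
  rw [← hO] at h1 h2 h3 hmin
  obtain ⟨s1, s2⟩ := h.straight_neg hl hβ' (k := O - (τ + 1)) (by omega)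
    (fun t g1 g2 g3 => hmin t (by omega) ⟨by omega, by omega, g3⟩)
  have hO1 := s1 _ le_rfl
  rw [show τ + 1 + (O - (τ + 1)) = O by omega] at hO1
  have st := h O h2
  rw [h3] at st
  have hcase : (O = 2 * τ ∧ β O = (1, false) ∧ F O = 2 * B 0) ∨
        (O = 2 * τ + 1 ∧ β O = (0, false) ∧ ∀ j < τ, F (2 * τ - j) = B j) := by
    rcases st.turn with ⟨h4, -⟩ | h4 | ⟨h4, h5⟩ | h4
    · rw [hO1.2] at h4; simp at h4
    · rw [hO1.2] at h4; simp at h4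
    · left
      have := congrArg Prod.fst (hO1.2.symm.trans h4)
      simp only at this
      exact ⟨by omega, h4, h5⟩
    · right
      have := congrArg Prod.fst (hO1.2.symm.trans h4)
      simp only at this
      refine ⟨by omega, h4, fun j hj => ?_⟩
      have := (s2 (τ - 1 - j) (by omega)).2.2
      rw [show 2 * τ - j = τ + 1 + (τ - 1 - j) by omega, this]
      congr 1; omega
  have hO2 : ∃ z ≤ 1, β (O + 1) = (z, true) := by
    rcases hcase with ⟨-, h4, -⟩ | ⟨-, h4, -⟩
    · exact ⟨1, le_rfl, by rw [h3, h4]; rfl⟩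
    · exact ⟨0, by omega, by rw [h3, h4]; rfl⟩
  have hOn : O + l ≤ n := by
    by_contra hlt
    obtain ⟨z, hz, hz'⟩ := hO2
    have := (h.forced hz' (k := n - (O + 1)) (by omega) (by omega)).1 _ le_rfl
    rw [show O + 1 + (n - (O + 1)) = n by omega, hn] at this
    have := congrArg Prod.fst this
    simp only at this
    omega
  refine ⟨O, h1, h2, h3, hOn, hcase, fun i hi h4 => ?_⟩
  have := (h.forced (a := O + 1) (e := 0) (by rw [h3, h4]; rfl) (k := l - 1)
    (by omega) (by omega)).2 i (by omega)
  rwa [zero_add] at this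

/-! ### Alternating words -/

/-- The word `k, x, k, x, …`. -/
def alternating (k x : ℕ) (i : ℕ) : ℕ := if i % 2 = 0 then k else x

/-- A turn that reads a doubled letter. -/
def IsZ (m : ℕ) (r s : ℕ × Bool) : Prop :=
  s = rev r ∧ ((r.2 = true ∧ r.1 + 1 = m) ∨ r = (1, false))

theorem IsZ.symm {m : ℕ} {r s : ℕ × Bool} (h : IsZ m (rev s) (rev r)) : IsZ m r s := by
  obtain ⟨h1, h2⟩ := h
  have h3 : s = rev r := by rw [h1, rev_rev]
  subst h3
  simp only [rev_rev] at h2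
  exact ⟨rfl, h2⟩

theorem phase_rev {g : ℕ} (hg : 0 < g) (h : ℤ) : rev (phase g 0 h) = phase g 0 (-1 - h) := by
  have hr0 := Int.emod_nonneg h (show (2 * g : ℤ) ≠ 0 by omega)
  have hr1 := Int.emod_lt_of_pos h (show (0 : ℤ) < 2 * g by omega)
  have h1 : (-1 - h) % (2 * g) = 2 * g - 1 - h % (2 * g) := by
    have h2 : (-1 - h) % (2 * g) = (2 * g - 1 - h % (2 * g)) % (2 * g) := by
      apply Int.emod_eq_emod_iff_emod_sub_eq_zero.mpr
      apply Int.emod_eq_zero_of_dvd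
      refine ⟨- 1 - h / (2 * g), ?_⟩
      linarith [Int.mul_ediv_add_emod h (2 * g)]
    rw [h2, Int.emod_eq_of_lt (by omega) (by omega)]
  unfold phase
  rw [h1]
  generalize h % (2 * g) = r at *
  split_ifs <;> simp only [rev, Bool.not_true, Bool.not_false, Prod.mk.injEq, and_true] <;> omega

theorem exists_phase {m : ℕ} {r : ℕ × Bool} (hr : r.1 ≤ m) : ∃ h : ℤ, r = phase (m + 1) 0 h := by
  obtain ⟨e, d⟩ := r
  simp only at hr
  have key : ((e, true) : ℕ × Bool) = phase (m + 1) 0 e := by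
    rw [phase, Int.emod_eq_of_lt (by omega) (by push_cast; omega), if_pos (by push_cast; omega)]
    simp
  cases d with
  | true => exact ⟨e, key⟩
  | false => exact ⟨-1 - e, by rw [← phase_rev (by omega), ← key]; rfl⟩

theorem phase_true_val {g e : ℕ} {h : ℤ} (hh : h % (2 * g) = e) (he : e < g) :
    phase g 0 h = (e, true) := by
  rw [phase, hh, if_pos (by omega)]; simp

theorem phase_false_val {g e : ℕ} {h : ℤ} (hh : h % (2 * g) = 2 * g - 1 - e) (he : e < g) :
    phase g 0 h = (e, false) := by
  rw [phase, hh, if_neg (by omega)]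
  simp only [Prod.mk.injEq, and_true]; omega

theorem Step.next_phase {m : ℕ} {A : ℕ → ℕ} {r s : ℕ × Bool} {y : ℕ} {h : ℤ}
    (hs : Step m A r y s) (hz : ¬ IsZ m r s) (hr : r = phase (m + 1) 0 h) :
    s = phase (m + 1) 0 (h + 1) := by
  obtain ⟨e, d⟩ := r
  have hmod : ∀ v : ℤ, h % (2 * (m + 1 : ℕ)) = v → (h + 1) % (2 * (m + 1 : ℕ)) =
      (v + 1) % (2 * (m + 1 : ℕ)) := by
    intro v hv; rw [← hv, Int.emod_add_emod]
  rcases hs with ⟨h1, h2, h3, rfl⟩ | ⟨h1, h2, h3, rfl⟩ | ⟨h1, h2, rfl⟩ | ⟨h1, h2, h2', h3, rfl⟩ |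
    ⟨h1, h2, h3, rfl⟩ | ⟨h1, h2, rfl⟩ <;> simp only at h1 h2 <;> subst h1
  · have := (hmod _ (phase_eq_true (by omega) hr.symm)).trans
      (Int.emod_eq_of_lt (by omega) (by push_cast; omega))
    exact (phase_true_val (by rw [this]; simp) (by omega)).symm
  · exact absurd ⟨rfl, Or.inl ⟨rfl, h2⟩⟩ hz
  · subst h2
    have := (hmod _ (phase_eq_true (by omega) hr.symm)).trans
      (Int.emod_eq_of_lt (by omega) (by push_cast; omega))
    exact (phase_false_val (by rw [this]; push_cast; ring) (by omega)).symm
  · simp only at h2'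
    have := (hmod _ (phase_eq_false (by omega) hr.symm)).trans
      (Int.emod_eq_of_lt (by push_cast; omega) (by push_cast; omega))
    exact (phase_false_val (by
      rw [this]; simp only; rw [Nat.cast_sub h2]; push_cast; ring) (by simp only; omega)).symm
  · subst h2
    exact absurd ⟨rfl, Or.inr rfl⟩ hz
  · subst h2
    have := hmod _ (phase_eq_false (by omega) hr.symm)
    rw [show (2 * ((m + 1 : ℕ) : ℤ) - 1 - (0 : ℕ) + 1) = 2 * (m + 1 : ℕ) by push_cast; ring,
      Int.emod_self] at this
    exact (phase_true_val (e := 0) (by simpa using this) (by omega)).symm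

/-- A run following `phase (m + 1) 0` can turn only at a place between two copies or, with a doubled
letter, right before one. -/
theorem dvd_of_turn {m : ℕ} {A : ℕ → ℕ} {y : ℕ} {h : ℤ}
    (hs : Step m A (phase (m + 1) 0 h) y (rev (phase (m + 1) 0 h))) :
    ((m + 1 : ℕ) : ℤ) ∣ h + 1 ∨ ((m + 1 : ℕ) : ℤ) ∣ h + 2 := by
  have hd := Int.mul_ediv_add_emod h (2 * (m + 1 : ℕ))
  rcases hs.turn with ⟨h1, h2, -⟩ | h1 | ⟨h1, -⟩ | h1
  · have h1 : phase (m + 1) 0 h = (m - 1, true) := Prod.ext (by omega) h1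
    have := phase_eq_true (by omega) h1
    refine Or.inr ⟨2 * (h / (2 * (m + 1 : ℕ))) + 1, ?_⟩
    rw [this, Nat.cast_sub (by omega)] at hd
    push_cast at *
    linarith
  · have := phase_eq_true (by omega) h1
    refine Or.inl ⟨2 * (h / (2 * (m + 1 : ℕ))) + 1, ?_⟩
    rw [this] at hd
    push_cast at *
    linarith
  · have := phase_eq_false (by omega) h1
    refine Or.inr ⟨2 * (h / (2 * (m + 1 : ℕ))) + 2, ?_⟩
    rw [this] at hd
    push_cast at *
    linarith
  · have := phase_eq_false (by omega) h1
    refine Or.inl ⟨2 * (h / (2 * (m + 1 : ℕ))) + 2, ?_⟩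
    rw [this] at hd
    push_cast at *
    linarith

theorem turn_of_dvd {m : ℕ} {h : ℤ} (hd : ((m + 1 : ℕ) : ℤ) ∣ h + 1) :
    phase (m + 1) 0 h = (m, true) ∨ phase (m + 1) 0 h = (0, false) := by
  obtain ⟨z, hz⟩ := hd
  rcases Int.even_or_odd' z with ⟨w, rfl | rfl⟩
  · right
    apply phase_false_val _ (by omega)
    have : (h + 2 * (m + 1 : ℕ) * (1 - w)) % (2 * (m + 1 : ℕ)) = h % (2 * (m + 1 : ℕ)) := by simp
    rw [← this, show h + 2 * (m + 1 : ℕ) * (1 - w) = 2 * (m + 1 : ℕ) - 1 - (0 : ℕ) by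
      push_cast at *; linarith, Int.emod_eq_of_lt (by push_cast; omega) (by push_cast; omega)]
  · left
    apply phase_true_val _ (by omega)
    have : (h + 2 * (m + 1 : ℕ) * (- w)) % (2 * (m + 1 : ℕ)) = h % (2 * (m + 1 : ℕ)) := by simp
    rw [← this, show h + 2 * (m + 1 : ℕ) * (-w) = m by push_cast at *; linarith,
      Int.emod_eq_of_lt (by omega) (by push_cast; omega)]

theorem alternating_add {k x i j : ℕ} (h : i % 2 = j % 2) :
    alternating k x i = alternating k x j := by simp [alternating, h]

theorem Run.alternating_of_pass {m n : ℕ} {A F : ℕ → ℕ} {α : ℕ → ℕ × Bool} {k x : ℕ} (hm : 2 ≤ m)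
    (hm2 : Even m) (h : Run m A n F α) (h0 : α 0 = (0, true))
    (hA : ∀ i < m, A i = alternating k x i) {p : ℕ} (hp : p < n)
    (hn : α (p + 1) ≠ rev (α p)) : F p = alternating k x p := by
  obtain ⟨p1, p2⟩ := h.parity hm2 h0 p hp.le
  rcases (h p hp).pass hm hn with ⟨g1, g2, g3, g⟩ | ⟨g1, g2, g2', g3, g⟩
  · rw [g3, hA _ g2]; exact alternating_add (p1 g1)
  · rw [g3, hA _ (by omega)]; have := p2 g1; exact alternating_add (by omega)

/-- When the word and the text alternate between the same two labels, no letter is read doubled: by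
parity, a doubled letter would stand where the letter itself is due. -/
theorem Run.not_isZ_of_alternating {m n : ℕ} {A F : ℕ → ℕ} {α : ℕ → ℕ × Bool} {k x : ℕ}
    (hm : 2 ≤ m) (hm2 : Even m) (h : Run m A n F α) (h0 : α 0 = (0, true))
    (hpos : ∀ i < m, 0 < A i) (hA : ∀ i < m, A i = alternating k x i) {p : ℕ} (hp : p < n)
    (hF : F p = alternating k x p) : ¬ IsZ m (α p) (α (p + 1)) := by
  rintro ⟨h1, h2⟩
  obtain ⟨p1, p2⟩ := h.parity hm2 h0 p hp.le
  have st := h p hp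
  rw [h1] at st
  rw [Nat.even_iff] at hm2
  rcases st.turn with ⟨g1, g2, g3⟩ | g1 | ⟨g1, g2⟩ | g1
  · have e1 := p1 g1
    have := hpos (m - 1) (by omega)
    rw [hF, hA _ (by omega), alternating_add (show (m - 1) % 2 = p % 2 by omega)] at g3
    rw [hA _ (by omega), alternating_add (show (m - 1) % 2 = p % 2 by omega)] at this
    omega
  · rw [g1] at h2; simp at h2
  · have e1 := p2 (by rw [g1])
    rw [g1] at e1
    simp only at e1
    have := hpos 0 (by omega)
    rw [hF, hA _ (by omega), alternating_add (show 0 % 2 = p % 2 by omega)] at g2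
    rw [hA _ (by omega), alternating_add (show 0 % 2 = p % 2 by omega)] at this
    omega
  · rw [g1] at h2; simp at h2

/-- As long as no doubled letter is read, the states of a run are those of the regular pattern of
period `2 * (m + 1)`. -/
theorem Run.phase_forward {m n : ℕ} {A F : ℕ → ℕ} {α : ℕ → ℕ × Bool} (hr : Run m A n F α) {a j : ℕ}
    {h : ℤ} (ha : α a = phase (m + 1) 0 h) (hj : a + j ≤ n)
    (hZ : ∀ t, a ≤ t → t < a + j → ¬ IsZ m (α t) (α (t + 1))) :
    α (a + j) = phase (m + 1) 0 (h + j) := by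
  induction j with
  | zero => simpa using ha
  | succ j ih =>
    have := (hr (a + j) (by omega)).next_phase (hZ _ (by omega) (by omega))
      (ih (by omega) (fun t h1 h2 => hZ t h1 (by omega)))
    rw [← add_assoc, this]; congr 1; push_cast; ring

theorem Run.phase_backward {m n : ℕ} {A F : ℕ → ℕ} {α : ℕ → ℕ × Bool} (hr : Run m A n F α)
    {a j : ℕ} {h : ℤ} (ha : α a = phase (m + 1) 0 h) (hja : j ≤ a) (han : a ≤ n)
    (hZ : ∀ t, a ≤ t + j → t < a → ¬ IsZ m (α t) (α (t + 1))) :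
    α (a - j) = phase (m + 1) 0 (h - j) := by
  induction j with
  | zero => simpa using ha
  | succ j ih =>
    have ih := ih (by omega) (fun t h1 h2 => hZ t (by omega) h2)
    have st := (hr (a - (j + 1)) (by omega)).symm
    rw [show a - (j + 1) + 1 = a - j by omega] at st
    have := st.next_phase (h := -1 - (h - j)) (fun hz => hZ (a - (j + 1)) (by omega) (by omega) (by
      rw [show a - (j + 1) + 1 = a - j by omega]; exact hz.symm))
      (by rw [ih, phase_rev (by omega)])
    rw [← rev_rev (α _), this, phase_rev (by omega)]
    congr 1; push_cast; ring

/-- If one of the two words alternates then so does the other. -/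
theorem alternating_transfer {m l n τ k x : ℕ} {A B F : ℕ → ℕ} {α β : ℕ → ℕ × Bool} (hm : 2 ≤ m)
    (hm2 : Even m) (hl : 2 ≤ l) (hl2 : Even l) (hpos : ∀ i < m, 0 < A i)
    (hA : ∀ i < m, A i = alternating k x i)
    (hα : Run m A n F α) (hα0 : α 0 = (0, true)) (hαn : α n = (m, true))
    (hβ : Run l B n F β) (hβ0 : β 0 = (0, true)) (hβn : β n = (l, true))
    (hNC : ∀ p < n, ¬ (α (p + 1) = rev (α p) ∧ β (p + 1) = rev (β p)))
    (hτ : τ < n) (ht : β (τ + 1) = rev (β τ)) (hno : ∀ t < τ, β (t + 1) ≠ rev (β t)) :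
    ∀ i < l, B i = alternating k x i := by
  classical
  obtain ⟨hβτ, y, hM⟩ := hβ.first_turn hl hβ0 hβn hτ ht hno
  have hMl := hM.add_eq
  have hMy := hM.le_one
  by_contra hne
  push Not at hne
  obtain ⟨Y, hY⟩ : ∃ Y, Y = Nat.find hne := ⟨_, rfl⟩
  obtain ⟨hYl, hYB⟩ := Nat.find_spec hne
  have hmin : ∀ i < Y, B i = alternating k x i := by
    intro i hi
    have := Nat.find_min hne (hY ▸ hi)
    push Not at this
    exact this (by omega)
  rw [← hY] at hYl hYB
  have hm2' := Nat.even_iff.mp hm2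
  have hl2' := Nat.even_iff.mp hl2
  have hYl2 : Y + 1 < l := by
    by_contra hlt
    obtain rfl : Y = l - 1 := by omega
    apply hYB
    rw [← hβ.last_eq hl hβ0 hβn, hα.last_eq hm hα0 hαn, hA _ (by omega)]
    exact alternating_add (by omega)
  obtain ⟨O, hO1, hO2, hO3, hO4, hO5, hO6⟩ := hβ.second_turn hl hβn hτ ht hβτ
  have hpass : α (O + 1) ≠ rev (α O) := fun h => hNC O hO2 ⟨h, hO3⟩
  have hFO := hα.alternating_of_pass hm hm2 hα0 hA hO2 hpass
  have irr : ∀ p < n, F p ≠ alternating k x p → α (p + 1) = rev (α p) := fun p hp h => by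
    by_contra hc
    exact h (hα.alternating_of_pass hm hm2 hα0 hA hp hc)
  have notZ : ∀ p < n, F p = alternating k x p → ¬ IsZ m (α p) (α (p + 1)) := fun p hp h =>
    hα.not_isZ_of_alternating hm hm2 hα0 hpos hA hp h
  -- the second run turns back at the undoubled start
  obtain ⟨hOτ, hβO, hback⟩ : O = 2 * τ + 1 ∧ β O = (0, false) ∧ ∀ j < τ, F (2 * τ - j) = B j := by
    rcases hO5 with ⟨h1, h2, h3⟩ | h
    · exfalso
      have e0 := hpos 0 (by omega)
      have e1 := hM.init 0 (by omega)
      have e2 := hα.first_eq hm hα0 hαn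
      rw [hFO, alternating_add (show O % 2 = 0 % 2 by omega), ← hA 0 (by omega)] at h3
      omega
    · exact h
  have hfwd := fun i hi => hO6 i hi hβO
  -- the first irregular letter
  have c1 : ((m + 1 : ℕ) : ℤ) ∣ (Y : ℤ) + 1 ∨ ((m + 1 : ℕ) : ℤ) ∣ (Y : ℤ) + 2 := by
    have h1 : α 0 = phase (m + 1) 0 0 := by rw [hα0]; simp [phase]
    have h2 := hα.phase_forward h1 (j := Y) (by omega) (fun t _ ht => notZ t (by omega) (by
      rw [← hM.init t (by omega)]; exact hmin t (by omega)))
    rw [zero_add, zero_add] at h2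
    have h3 := irr Y (by omega) (by rw [← hM.init Y (by omega)]; exact hYB)
    have st := hα Y (by omega)
    rw [h3, h2] at st
    exact dvd_of_turn st
  obtain ⟨h, hh⟩ := exists_phase ((hα O hO2).le hm).1
  -- the first irregular letter after the second turn
  have c2 : ((m + 1 : ℕ) : ℤ) ∣ h + 1 + Y + 1 ∨ ((m + 1 : ℕ) : ℤ) ∣ h + 1 + Y + 2 := by
    have h2 := hα.phase_forward hh (j := Y + 1) (by omega) (fun t h1 h2 => notZ t (by omega) (by
      rcases Nat.eq_or_lt_of_le h1 with rfl | h1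
      · exact hFO
      · have := hfwd (t - (O + 1)) (by omega)
        rw [show O + 1 + (t - (O + 1)) = t by omega] at this
        rw [this, hmin _ (by omega)]
        exact alternating_add (by omega)))
    have hF := hfwd Y hYl2
    have h3 := irr (O + 1 + Y) (by omega) (by
      rw [hF, alternating_add (show (O + 1 + Y) % 2 = Y % 2 by omega)]; exact hYB)
    have st := hα (O + 1 + Y) (by omega)
    rw [h3, show O + 1 + Y = O + (Y + 1) by omega, h2] at st
    have := dvd_of_turn st
    push_cast at this ⊢
    rwa [show h + 1 + (Y : ℤ) = h + (Y + 1) by ring]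
  -- the last irregular letter before the second turn
  have c3 : ((m + 1 : ℕ) : ℤ) ∣ (Y : ℤ) - h ∨ ((m + 1 : ℕ) : ℤ) ∣ (Y : ℤ) - h + 1 := by
    have h2 := hα.phase_backward hh (j := Y) (by omega) hO2.le (fun t h1 h2 => notZ t (by omega) (by
      have := hback (O - 1 - t) (by omega)
      rw [show 2 * τ - (O - 1 - t) = t by omega] at this
      rw [this, hmin _ (by omega)]
      exact alternating_add (by omega)))
    have hF := hback Y (by omega)
    have h3 := irr (2 * τ - Y) (by omega) (by
      rw [hF, alternating_add (show (2 * τ - Y) % 2 = Y % 2 by omega)]; exact hYB)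
    have st := hα (2 * τ - Y) (by omega)
    have h4 : α (2 * τ - Y) = phase (m + 1) 0 (-1 - (h - Y)) := by
      rw [← phase_rev (by omega), ← h2, show O - Y = 2 * τ - Y + 1 by omega, h3, rev_rev]
    rw [h3, h4] at st
    have := dvd_of_turn st
    rwa [show -1 - (h - Y) + 1 = (Y : ℤ) - h by ring,
      show -1 - (h - Y) + 2 = (Y : ℤ) - h + 1 by ring] at this
  have hdvd : ((m + 1 : ℕ) : ℤ) ∣ h + 1 := by
    have no2 : ¬ ((m + 1 : ℕ) : ℤ) ∣ 2 := fun hd => by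
      have := Int.le_of_dvd (by norm_num) hd
      push_cast at this; omega
    rcases c1 with c1 | c1
    · rcases c2 with c2 | c2
      · have := dvd_sub c2 c1; rwa [show h + 1 + (Y : ℤ) + 1 - (Y + 1) = h + 1 by ring] at this
      · rcases c3 with c3 | c3
        · have := dvd_sub c1 c3; rwa [show (Y : ℤ) + 1 - (Y - h) = h + 1 by ring] at this
        · exfalso
          have a1 := dvd_sub c2 c1
          have a2 := dvd_sub c3 c1
          have := dvd_add a1 a2
          apply no2
          rwa [show h + 1 + (Y : ℤ) + 2 - (Y + 1) + (Y - h + 1 - (Y + 1)) = 2 by ring] at this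
    · rcases c2 with c2 | c2
      · rcases c3 with c3 | c3
        · exfalso
          have a1 := dvd_sub c1 c2
          have a2 := dvd_sub c1 c3
          have := dvd_add a1 a2
          apply no2
          rwa [show (Y : ℤ) + 2 - (h + 1 + Y + 1) + (Y + 2 - (Y - h)) = 2 by ring] at this
        · have := dvd_sub c1 c3; rwa [show (Y : ℤ) + 2 - (Y - h + 1) = h + 1 by ring] at this
      · have := dvd_sub c2 c1; rwa [show h + 1 + (Y : ℤ) + 2 - (Y + 2) = h + 1 by ring] at this
  have st := hα O hO2
  rw [hh] at st hpass
  apply hpass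
  rcases turn_of_dvd hdvd with h1 | h1
  · rw [h1] at st ⊢; exact st.end_pos
  · rw [h1] at st ⊢; exact st.start_neg


/-! ### Words with a common accepted word -/

/-- The conclusion about two words accepted together: either both arise from a common
nonempty word, or both are the same alternating word. -/
def CommonCell (m : ℕ) (A : ℕ → ℕ) (l : ℕ) (B : ℕ → ℕ) : Prop :=
  (∃ E e, Even E ∧ 2 ≤ E ∧ (∀ i < E, 0 < e i) ∧ Acc E e m A ∧ Acc E e l B) ∨
  ∃ k x, (∀ i < m, A i = alternating k x i) ∧ ∀ i < l, B i = alternating k x i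

theorem CommonCell.symm {m l : ℕ} {A B : ℕ → ℕ} (h : CommonCell m A l B) : CommonCell l B m A := by
  rcases h with ⟨E, e, h1, h2, h3, h4, h5⟩ | ⟨k, x, h1, h2⟩
  · exact Or.inl ⟨E, e, h1, h2, h3, h5, h4⟩
  · exact Or.inr ⟨k, x, h2, h1⟩

theorem exists_last_turn {P : ℕ → Prop} {τ : ℕ} (h : ∃ t < τ, P t) :
    ∃ κ < τ, P κ ∧ ∀ t, κ < t → t < τ → ¬ P t := by
  induction τ with
  | zero => obtain ⟨t, ht, -⟩ := h; omega
  | succ τ ih =>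
    by_cases hτ : P τ
    · exact ⟨τ, by omega, hτ, fun t h1 h2 => by omega⟩
    · obtain ⟨t, ht, hP⟩ := h
      have : t ≠ τ := by rintro rfl; exact hτ hP
      obtain ⟨κ, h1, h2, h3⟩ := ih ⟨t, by omega, hP⟩
      refine ⟨κ, by omega, h2, fun s hs hs' => ?_⟩
      rcases Nat.lt_succ_iff_lt_or_eq.mp hs' with h | rfl
      · exact h3 s hs h
      · exact hτ

theorem exists_first_turn {P : ℕ → Prop} (h : ∃ t, P t) : ∃ κ, P κ ∧ ∀ t < κ, ¬ P t := by
  classical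
  exact ⟨Nat.find h, Nat.find_spec h, fun t ht => Nat.find_min h ht⟩

theorem alternating_of_two_periodic {m : ℕ} {A : ℕ → ℕ} (h : ∀ i, i + 2 < m → A i = A (i + 2)) :
    ∀ i < m, A i = alternating (A 0) (A 1) i := by
  intro i
  induction i using Nat.strong_induction_on with
  | _ i ih =>
    intro hi
    match i with
    | 0 => rfl
    | 1 => rfl
    | i + 2 =>
      rw [← h i hi, ih i (by omega) (by omega)]
      exact alternating_add (by omega)

/-- When the first turn of the run of `A` comes before that of the run of `B`, either the words
alternate, or one of them can be replaced by a shorter word that accepts it. -/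
theorem common_cell_step {m l n κ₁ τ : ℕ} {A B F : ℕ → ℕ} {α β : ℕ → ℕ × Bool} (hm : 2 ≤ m)
    (hm2 : Even m) (hl : 2 ≤ l) (hl2 : Even l) (hA : ∀ i < m, 0 < A i) (hB : ∀ i < l, 0 < B i)
    (hα : Run m A n F α) (hα0 : α 0 = (0, true)) (hαn : α n = (m, true))
    (hβ : Run l B n F β) (hβ0 : β 0 = (0, true)) (hβn : β n = (l, true))
    (hNC : ∀ p < n, ¬ (α (p + 1) = rev (α p) ∧ β (p + 1) = rev (β p)))
    (hκ : α (κ₁ + 1) = rev (α κ₁)) (hκno : ∀ t < κ₁, α (t + 1) ≠ rev (α t))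
    (hτ : τ < n) (ht : β (τ + 1) = rev (β τ)) (hno : ∀ t < τ, β (t + 1) ≠ rev (β t))
    (hlt : κ₁ < τ)
    (IH : ∀ m' l' A' B', m' + l' < m + l → 2 ≤ m' → Even m' → 2 ≤ l' → Even l' →
      (∀ i < m', 0 < A' i) → (∀ i < l', 0 < B' i) → Acc m' A' n F → Acc l' B' n F →
      CommonCell m' A' l' B') : CommonCell m A l B := by
  have hm2' := Nat.even_iff.mp hm2
  have hl2' := Nat.even_iff.mp hl2
  obtain ⟨hβτ, y, hM⟩ := hβ.first_turn hl hβ0 hβn hτ ht hno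
  obtain ⟨hακ, y₁, hM₁⟩ := hα.first_turn hm hα0 hαn (by omega) hκ hκno
  have hMl := hM.add_eq
  have hMy := hM.le_one
  have hMl₁ := hM₁.add_eq
  have hMy₁ := hM₁.le_one
  have hlast : A (m - 1) = B (l - 1) := by
    rw [← hα.last_eq hm hα0 hαn, ← hβ.last_eq hl hβ0 hβn]
  -- the alternating case
  have hBA : ∀ k x, (∀ i < l, B i = alternating k x i) → ∀ i < m, A i = alternating k x i := by
    intro k x h i hi
    rcases Nat.lt_or_ge i κ₁ with h1 | h1
    · rw [hM₁.init i h1, ← hM.init i (by omega), h i (by omega)]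
    · obtain rfl : i = m - 1 := by omega
      rw [hlast, h _ (by omega)]
      exact alternating_add (by omega)
  by_cases hnalt : ∀ i, i + 2 < m → A i = A (i + 2)
  · have h1 := alternating_of_two_periodic hnalt
    exact Or.inr ⟨_, _, h1, alternating_transfer hm hm2 hl hl2 hA h1 hα hα0 hαn hβ hβ0 hβn hNC hτ ht
      hno⟩
  -- the turns around `τ`
  obtain ⟨κ, hκτ, hκt, hκl⟩ := exists_last_turn (P := fun t => α (t + 1) = rev (α t)) ⟨κ₁, hlt, hκ⟩
  have hκκ : κ₁ ≤ κ := by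
    by_contra h
    exact hκno κ (by omega) hκt
  obtain ⟨O, -, -, -, hO4, hO5, -⟩ := hβ.second_turn hl hβn hτ ht hβτ
  have hαle := (hα κ (by omega)).le hm
  have hακ1 : ∃ e ≤ m, ∃ d, α (κ + 1) = (e, d) := ⟨_, hαle.2, _, rfl⟩
  obtain ⟨e, he, d, hed⟩ := hακ1
  have hex : ∃ t, κ < t ∧ t < n ∧ α (t + 1) = rev (α t) := by
    by_contra h
    push Not at h
    cases d with
    | true =>
      have := (hα.straight hm hed (k := n - (κ + 1)) (by omega)
        (fun t h1 h2 => h t (by omega) (by omega))).1 _ le_rfl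
      rw [show κ + 1 + (n - (κ + 1)) = n by omega, hαn] at this
      have := congrArg Prod.fst this
      simp only at this
      omega
    | false =>
      have := (hα.straight_neg hm hed (k := n - (κ + 1)) (by omega)
        (fun t h1 h2 => h t (by omega) (by omega))).1 _ le_rfl
      rw [show κ + 1 + (n - (κ + 1)) = n by omega, hαn] at this
      simp at this
  obtain ⟨κ', ⟨hκ1, hκ2, hκ3⟩, hκ4⟩ := exists_first_turn hex
  have hκ5 : ∀ t, κ < t → t < κ' → α (t + 1) ≠ rev (α t) :=
    fun t h1 h2 h3 => hκ4 t h2 ⟨h1, by omega, h3⟩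
  have hτκ : τ < κ' := by
    by_contra h
    rcases Nat.lt_or_ge κ' τ with h1 | h1
    · exact hκl κ' hκ1 h1 hκ3
    · obtain rfl : κ' = τ := by omega
      exact hNC _ hτ ⟨hκ3, ht⟩
  have hT : κ' - κ ≤ m + 1 ∧ (d = false → κ' - κ ≤ e + 1) := by
    cases d with
    | true =>
      have h1 := (hα.straight hm hed (k := κ' - (κ + 1)) (by omega)
        (fun t h1 h2 => hκ5 t (by omega) (by omega))).1 _ le_rfl
      have h2 := ((hα κ' hκ2).le hm).1
      rw [show κ + 1 + (κ' - (κ + 1)) = κ' by omega] at h1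
      rw [h1] at h2
      simp only at h2
      exact ⟨by omega, by simp⟩
    | false =>
      have h1 := (hα.straight_neg hm hed (k := κ' - (κ + 1)) (by omega)
        (fun t h1 h2 => hκ5 t (by omega) (by omega))).1 _ le_rfl
      exact ⟨by omega, fun _ => by omega⟩
  have hTτ : κ' - κ ≤ τ := by
    rcases Nat.eq_or_lt_of_le hκκ with h | h
    · subst h
      rw [hκ, hακ] at hed
      simp only [rev, Bool.not_true, Prod.mk.injEq] at hed
      have := hT.2 hed.2.symm
      omega
    · omega
  obtain ⟨E, w, w1, w2, w3, w4⟩ := exists_cell hm hm2 hl2 hA hB hα hα0 hαn hM hκτ hτκ hκ2 hκt hκ3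
    hκ5 hTτ hnalt (by have := hA (m - 1) (by omega); omega)
  rcases w4 with ⟨w4, w5⟩ | ⟨w4, w5⟩
  · rcases IH E l w B (by omega) w2 w1 hl hl2 w3 hB
      (w5.trans w2 hm ⟨α, hα0, hαn, hα⟩) ⟨β, hβ0, hβn, hβ⟩ with
      ⟨E', e', h1, h2, h3, h4, h5⟩ | ⟨k, x, -, h2⟩
    · exact Or.inl ⟨E', e', h1, h2, h3, h4.trans h2 w2 w5, h5⟩
    · exact Or.inr ⟨k, x, hBA k x h2, h2⟩
  · rcases IH E m w A (by omega) w2 w1 hm hm2 w3 hA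
      (w5.trans w2 hl ⟨β, hβ0, hβn, hβ⟩) ⟨α, hα0, hαn, hα⟩ with
      ⟨E', e', h1, h2, h3, h4, h5⟩ | ⟨k, x, -, h2⟩
    · exact Or.inl ⟨E', e', h1, h2, h3, h5, h4.trans h2 w2 w5⟩
    · exfalso
      apply hnalt
      intro i hi
      rw [h2 i (by omega), h2 (i + 2) hi]
      exact alternating_add (by omega)

/-- A run that never turns reads `A` once. -/
theorem eq_of_no_turn {m n : ℕ} {A F : ℕ → ℕ} {α : ℕ → ℕ × Bool} (hm : 2 ≤ m)
    (hα : Run m A n F α) (hα0 : α 0 = (0, true)) (hαn : α n = (m, true))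
    (h : ∀ t < n, α (t + 1) ≠ rev (α t)) : n = m ∧ ∀ t < m, F t = A t := by
  obtain ⟨s1, s2⟩ := hα.straight hm hα0 (k := n) (by omega) (fun t _ ht => h t (by omega))
  have := s1 n le_rfl
  simp only [zero_add] at this
  rw [hαn] at this
  have := congrArg Prod.fst this
  simp only at this
  subst this
  refine ⟨rfl, fun t ht => ?_⟩
  have := (s2 t ht).2
  simpa using this

theorem common_cell_aux (N : ℕ) : ∀ {m l n : ℕ} {A B F : ℕ → ℕ}, m + l < N → 2 ≤ m → Even m →
    2 ≤ l → Even l → (∀ i < m, 0 < A i) → (∀ i < l, 0 < B i) → (∀ t < n, 0 < F t) →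
    Acc m A n F → Acc l B n F → CommonCell m A l B := by
  induction N with
  | zero => intro m l n A B F h; omega
  | succ N IH =>
    rintro m l n A B F hN hm hm2 hl hl2 hA hB hF ⟨α, a0, a1, a2⟩ ⟨β, b0, b1, b2⟩
    have D : DRun m A (fun _ => true) l B (fun _ => true) n F (fun _ => true) α β :=
      ⟨⟨a0, a1, a2, fun _ _ _ _ _ => rfl⟩, ⟨b0, b1, b2, fun _ _ _ _ _ => rfl⟩, hF⟩
    obtain ⟨n', F', c', α', β', D', hNC⟩ := D.exists_noncommon hm hl hA hB
    clear D a0 a1 a2 b0 b1 b2 hF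
    obtain ⟨⟨a0, a1, a2, -⟩, ⟨b0, b1, b2, -⟩, hF⟩ := D'
    by_cases hα : ∃ t, t < n' ∧ α' (t + 1) = rev (α' t)
    · by_cases hβ : ∃ t, t < n' ∧ β' (t + 1) = rev (β' t)
      · obtain ⟨κ, ⟨hκ1, hκ2⟩, hκ3⟩ := exists_first_turn hα
        obtain ⟨τ, ⟨hτ1, hτ2⟩, hτ3⟩ := exists_first_turn hβ
        rcases lt_trichotomy κ τ with h | h | h
        · exact common_cell_step hm hm2 hl hl2 hA hB a2 a0 a1 b2 b0 b1 hNC hκ2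
            (fun t ht h => hκ3 t ht ⟨by omega, h⟩) hτ1 hτ2 (fun t ht h => hτ3 t ht ⟨by omega, h⟩) h
            (fun m' l' A' B' h1 h2 h3 h4 h5 h6 h7 h8 h9 =>
              IH (by omega) h2 h3 h4 h5 h6 h7 hF h8 h9)
        · subst h
          exact absurd ⟨hκ2, hτ2⟩ (hNC κ hκ1)
        · exact (common_cell_step hl hl2 hm hm2 hB hA b2 b0 b1 a2 a0 a1
            (fun p hp h => hNC p hp h.symm) hτ2
            (fun t ht h => hτ3 t ht ⟨by omega, h⟩) hκ1 hκ2 (fun t ht h => hκ3 t ht ⟨by omega, h⟩) h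
            (fun m' l' A' B' h1 h2 h3 h4 h5 h6 h7 h8 h9 =>
              IH (by omega) h2 h3 h4 h5 h6 h7 hF h8 h9)).symm
      · push Not at hβ
        obtain ⟨rfl, h2⟩ := eq_of_no_turn hl b2 b0 b1 hβ
        have hA' : Acc m A n' B := Acc.congr hm (fun _ _ => rfl) h2 ⟨α', a0, a1, a2⟩
        exact Or.inl ⟨m, A, hm2, hm, hA, Acc.refl m A, hA'⟩
    · push Not at hα
      obtain ⟨rfl, h2⟩ := eq_of_no_turn hm a2 a0 a1 hα
      have hB' : Acc l B n' A := Acc.congr hl (fun _ _ => rfl) h2 ⟨β', b0, b1, b2⟩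
      exact Or.inl ⟨l, B, hl2, hl, hB, hB', Acc.refl l B⟩

/-- Two words accepting a common word arise from a common nonempty word, or are initial segments of
the same alternating word. -/
theorem common_cell {m l n : ℕ} {A B F : ℕ → ℕ} (hm : 2 ≤ m) (hm2 : Even m) (hl : 2 ≤ l)
    (hl2 : Even l) (hA : ∀ i < m, 0 < A i) (hB : ∀ i < l, 0 < B i) (hF : ∀ t < n, 0 < F t)
    (hAF : Acc m A n F) (hBF : Acc l B n F) : CommonCell m A l B :=
  common_cell_aux (m + l + 1) (by omega) hm hm2 hl hl2 hA hB hF hAF hBF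


/-! ### Labels of an expanded even vector -/

/-- The vector `(2c₁, 2c₂, …)` obtained from a list of integers `cᵢ` by expanding each of them. -/
def expand (x : List ℤ) : List ℤ := x.flatMap connector

@[simp] theorem expand_nil : expand [] = [] := rfl

@[simp] theorem expand_cons (k : ℤ) (x : List ℤ) : expand (k :: x) = connector k ++ expand x := rfl

@[simp] theorem expand_append (x y : List ℤ) : expand (x ++ y) = expand x ++ expand y := by
  simp [expand]

theorem intersperse_replicate_succ (n : ℕ) (z : ℤ) :
    (List.replicate (n + 2) z).intersperse 0 =
      z :: 0 :: (List.replicate (n + 1) z).intersperse 0 := by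
  rw [List.replicate_succ, List.replicate_succ, List.intersperse_cons_cons, ← List.replicate_succ]

theorem intersperse_replicate_add (a b : ℕ) (z : ℤ) :
    (List.replicate (a + 1 + (b + 1)) z).intersperse 0 =
      (List.replicate (a + 1) z).intersperse 0 ++ 0 :: (List.replicate (b + 1) z).intersperse 0 :=
        by
  induction a with
  | zero =>
    rw [show 0 + 1 + (b + 1) = b + 2 by omega, intersperse_replicate_succ]; rfl
  | succ a ih =>
    rw [show a + 1 + 1 + (b + 1) = (a + b + 1) + 2 by omega, intersperse_replicate_succ (a + b + 1),
      intersperse_replicate_succ a, show a + b + 1 + 1 = a + 1 + (b + 1) by omega, ih]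
    rfl

theorem intersperse_replicate_reverse (n : ℕ) (z : ℤ) :
    ((List.replicate n z).intersperse 0).reverse = (List.replicate n z).intersperse 0 := by
  induction n with
  | zero => rfl
  | succ n ih =>
    cases n with
    | zero => rfl
    | succ n =>
      have := intersperse_replicate_add n 0 z
      rw [show n + 1 + (0 + 1) = n + 2 by omega] at this
      conv_lhs => rw [intersperse_replicate_succ]
      rw [show n + 1 + 1 = n + 2 by omega, this, List.reverse_cons, List.reverse_cons, ih]
      simp

theorem connector_zero : connector 0 = [0] := rfl

theorem connector_of_ne {k : ℤ} (hk : k ≠ 0) :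
    connector k = (List.replicate k.natAbs (2 * k.sign)).intersperse 0 := by
  simp [connector, hk]

theorem connector_reverse (k : ℤ) : (connector k).reverse = connector k := by
  by_cases hk : k = 0
  · subst hk; rfl
  · rw [connector_of_ne hk, intersperse_replicate_reverse]

theorem connector_head {k : ℤ} : ∃ t, connector k = 2 * k.sign :: t := by
  by_cases hk : k = 0
  · subst hk; exact ⟨[], rfl⟩
  · rw [connector_of_ne hk]
    obtain ⟨n, hn⟩ : ∃ n, k.natAbs = n + 1 := ⟨k.natAbs - 1, by omega⟩
    rw [hn]
    cases n with
    | zero => exact ⟨[], rfl⟩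
    | succ n => exact ⟨_, intersperse_replicate_succ n _⟩

theorem connector_ne_nil (k : ℤ) : connector k ≠ [] := by
  obtain ⟨t, ht⟩ := connector_head (k := k)
  simp [ht]

/-- A longer connector of the same sign continues a shorter one with a zero. -/
theorem connector_split {k k' : ℤ} (hk : k ≠ 0) (hs : k.sign = k'.sign)
    (hlt : k.natAbs < k'.natAbs) :
    connector k' = connector k ++ 0 ::
      (List.replicate (k'.natAbs - k.natAbs) (2 * k.sign)).intersperse 0 := by
  have hk' : k' ≠ 0 := by rintro rfl; simp at hlt
  rw [connector_of_ne hk, connector_of_ne hk', ← hs]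
  have := intersperse_replicate_add (k.natAbs - 1) (k'.natAbs - k.natAbs - 1) (2 * k.sign)
  rwa [show k.natAbs - 1 + 1 + (k'.natAbs - k.natAbs - 1 + 1) = k'.natAbs by omega,
    show k.natAbs - 1 + 1 = k.natAbs by omega,
    show k'.natAbs - k.natAbs - 1 + 1 = k'.natAbs - k.natAbs by omega] at this

/-- Merging at a zero: `(2c, 0, 2c) = 2(2c)` on the level of connectors. -/
theorem connector_two_mul {k : ℤ} (hk : k ≠ 0) :
    connector (2 * k) = connector k ++ 0 :: connector k := by
  rw [connector_split hk (k' := 2 * k) (by rw [Int.sign_mul, show Int.sign 2 = 1 from rfl,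
    one_mul]) (by omega),
    show (2 * k).natAbs - k.natAbs = k.natAbs by omega, ← connector_of_ne hk]

theorem units_int_cases (ε : ℤˣ) : (ε : ℤ) = 1 ∨ (ε : ℤ) = -1 := by
  rcases Int.units_eq_one_or ε with rfl | rfl <;> simp

@[simp] theorem signed_one (a : List ℤ) : signed 1 a = a := by simp [signed]

theorem signed_append (ε : ℤˣ) (a b : List ℤ) : signed ε (a ++ b) = signed ε a ++ signed ε b := by
  simp [signed]

@[simp] theorem signed_cons (ε : ℤˣ) (k : ℤ) (a : List ℤ) :
    signed ε (k :: a) = (ε : ℤ) * k :: signed ε a := rfl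

@[simp] theorem signed_nil (ε : ℤˣ) : signed ε [] = [] := rfl

theorem signed_signed (ε δ : ℤˣ) (a : List ℤ) : signed ε (signed δ a) = signed (ε * δ) a := by
  simp [signed, mul_assoc]

theorem signed_reverse (ε : ℤˣ) (a : List ℤ) : (signed ε a).reverse = signed ε a.reverse := by
  simp [signed]

@[simp] theorem signed_length (ε : ℤˣ) (a : List ℤ) : (signed ε a).length = a.length := by
  simp [signed]

theorem signed_self_signed (ε : ℤˣ) (a : List ℤ) : signed ε (signed ε a) = a := by
  rw [signed_signed, Int.units_mul_self, signed_one]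

theorem intersperse_map (f : ℤ → ℤ) (h0 : f 0 = 0) (n : ℕ) (z : ℤ) :
    ((List.replicate n z).intersperse 0).map f = (List.replicate n (f z)).intersperse 0 := by
  induction n with
  | zero => rfl
  | succ n ih =>
    cases n with
    | zero => rfl
    | succ n =>
      rw [intersperse_replicate_succ, intersperse_replicate_succ, List.map_cons, List.map_cons,
        ih, h0]

theorem signed_connector (ε : ℤˣ) (k : ℤ) : signed ε (connector k) = connector (ε * k) := by
  by_cases hk : k = 0
  · subst hk; simp [connector_zero]
  · rcases Int.units_eq_one_or ε with rfl | rfl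
    · simp
    · have : ((-1 : ℤˣ) : ℤ) * k ≠ 0 := by simpa using hk
      rw [connector_of_ne hk, connector_of_ne this, signed, intersperse_map _ (by simp)]
      simp

theorem signed_expand (ε : ℤˣ) (x : List ℤ) : signed ε (expand x) = expand (signed ε x) := by
  induction x with
  | nil => rfl
  | cons k x ih => rw [expand_cons, signed_append, signed_connector, ih, signed_cons, expand_cons]

theorem expand_reverse (x : List ℤ) : (expand x).reverse = expand x.reverse := by
  induction x with
  | nil => rfl
  | cons k x ih =>
    rw [expand_cons, List.reverse_append, ih, connector_reverse, List.reverse_cons, expand_append]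
    simp

theorem connector_length_odd (k : ℤ) : (connector k).length % 2 = 1 := by
  by_cases hk : k = 0
  · subst hk; rfl
  · rw [connector_of_ne hk]
    obtain ⟨n, hn⟩ : ∃ n, k.natAbs = n + 1 := ⟨k.natAbs - 1, by omega⟩
    rw [hn]
    generalize 2 * k.sign = z
    clear hn
    induction n with
    | zero => rfl
    | succ n ih =>
      rw [intersperse_replicate_succ]
      simp only [List.length_cons]
      omega

theorem expand_length (x : List ℤ) : (expand x).length % 2 = x.length % 2 := by
  induction x with
  | nil => rfl
  | cons k x ih =>
    have := connector_length_odd k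
    rw [expand_cons, List.length_append, List.length_cons]
    omega

theorem even_length_of_expand {x : List ℤ} (h : Even (expand x).length) : Even x.length := by
  have := expand_length x
  rw [Nat.even_iff] at *
  omega

theorem expand_head {k : ℤ} {x : List ℤ} : (expand (k :: x)).head? = some (2 * k.sign) := by
  obtain ⟨t, ht⟩ := connector_head (k := k)
  simp [ht]

theorem eq_of_natAbs_sign {k k' : ℤ} (h : k.natAbs = k'.natAbs) (hs : k.sign = k'.sign) :
    k = k' := by
  rw [← Int.sign_mul_natAbs k, ← Int.sign_mul_natAbs k', h, hs]

theorem expand_not_head_zero {x : List ℤ} (h : 0 < x.length → x.getD 0 0 ≠ 0) {t : List ℤ} :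
    expand x ≠ 0 :: t := by
  intro he
  cases x with
  | nil => simp at he
  | cons k x =>
    have h1 := expand_head (k := k) (x := x)
    rw [he] at h1
    simp at h1
    exact h (by simp) (by simpa using h1)

/-- A list can be recovered from its expansion when at each place either the absolute value is
known or the next entry is nonzero. -/
theorem expand_unique {x x' : List ℤ} (he : expand x = expand x')
    (h : ∀ i, i < x.length → i < x'.length → (x.getD i 0).natAbs = (x'.getD i 0).natAbs ∨
      ((i + 1 < x.length → x.getD (i + 1) 0 ≠ 0) ∧ (i + 1 < x'.length → x'.getD (i + 1) 0 ≠ 0))) :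
    x = x' := by
  induction x generalizing x' with
  | nil =>
    cases x' with
    | nil => rfl
    | cons k' x' =>
      exfalso
      rw [expand_cons] at he
      exact connector_ne_nil k' (List.append_eq_nil_iff.mp he.symm).1
  | cons k x ih =>
    cases x' with
    | nil =>
      exfalso
      rw [expand_cons] at he
      exact connector_ne_nil k (List.append_eq_nil_iff.mp he).1
    | cons k' x' =>
      have hs : k.sign = k'.sign := by
        have h1 := expand_head (k := k) (x := x)
        rw [he, expand_head] at h1
        simpa using h1.symm
      have hk : k = k' := by
        rcases h 0 (by simp) (by simp) with h0 | ⟨h1, h2⟩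
        · exact eq_of_natAbs_sign (by simpa using h0) hs
        · simp only [List.length_cons, List.getD_cons_succ, zero_add, lt_add_iff_pos_left] at h1 h2
          by_cases hk0 : k = 0
          · subst hk0; exact (Int.sign_eq_zero_iff_zero.mp hs.symm).symm
          have hk0' : k' ≠ 0 := by rintro rfl; simp at hs; exact hk0 hs
          rw [expand_cons, expand_cons] at he
          rcases lt_trichotomy k.natAbs k'.natAbs with hlt | heq | hgt
          · rw [connector_split hk0 hs hlt, List.append_assoc, List.append_cancel_left_eq,
              List.cons_append] at he
            exact absurd he (expand_not_head_zero h1)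
          · exact eq_of_natAbs_sign heq hs
          · rw [connector_split hk0' hs.symm hgt, List.append_assoc, List.append_cancel_left_eq,
              List.cons_append] at he
            exact absurd he.symm (expand_not_head_zero h2)
      subst hk
      rw [expand_cons, expand_cons, List.append_cancel_left_eq] at he
      rw [ih he (fun i h1 h2 => by simpa using h (i + 1) (by simpa using h1) (by simpa using h2))]

/-! ### Expanded even vectors are expansions of nonzero integers -/

theorem exists_labels_aux (N : ℕ) : ∀ a : List ℤ, a.length < N → TailGood a → a.head? ≠ some 0 →
    ∃ y, (∀ k ∈ y, k ≠ 0) ∧ expand y = a := by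
  induction N with
  | zero => intro a h; omega
  | succ N IH =>
    intro a hN hg h0
    cases a with
    | nil => exact ⟨[], by simp, rfl⟩
    | cons z t =>
      have hz0 : z ≠ 0 := by simpa using h0
      obtain ⟨s, hs, rfl⟩ : ∃ s : ℤ, (s = 1 ∨ s = -1) ∧ z = 2 * s := by
        rcases hg.1 z (by simp) with rfl | rfl | rfl
        · exact ⟨-1, by simp, rfl⟩
        · exact absurd rfl hz0
        · exact ⟨1, by simp, rfl⟩
      have hc : connector s = [2 * s] := by rcases hs with rfl | rfl <;> rfl
      by_cases ht : t.head? = some 0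
      · cases t with
        | nil => simp at ht
        | cons w t =>
          obtain rfl : w = 0 := by simpa using ht
          cases t with
          | nil => exact absurd rfl hg.2.1
          | cons w t =>
            obtain ⟨h1, -, h3⟩ := hg.2.2 (2 * s) w (List.prefix_append [2 * s, 0, w] t).isInfix
            subst h1
            obtain ⟨y, hy, hye⟩ := IH (2 * s :: t) (by simp at hN ⊢; omega) hg.tail.tail
              (by simpa using hz0)
            cases y with
            | nil => simp at hye
            | cons k y =>
              have hsign : k.sign = s := by
                have h1 := expand_head (k := k) (x := y)
                rw [hye] at h1
                simp at h1
                omega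
              have hk0 : k ≠ 0 := hy k (by simp)
              have hs' : s.sign = s := by rcases hs with rfl | rfl <;> rfl
              have hks : (s + k).natAbs = k.natAbs + 1 ∧ (s + k).sign = s := by
                rcases hs with rfl | rfl
                · have := Int.sign_eq_one_iff_pos.mp hsign
                  exact ⟨by omega, Int.sign_eq_one_iff_pos.mpr (by omega)⟩
                · have := Int.sign_eq_neg_one_iff_neg.mp hsign
                  exact ⟨by omega, Int.sign_eq_neg_one_iff_neg.mpr (by omega)⟩
              have hs0 : s ≠ 0 := by omega
              have hs1 : s.natAbs = 1 := by omega
              refine ⟨(s + k) :: y, ?_, ?_⟩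
              · intro j hj
                rcases List.mem_cons.mp hj with rfl | hj
                · intro h; rw [h] at hks; simp at hks
                · exact hy j (by simp [hj])
              · rw [expand_cons, connector_split hs0 (hs'.trans hks.2.symm) (by omega), hc, hks.1,
                  hs1,
                  Nat.add_sub_cancel, hs', ← hsign, ← connector_of_ne hk0]
                rw [expand_cons] at hye
                simp only [List.cons_append, List.nil_append]
                rw [hye, hsign]
      · obtain ⟨y, hy, hye⟩ := IH t (by simp at hN; omega) hg.tail ht
        refine ⟨s :: y, ?_, ?_⟩
        · intro j hj
          rcases List.mem_cons.mp hj with rfl | hj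
          · omega
          · exact hy j hj
        · rw [expand_cons, hc, hye]; rfl

/-- An expanded even vector is the expansion of a list of nonzero integers, its labels: `0` occurs
only between two equal entries, so the entries group into blocks `±(2, 0, 2, …, 0, 2)`. -/
theorem exists_labels {a : List ℤ} (ha : IsExpandedEven a) :
    ∃ y, (∀ k ∈ y, k ≠ 0) ∧ expand y = a :=
  exists_labels_aux (a.length + 1) a (by omega) ⟨ha.1, ha.2.2.1, ha.2.2.2⟩ ha.2.1

theorem getD_mem_ne {y : List ℤ} (hy : ∀ k ∈ y, k ≠ 0) {i : ℕ} (hi : i < y.length) :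
    y.getD i 0 ≠ 0 := by
  rw [List.getD_eq_getElem _ _ hi]
  exact hy _ (List.getElem_mem hi)

theorem labels_unique {y y' : List ℤ} (hy : ∀ k ∈ y, k ≠ 0) (hy' : ∀ k ∈ y', k ≠ 0)
    (h : expand y = expand y') : y = y' :=
  expand_unique h fun _ _ _ => Or.inr ⟨fun hi => getD_mem_ne hy hi, fun hi => getD_mem_ne hy' hi⟩

/-- The zeros of `x` lie inside the list, have equal nonzero neighbours, and are at distance at
least three from each other. -/
def IsolatedZeros (x : List ℤ) : Prop :=
  ∀ i < x.length, x.getD i 0 = 0 → 1 ≤ i ∧ i + 1 < x.length ∧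
    x.getD (i - 1) 0 = x.getD (i + 1) 0 ∧ x.getD (i + 1) 0 ≠ 0 ∧
    (i + 2 < x.length → x.getD (i + 2) 0 ≠ 0)

/-- Isolated zeros can be merged with their neighbours, which leaves the expansion unchanged. The
function `p` tells where the merged entries begin. -/
theorem exists_merge (N : ℕ) : ∀ x : List ℤ, x.length < N → IsolatedZeros x →
    ∃ y, (∀ k ∈ y, k ≠ 0) ∧ expand y = expand x ∧ ∃ p : ℕ → ℕ, p 0 = 0 ∧ p y.length = x.length ∧
      ∀ t < y.length, (p (t + 1) = p t + 1 ∧ y.getD t 0 = x.getD (p t) 0) ∨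
        (p (t + 1) = p t + 3 ∧ y.getD t 0 = 2 * x.getD (p t) 0 ∧ x.getD (p t + 1) 0 = 0 ∧
          x.getD (p t + 2) 0 = x.getD (p t) 0) := by
  induction N with
  | zero => intro x h; omega
  | succ N IH =>
    intro x hN hz
    cases x with
    | nil => exact ⟨[], by simp, rfl, fun _ => 0, rfl, rfl, fun t ht => by simp at ht⟩
    | cons u x =>
      have hu : u ≠ 0 := by
        rintro rfl
        have := (hz 0 (by simp) rfl).1
        omega
      by_cases h0 : 0 < x.length ∧ x.getD 0 0 = 0
      · have h1 := hz 1 (by simp; omega) (by simpa using h0.2)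
        simp only [List.length_cons, Nat.sub_self, List.getD_cons_zero, List.getD_cons_succ,
          Nat.reduceAdd] at h1
        match x, h0, h1, hz with
        | v :: w :: x, h0, h1, hz =>
          simp at h0 h1
          obtain ⟨rfl, hu', h2⟩ := h1
          subst h0
          obtain ⟨y, y1, y2, p, p1, p2, p3⟩ := IH x (by simp at hN; omega) (by
            intro i hi hi0
            have := hz (i + 3) (by simp; omega) (by simpa using hi0)
            simp only [List.length_cons, List.getD_cons_succ, Nat.add_assoc] at this
            obtain ⟨-, a2, a3, a4, a5⟩ := this
            have hi1 : 1 ≤ i := by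
              rcases Nat.eq_zero_or_pos i with rfl | h
              · exfalso
                exact h2 hi (by simpa using hi0)
              · exact h
            refine ⟨hi1, by omega, ?_, by simpa using a4, fun h => by simpa using a5 (by omega)⟩
            obtain ⟨i, rfl⟩ : ∃ j, i = j + 1 := ⟨i - 1, by omega⟩
            simpa [show i + 1 + 3 - 1 = i + 3 by omega] using a3)
          refine ⟨2 * u :: y, ?_, ?_, fun t => if t = 0 then 0 else p (t - 1) + 3, by simp, ?_, ?_⟩
          · intro k hk
            rcases List.mem_cons.mp hk with rfl | hk
            · omega
            · exact y1 k hk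
          · rw [expand_cons, connector_two_mul hu, y2]
            simp [connector_zero]
          · simp [p2]
          · intro t ht
            cases t with
            | zero => right; simp [p1]
            | succ t =>
              simp only [List.length_cons, Nat.add_lt_add_iff_right] at ht
              rcases p3 t ht with ⟨a1, a2⟩ | ⟨a1, a2, a3, a4⟩
              · left; simp only [Nat.add_eq_zero_iff, one_ne_zero, and_false, if_false,
                  Nat.add_sub_cancel, List.getD_cons_succ]
                exact ⟨by omega, a2⟩
              · right; simp only [Nat.add_eq_zero_iff, one_ne_zero, and_false, if_false,
                  Nat.add_sub_cancel, List.getD_cons_succ]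
                exact ⟨by omega, a2, by simpa using a3, by simpa using a4⟩
      · obtain ⟨y, y1, y2, p, p1, p2, p3⟩ := IH x (by simp at hN; omega) (by
          intro i hi hi0
          have := hz (i + 1) (by simp; omega) (by simpa using hi0)
          simp only [List.length_cons, List.getD_cons_succ, Nat.add_assoc] at this
          obtain ⟨-, a2, a3, a4, a5⟩ := this
          have hi1 : 1 ≤ i := by
            rcases Nat.eq_zero_or_pos i with rfl | h
            · exact absurd ⟨hi, hi0⟩ h0
            · exact h
          refine ⟨hi1, by omega, ?_, by simpa using a4, fun h => by simpa using a5 (by omega)⟩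
          obtain ⟨i, rfl⟩ : ∃ j, i = j + 1 := ⟨i - 1, by omega⟩
          simpa using a3)
        refine ⟨u :: y, ?_, by rw [expand_cons, expand_cons, y2],
          fun t => if t = 0 then 0 else p (t - 1) + 1, by simp, by simp [p2], ?_⟩
        · intro k hk
          rcases List.mem_cons.mp hk with rfl | hk
          · exact hu
          · exact y1 k hk
        · intro t ht
          cases t with
          | zero => left; simp [p1]
          | succ t =>
            simp only [List.length_cons, Nat.add_lt_add_iff_right] at ht
            rcases p3 t ht with ⟨a1, a2⟩ | ⟨a1, a2, a3, a4⟩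
            · left; simp only [Nat.add_eq_zero_iff, one_ne_zero, and_false, if_false,
                Nat.add_sub_cancel, List.getD_cons_succ]
              exact ⟨by omega, a2⟩
            · right; simp only [Nat.add_eq_zero_iff, one_ne_zero, and_false, if_false,
                Nat.add_sub_cancel, List.getD_cons_succ]
              exact ⟨by omega, a2, by simpa using a3, by simpa using a4⟩


/-! ### Unfolded words -/

/-- `c` consists of `n + 1` copies of `x`, alternately read forwards and backwards and multiplied by
the signs `σ 0, …, σ n`, with single entries between them; if such an entry is `0` then the adjacent
signs agree. -/
structure Unf (x c : List ℤ) (n : ℕ) (σ : ℕ → ℤˣ) : Prop where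
  len : c.length + 1 = (n + 1) * (x.length + 1)
  letter : ∀ j ≤ n, ∀ i < x.length, c.getD (j * (x.length + 1) + i) 0 =
    σ j * (if j % 2 = 0 then x.getD i 0 else x.getD (x.length - 1 - i) 0)
  zero : ∀ j < n, c.getD (j * (x.length + 1) + x.length) 0 = 0 → σ j = σ (j + 1)

theorem getD_signed (ε : ℤˣ) (x : List ℤ) (i : ℕ) : (signed ε x).getD i 0 = ε * x.getD i 0 := by
  simp only [signed, List.getD_eq_getElem?_getD, List.getElem?_map]
  cases x[i]? <;> simp

theorem getD_reverse {x : List ℤ} {i : ℕ} (hi : i < x.length) :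
    x.reverse.getD i 0 = x.getD (x.length - 1 - i) 0 := by
  rw [List.getD_eq_getElem?_getD, List.getD_eq_getElem?_getD, List.getElem?_reverse hi]

theorem getD_take {x : List ℤ} {k i : ℕ} (hi : i < k) : (x.take k).getD i 0 = x.getD i 0 := by
  simp [List.getD_eq_getElem?_getD, hi]

theorem getD_drop (x : List ℤ) (k i : ℕ) : (x.drop k).getD i 0 = x.getD (k + i) 0 := by
  simp [List.getD_eq_getElem?_getD, List.getElem?_drop]

theorem ext_getD {x y : List ℤ} (hl : x.length = y.length)
    (h : ∀ i < x.length, x.getD i 0 = y.getD i 0) : x = y := by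
  apply List.ext_getElem hl
  intro i h1 h2
  have := h i h1
  rwa [List.getD_eq_getElem _ _ h1, List.getD_eq_getElem _ _ h2] at this

theorem mid_getD {x c : List ℤ} {k : ℤ} {M : ℕ} (hM : x.length = M) :
    (∀ i < M, (x ++ k :: c).getD i 0 = x.getD i 0) ∧ (x ++ k :: c).getD M 0 = k ∧
      ∀ i, (x ++ k :: c).getD (M + 1 + i) 0 = c.getD i 0 := by
  subst hM
  refine ⟨fun i hi => List.getD_append _ _ _ _ hi, ?_, fun i => ?_⟩
  · rw [List.getD_append_right _ _ _ _ le_rfl]; simp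
  · rw [List.getD_append_right _ _ _ _ (by omega), show x.length + 1 + i - x.length =
      i + 1 by omega]
    simp

theorem Unf.cons {x c : List ℤ} {n : ℕ} {σ : ℕ → ℤˣ} (h : Unf x.reverse c n σ) {k : ℤ} {ε : ℤˣ}
    (hk : k = 0 → ε = σ 0) :
    Unf x (signed ε x ++ k :: c) (n + 1) (fun j => if j = 0 then ε else σ (j - 1)) := by
  obtain ⟨h1, h2, h3⟩ := h
  rw [List.length_reverse] at h1 h2 h3
  obtain ⟨g1, g2, g3⟩ := mid_getD (x := signed ε x) (c := c) (k := k) (signed_length ε x)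
  refine ⟨?_, fun j hj i hi => ?_, fun j hj h0 => ?_⟩
  · simp only [List.length_append, List.length_cons, signed_length]
    rw [show x.length + (c.length + 1) + 1 = x.length + 1 + (c.length + 1) by omega, h1]; ring
  · cases j with
    | zero => simp only [zero_mul, zero_add, Nat.zero_mod, if_true]; rw [g1 i hi, getD_signed]
    | succ j =>
      have := h2 j (by omega) i hi
      rw [show (j + 1) * (x.length + 1) + i = x.length + 1 + (j * (x.length + 1) + i) by ring, g3,
        this, if_neg (Nat.succ_ne_zero j), Nat.add_sub_cancel]
      congr 1
      rw [getD_reverse hi, getD_reverse (by omega)]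
      rcases Nat.mod_two_eq_zero_or_one j with hj2 | hj2
      · rw [if_pos hj2, if_neg (by omega)]
      · rw [if_neg (by omega), if_pos (by omega)]
        congr 1; omega
  · cases j with
    | zero =>
      simp only [zero_mul, zero_add] at h0
      rw [g2] at h0
      simpa using hk h0
    | succ j =>
      rw [show (j + 1) * (x.length + 1) + x.length = x.length + 1 + (j * (x.length + 1) + x.length)
        by ring, g3] at h0
      simpa using h3 j (by omega) h0

/-- A tiling lifts to lists that expand to the given vectors. -/
theorem exists_unf_of_tiling {a c : List ℤ} {ε : ℤˣ} (h : Tiling a ε c) :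
    ∀ x, expand x = a → ∃ xc n σ, σ 0 = ε ∧ Unf x xc n σ ∧ expand xc = c := by
  induction h with
  | last a ε =>
    rintro x rfl
    refine ⟨signed ε x, 0, fun _ => ε, rfl, ⟨by simp, fun j hj i hi => ?_, fun j hj => by omega⟩,
      (signed_expand ε x).symm⟩
    obtain rfl : j = 0 := by omega
    simp only [zero_mul, zero_add, Nat.zero_mod, if_true]
    exact getD_signed _ _ _
  | step a ε ε' k c hk h ih =>
    rintro x rfl
    obtain ⟨xc, n, σ, h1, h2, h3⟩ := ih x.reverse (expand_reverse x).symm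
    refine ⟨_, _, _, ?_, h2.cons (k := k) (ε := ε) (fun h0 => by rw [h1]; exact hk h0), ?_⟩
    · simp
    · rw [expand_append, expand_cons, h3, signed_expand, List.append_assoc]

/-- Conversely, an unfolded word expands to a tiled vector. -/
theorem tiling_of_unf {n : ℕ} : ∀ {x c : List ℤ} {σ : ℕ → ℤˣ}, Unf x c n σ →
    Tiling (expand x) (σ 0) (expand c) := by
  induction n with
  | zero =>
    rintro x c σ ⟨h1, h2, -⟩
    have : c = signed (σ 0) x := by
      apply ext_getD (by simp at h1 ⊢; omega)
      intro i hi
      have := h2 0 le_rfl i (by simp at h1; omega)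
      rw [getD_signed]
      simpa using this
    rw [this, ← signed_expand]
    exact Tiling.last _ _
  | succ n ih =>
    rintro x c σ ⟨h1, h2, h3⟩
    have hlen : x.length < c.length := by
      have : (n + 1 + 1) * (x.length + 1) = (n + 1) * (x.length + 1) + (x.length + 1) := by ring
      have : x.length + 1 ≤ (n + 1) * (x.length + 1) := Nat.le_mul_of_pos_left _ (by omega)
      omega
    obtain ⟨k, hk⟩ : ∃ k, k = c.getD x.length 0 := ⟨_, rfl⟩
    have hc : c = signed (σ 0) x ++ k :: c.drop (x.length + 1) := by
      conv_lhs => rw [← List.take_append_drop x.length c]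
      congr 1
      · apply ext_getD (by simp; omega)
        intro i hi
        rw [List.length_take] at hi
        have := h2 0 (by omega) i (by omega)
        rw [getD_take (by omega), getD_signed]
        simpa using this
      · rw [List.drop_eq_getElem_cons hlen, hk, List.getD_eq_getElem _ _ hlen]
    have hU : Unf x.reverse (c.drop (x.length + 1)) n (fun j => σ (j + 1)) := by
      refine ⟨?_, fun j hj i hi => ?_, fun j hj h0 => ?_⟩
      · rw [List.length_drop, List.length_reverse]
        have : (n + 1 + 1) * (x.length + 1) = (n + 1) * (x.length + 1) + (x.length + 1) := by ring
        omega
      · rw [List.length_reverse] at hi ⊢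
        have := h2 (j + 1) (by omega) i hi
        rw [getD_drop, show x.length + 1 + (j * (x.length + 1) + i) =
          (j + 1) * (x.length + 1) + i by
          ring, this]
        congr 1
        rw [getD_reverse hi, getD_reverse (by omega)]
        rcases Nat.mod_two_eq_zero_or_one j with hj2 | hj2
        · rw [if_pos hj2, if_neg (by omega : ¬ (j + 1) % 2 = 0)]
        · rw [if_neg (by omega : ¬ j % 2 = 0), if_pos (by omega : (j + 1) % 2 = 0)]
          congr 1; omega
      · rw [List.length_reverse, getD_drop, show x.length + 1 + (j * (x.length + 1) + x.length) =
          (j + 1) * (x.length + 1) + x.length by ring] at h0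
        exact h3 (j + 1) (by omega) h0
    rw [hc, expand_append, expand_cons, ← List.append_assoc, ← signed_expand]
    refine Tiling.step _ _ (σ 1) k _ (fun h0 => ?_) ?_
    · exact h3 0 (by omega) (by rw [zero_mul, zero_add, ← hk, h0])
    · rw [expand_reverse]; exact ih hU

theorem Unf.signed_left {x c : List ℤ} {n : ℕ} {σ : ℕ → ℤˣ} (h : Unf x c n σ) (δ : ℤˣ) :
    Unf (signed δ x) c n (fun j => σ j * δ) := by
  obtain ⟨h1, h2, h3⟩ := h
  refine ⟨by simpa using h1, fun j hj i hi => ?_, fun j hj h0 => ?_⟩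
  · rw [signed_length] at hi ⊢
    rw [h2 j hj i hi, getD_signed, getD_signed]
    have : (δ : ℤ) * δ = 1 := by rcases units_int_cases δ with h | h <;> rw [h] <;> rfl
    push_cast
    split_ifs <;> linear_combination (- (σ j : ℤ) * x.getD _ 0) * this
  · rw [signed_length] at h0
    rw [h3 j hj h0]

theorem Unf.of_signed {x c : List ℤ} {n : ℕ} {σ : ℕ → ℤˣ} {δ : ℤˣ} (h : Unf x (signed δ c) n σ) :
    Unf x c n (fun j => δ * σ j) := by
  obtain ⟨h1, h2, h3⟩ := h
  have hδ : (δ : ℤ) * δ = 1 := by rcases units_int_cases δ with h | h <;> rw [h] <;> rfl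
  refine ⟨by simpa using h1, fun j hj i hi => ?_, fun j hj h0 => ?_⟩
  · have := h2 j hj i hi
    rw [getD_signed] at this
    push_cast
    rw [mul_assoc, ← this, ← mul_assoc, hδ, one_mul]
  · rw [h3 j hj (by rw [getD_signed, h0, mul_zero])]

theorem Unf.normalize {x c : List ℤ} {n : ℕ} {σ : ℕ → ℤˣ} (h : Unf x c n σ) :
    ∃ σ', σ' 0 = 1 ∧ Unf (signed (σ 0) x) c n σ' :=
  ⟨_, by simp, h.signed_left (σ 0)⟩

theorem Unf.reverse {x c : List ℤ} {n : ℕ} {σ : ℕ → ℤˣ} (hn : Even n) (h : Unf x c n σ) :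
    Unf x.reverse c.reverse n (fun j => σ (n - j)) := by
  obtain ⟨h1, h2, h3⟩ := h
  have key : ∀ j ≤ n, ∀ i ≤ x.length, j * (x.length + 1) + i < c.length →
      c.length - 1 - (j * (x.length + 1) + i) + 1 = (n - j) * (x.length + 1) + (x.length - i) := by
    intro j hj i hi hlt
    obtain ⟨d, rfl⟩ := Nat.exists_eq_add_of_le hj
    have : (j + d + 1) * (x.length + 1) =
        j * (x.length + 1) + (d * (x.length + 1) + (x.length + 1)) :=
      by ring
    rw [Nat.add_sub_cancel_left]
    omega
  have bound : ∀ j < n + 1, (j + 1) * (x.length + 1) ≤ c.length + 1 := by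
    intro j hj; rw [h1]; exact Nat.mul_le_mul_right _ hj
  refine ⟨by simpa using h1, fun j hj i hi => ?_, fun j hj h0 => ?_⟩
  · rw [List.length_reverse] at hi ⊢
    have hb := bound j (by omega)
    rw [add_mul, one_mul] at hb
    have hk := key j hj i (by omega) (by omega)
    rw [getD_reverse (by omega), show c.length - 1 - (j * (x.length + 1) + i) =
      (n - j) * (x.length + 1) + (x.length - 1 - i) by omega, h2 _ (by omega) _ (by omega)]
    rw [Nat.even_iff] at hn
    congr 1
    rw [getD_reverse hi, getD_reverse (by omega)]
    rcases Nat.mod_two_eq_zero_or_one j with hj2 | hj2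
    · rw [if_pos (by omega), if_pos hj2]
    · rw [if_neg (by omega), if_neg (by omega)]
  · rw [List.length_reverse] at h0
    have hb := bound (j + 1) (by omega)
    rw [add_mul, one_mul, add_mul, one_mul] at hb
    have hk := key j hj.le x.length le_rfl (by omega)
    have hnj : (n - j) * (x.length + 1) = (n - (j + 1)) * (x.length + 1) + (x.length + 1) := by
      rw [show n - j = n - (j + 1) + 1 by omega]; ring
    rw [getD_reverse (by omega), show c.length - 1 - (j * (x.length + 1) + x.length) =
      (n - (j + 1)) * (x.length + 1) + x.length by omega] at h0
    have := h3 (n - (j + 1)) (by omega) h0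
    rw [this]
    congr 1; omega

/-- When the unfolded word has even length, the number of copies is odd. -/
theorem Unf.even {x c : List ℤ} {n : ℕ} {σ : ℕ → ℤˣ} (h : Unf x c n σ) (hc : Even c.length) :
    Even n := by
  have h1 : Odd ((n + 1) * (x.length + 1)) := by rw [← h.len]; exact hc.add_one
  have := (Nat.odd_mul.mp h1).1
  rw [Nat.odd_iff] at this
  rw [Nat.even_iff]; omega

/-! ### Unfolded words and runs -/

/-- The absolute values of the entries. -/
def absW (x : List ℤ) : ℕ → ℕ := fun i => (x.getD i 0).natAbs

/-- Whether the entries before and at position `i` have the same sign. -/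
def bitW (x : List ℤ) : ℕ → Bool := fun i => decide (0 < x.getD (i - 1) 0 * x.getD i 0)

theorem phase_val (m : ℕ) {j i : ℕ} (hi : i ≤ m) :
    phase (m + 1) 0 ((j * (m + 1) + i : ℕ) : ℤ) =
      if j % 2 = 0 then (i, true) else (m - i, false) := by
  rcases Nat.mod_two_eq_zero_or_one j with hj | hj
  · rw [if_pos hj]
    obtain ⟨k, rfl⟩ : ∃ k, j = 2 * k := ⟨j / 2, by omega⟩
    rw [phase_congr (j := (i : ℤ)) ⟨k, by push_cast; ring⟩]
    exact phase_true_val (Int.emod_eq_of_lt (by omega) (by push_cast; omega)) (by omega)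
  · rw [if_neg (by omega)]
    obtain ⟨k, rfl⟩ : ∃ k, j = 2 * k + 1 := ⟨j / 2, by omega⟩
    rw [phase_congr (j := ((m + 1 + i : ℕ) : ℤ)) ⟨k, by push_cast; ring⟩]
    refine phase_false_val ?_ (by omega)
    rw [Int.emod_eq_of_lt (by omega) (by push_cast; omega)]
    push_cast
    omega

theorem step_phase_letter {m j i : ℕ} {A : ℕ → ℕ} (hi : i < m) {y : ℕ}
    (hy : y = A (if j % 2 = 0 then i else m - 1 - i)) :
    Step m A (phase (m + 1) 0 ((j * (m + 1) + i : ℕ) : ℤ)) y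
      (phase (m + 1) 0 ((j * (m + 1) + i + 1 : ℕ) : ℤ)) := by
  rw [phase_val m hi.le, add_assoc, phase_val m (by omega)]
  split_ifs at hy ⊢
  · exact Or.inl ⟨rfl, hi, hy, rfl⟩
  · refine Or.inr (Or.inr (Or.inr (Or.inl ⟨rfl, by simp only; omega, by simp only; omega, ?_, ?_⟩)))
    · rw [hy]; congr 1; simp only; omega
    · simp only [Prod.mk.injEq, and_true]; omega

theorem step_phase_connector {m j : ℕ} {A : ℕ → ℕ} {y : ℕ} :
    Step m A (phase (m + 1) 0 ((j * (m + 1) + m : ℕ) : ℤ)) y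
      (phase (m + 1) 0 ((j * (m + 1) + m + 1 : ℕ) : ℤ)) := by
  rw [phase_val m le_rfl, show j * (m + 1) + m + 1 = (j + 1) * (m + 1) + 0 by ring,
    phase_val m (by omega)]
  rcases Nat.mod_two_eq_zero_or_one j with hj | hj
  · rw [if_pos hj, if_neg (by omega)]
    exact Or.inr (Or.inr (Or.inl ⟨rfl, rfl, rfl⟩))
  · rw [if_neg (by omega), if_pos (by omega)]
    exact Or.inr (Or.inr (Or.inr (Or.inr (Or.inr ⟨rfl, by simp, rfl⟩))))

theorem step_phase_merged {m j : ℕ} {A : ℕ → ℕ} {y : ℕ} (hm : 2 ≤ m)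
    (hy : y = 2 * A (if j % 2 = 0 then m - 1 else 0)) :
    Step m A (phase (m + 1) 0 ((j * (m + 1) + (m - 1) : ℕ) : ℤ)) y
      (phase (m + 1) 0 ((j * (m + 1) + (m - 1) + 3 : ℕ) : ℤ)) := by
  rw [phase_val m (by omega), show j * (m + 1) + (m - 1) + 3 = (j + 1) * (m + 1) + 1 by
    rw [add_mul]; omega, phase_val m (by omega)]
  rcases Nat.mod_two_eq_zero_or_one j with hj | hj
  · rw [if_pos hj] at hy ⊢
    rw [if_neg (by omega)]
    exact Or.inr (Or.inl ⟨rfl, by simp only; omega, hy, rfl⟩)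
  · rw [if_neg (by omega)] at hy ⊢
    rw [if_pos (by omega), show m - (m - 1) = 1 by omega]
    exact Or.inr (Or.inr (Or.inr (Or.inr (Or.inl ⟨rfl, rfl, hy, rfl⟩))))

theorem exists_div_mod (M P : ℕ) : ∃ j i, P = j * (M + 1) + i ∧ i ≤ M :=
  ⟨P / (M + 1), P % (M + 1), by rw [mul_comm]; exact (Nat.div_add_mod _ _).symm,
    Nat.le_of_lt_succ (Nat.mod_lt _ (by omega))⟩

theorem Unf.le_of_lt {x c : List ℤ} {n : ℕ} {σ : ℕ → ℤˣ} (h : Unf x c n σ) {j i : ℕ}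
    (hlt : j * (x.length + 1) + i < c.length) : j ≤ n ∧ (i = x.length → j < n) := by
  have h1 := h.len
  constructor
  · by_contra hj
    have : (n + 1) * (x.length + 1) ≤ j * (x.length + 1) := Nat.mul_le_mul_right _ (by omega)
    omega
  · rintro rfl
    by_contra hj
    have : n * (x.length + 1) ≤ j * (x.length + 1) := Nat.mul_le_mul_right _ (by omega)
    rw [add_mul, one_mul] at h1
    omega

theorem Unf.letter_ne {x c : List ℤ} {n : ℕ} {σ : ℕ → ℤˣ} (h : Unf x c n σ)
    (hx : ∀ k ∈ x, k ≠ 0) {j i : ℕ} (hj : j ≤ n) (hi : i < x.length) :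
    c.getD (j * (x.length + 1) + i) 0 ≠ 0 := by
  rw [h.letter j hj i hi]
  refine mul_ne_zero (by simp) ?_
  split_ifs
  · exact getD_mem_ne hx hi
  · exact getD_mem_ne hx (by omega)

/-- The neighbours of a zero of an unfolded word are equal. -/
theorem Unf.zero_neighbours {x c : List ℤ} {n : ℕ} {σ : ℕ → ℤˣ} (h : Unf x c n σ)
    (hx0 : 0 < x.length) {j : ℕ} (hj : j < n)
    (h0 : c.getD (j * (x.length + 1) + x.length) 0 = 0) :
    c.getD (j * (x.length + 1) + (x.length - 1)) 0 = c.getD ((j + 1) * (x.length + 1) + 0) 0 := by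
  rw [h.letter j hj.le _ (by omega), h.letter (j + 1) (by omega) _ hx0, h.zero j hj h0]
  congr 1
  rcases Nat.mod_two_eq_zero_or_one j with hj2 | hj2
  · rw [if_pos hj2, if_neg (by omega), Nat.sub_zero]
  · rw [if_neg (by omega), if_pos (by omega), Nat.sub_self]

theorem Unf.natAbs_letter {x c : List ℤ} {n : ℕ} {σ : ℕ → ℤˣ} (h : Unf x c n σ) {j i : ℕ}
    (hj : j ≤ n) (hi : i < x.length) : (c.getD (j * (x.length + 1) + i) 0).natAbs =
      absW x (if j % 2 = 0 then i else x.length - 1 - i) := by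
  rw [h.letter j hj i hi, Int.natAbs_mul, Int.units_natAbs, one_mul, absW]
  split_ifs <;> rfl

theorem Unf.isolatedZeros {x c : List ℤ} {n : ℕ} {σ : ℕ → ℤˣ} (h : Unf x c n σ)
    (hx : ∀ k ∈ x, k ≠ 0) (hx2 : 2 ≤ x.length) : IsolatedZeros c := by
  intro P hP h0
  obtain ⟨j, i, rfl, hi⟩ := exists_div_mod x.length P
  obtain ⟨hj1, hj2⟩ := h.le_of_lt hP
  rcases Nat.lt_or_ge i x.length with hi' | hi'
  · exact absurd h0 (h.letter_ne hx hj1 hi')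
  · obtain rfl : i = x.length := by omega
    have hj := hj2 rfl
    have hlen := h.len
    have hb : (j + 1 + 1) * (x.length + 1) ≤ (n + 1) * (x.length + 1) :=
      Nat.mul_le_mul_right _ (by omega)
    rw [add_mul, one_mul, add_mul, one_mul] at hb
    have e1 : j * (x.length + 1) + x.length + 1 = (j + 1) * (x.length + 1) + 0 := by ring
    have e2 : j * (x.length + 1) + x.length + 2 = (j + 1) * (x.length + 1) + 1 := by ring
    refine ⟨by omega, by omega, ?_, ?_, fun _ => ?_⟩
    · rw [e1, show j * (x.length + 1) + x.length - 1 = j * (x.length + 1) + (x.length - 1) by omega]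
      exact h.zero_neighbours (by omega) hj h0
    · rw [e1]; exact h.letter_ne hx (by omega) (by omega)
    · rw [e2]; exact h.letter_ne hx (by omega) (by omega)

/-- The merged labels of an unfolded word are accepted by the automaton of the absolute values of
the folded word, with bits for the changes of sign. -/
theorem Unf.accRun {x c y : List ℤ} {n : ℕ} {σ : ℕ → ℤˣ} (h : Unf x c n σ)
    (hx : ∀ k ∈ x, k ≠ 0) (hx2 : 2 ≤ x.length) (hn : Even n) (hy : ∀ k ∈ y, k ≠ 0)
    (he : expand y = expand c) :
    ∃ α, AccRun x.length (absW x) (bitW x) y.length (absW y) (bitW y) α := by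
  obtain ⟨y', hy', he', p, p0, p1, p2⟩ := exists_merge (c.length + 1) c (by omega)
    (h.isolatedZeros hx hx2)
  obtain rfl : y = y' := labels_unique hy hy' (he.trans he'.symm)
  have hmono : ∀ t ≤ y.length, ∀ s ≤ t, p s ≤ p t := by
    intro t
    induction t with
    | zero => intro _ s hs; rw [Nat.le_zero.mp hs]
    | succ t ih =>
      intro ht s hs
      rcases Nat.eq_or_lt_of_le hs with rfl | hs
      · exact le_rfl
      · have := ih (by omega) s (by omega)
        rcases p2 t (by omega) with ⟨q, -⟩ | ⟨q, -⟩ <;> omega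
  have hpl : ∀ t < y.length, p (t + 1) ≤ c.length := fun t ht =>
    p1 ▸ hmono _ le_rfl _ ht
  refine ⟨fun t => phase (x.length + 1) 0 (p t), ?_, ?_, fun t ht => ?_, fun t h1 ht g1 g2 => ?_⟩
  · rw [p0]
    simpa using phase_val x.length (j := 0) (i := 0) (by omega)
  · have e : c.length = n * (x.length + 1) + x.length := by
      have := h.len; rw [add_mul, one_mul] at this; omega
    rw [p1, e, phase_val _ le_rfl, if_pos (Nat.even_iff.mp hn)]
  · obtain ⟨j, i, hP, hi⟩ := exists_div_mod x.length (p t)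
    have hle := hpl t ht
    rcases p2 t ht with ⟨q1, q2⟩ | ⟨q1, q2, q3, q4⟩
    · obtain ⟨hj1, hj2⟩ := h.le_of_lt (j := j) (i := i) (by omega)
      rw [q1, hP]
      rcases Nat.lt_or_ge i x.length with hi' | hi'
      · apply step_phase_letter hi'
        rw [absW, q2, hP, h.natAbs_letter hj1 hi']
      · obtain rfl : i = x.length := by omega
        exact step_phase_connector
    · -- a zero follows, so the copy ends after this letter
      have hi' : i = x.length - 1 := by
        by_contra hne
        rcases Nat.lt_or_ge i x.length with hi' | hi'
        · refine h.letter_ne hx (j := j) (i := i + 1) ?_ (by omega) ?_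
          · exact (h.le_of_lt (j := j) (i := i) (by omega)).1
          · rw [hP, add_assoc] at q3; exact q3
        · refine h.letter_ne hx (j := j + 1) (i := 0) ?_ (by omega) ?_
          · exact (h.le_of_lt (j := j) (i := i) (by omega)).2 (by omega)
          · obtain rfl : i = x.length := by omega
            rwa [hP, show j * (x.length + 1) + x.length + 1 = (j + 1) * (x.length + 1) + 0 by ring]
              at q3
      subst hi'
      obtain ⟨hj1, -⟩ := h.le_of_lt (j := j) (i := x.length - 1) (by omega)
      rw [q1, hP]
      apply step_phase_merged hx2
      rw [absW, q2, hP, Int.natAbs_mul, h.natAbs_letter hj1 (by omega)]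
      congr 2
      split_ifs <;> omega
  · beta_reduce at g1 g2 ⊢
    obtain ⟨s, rfl⟩ : ∃ s, t = s + 1 := ⟨t - 1, by omega⟩
    obtain ⟨j, i, hP, hi⟩ := exists_div_mod x.length (p (s + 1))
    have hle := hpl (s + 1) ht
    have hpp : p (s + 1) < c.length := by
      rcases p2 (s + 1) ht with ⟨q, -⟩ | ⟨q, -⟩ <;> omega
    obtain ⟨hj1, -⟩ := h.le_of_lt (j := j) (i := i) (by omega)
    rw [hP, phase_val _ hi] at g1 g2 ⊢
    have hi1 : 1 ≤ i ∧ i < x.length := by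
      split_ifs at g1 g2 <;> simp only at g1 g2 <;> omega
    -- both labels have the signs of the entries next to the edge
    have s1 : ∃ k : ℤ, 0 < k ∧ y.getD s 0 = k * c.getD (p (s + 1) - 1) 0 := by
      rcases p2 s (by omega) with ⟨q1, q2⟩ | ⟨q1, q2, q3, q4⟩
      · exact ⟨1, by norm_num, by rw [q2, q1]; simp⟩
      · refine ⟨2, by norm_num, ?_⟩
        rw [q2, q1, show p s + 3 - 1 = p s + 2 by omega, q4]
    have s2 : ∃ k : ℤ, 0 < k ∧ y.getD (s + 1) 0 = k * c.getD (p (s + 1)) 0 := by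
      rcases p2 (s + 1) ht with ⟨q1, q2⟩ | ⟨q1, q2, -⟩
      · exact ⟨1, by norm_num, by rw [q2]; simp⟩
      · exact ⟨2, by norm_num, q2⟩
    obtain ⟨k1, hk1, s1⟩ := s1
    obtain ⟨k2, hk2, s2⟩ := s2
    rw [hP, show j * (x.length + 1) + i - 1 = j * (x.length + 1) + (i - 1) by omega,
      h.letter j hj1 _ (by omega)] at s1
    rw [hP, h.letter j hj1 _ (by omega)] at s2
    have hσ : (σ j : ℤ) * σ j = 1 := by
      rcases units_int_cases (σ j) with h | h <;> rw [h] <;> rfl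
    have hb : ∀ u v : ℤ, (0 < k1 * (σ j * u) * (k2 * (σ j * v))) ↔ 0 < u * v := by
      intro u v
      rw [show k1 * (σ j * u) * (k2 * (σ j * v)) = (k1 * k2) * (σ j * σ j) * (u * v) by ring, hσ,
        mul_one]
      exact mul_pos_iff_of_pos_left (mul_pos hk1 hk2)
    simp only [bitW, Nat.add_sub_cancel]
    rw [s1, s2]
    apply decide_eq_decide.mpr
    rw [hb]
    split_ifs with hj
    · rfl
    · rw [mul_comm, show x.length - 1 - i = x.length - i - 1 by omega,
        show x.length - 1 - (i - 1) = x.length - i by omega]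


/-! ### Cutting a label list along an accepted word -/

theorem isolatedZeros_of_ne {x : List ℤ} (hx : ∀ k ∈ x, k ≠ 0) : IsolatedZeros x :=
  fun _ hi h0 => absurd h0 (getD_mem_ne hx hi)

/-- The letter at position `P` of the unfolded word `e`; positions `E`, `2 * E + 1`, … are the
places between the copies. -/
def cellW (E : ℕ) (e : ℕ → ℕ) (P : ℕ) : ℕ :=
  e (if (P / (E + 1)) % 2 = 0 then P % (E + 1) else E - 1 - P % (E + 1))

theorem cell_div {E j i : ℕ} (hi : i ≤ E) : (j * (E + 1) + i) / (E + 1) = j := by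
  rw [mul_comm, Nat.mul_add_div (by omega), Nat.div_eq_of_lt (by omega), add_zero]

theorem cell_mod {E j i : ℕ} (hi : i ≤ E) : (j * (E + 1) + i) % (E + 1) = i := by
  rw [mul_comm, Nat.mul_add_mod, Nat.mod_eq_of_lt (by omega)]

theorem cellW_val {E j i : ℕ} {e : ℕ → ℕ} (hi : i ≤ E) :
    cellW E e (j * (E + 1) + i) = e (if j % 2 = 0 then i else E - 1 - i) := by
  rw [cellW, cell_div hi, cell_mod hi]

/-- Up to signs, `x` consists of copies of the word `e` of length `E`, alternately read forwards and
backwards, with single entries between them; the zeros have equal neighbours. -/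
structure Cells (E : ℕ) (e : ℕ → ℕ) (x : List ℤ) : Prop where
  letter : ∀ P < x.length, P % (E + 1) ≠ E → (x.getD P 0).natAbs = cellW E e P
  zero : ∀ P < x.length, x.getD P 0 = 0 →
    1 ≤ P ∧ P + 1 < x.length ∧ x.getD (P - 1) 0 = x.getD (P + 1) 0

theorem getD_snoc_lt {x y : List ℤ} {P : ℕ} (h : P < x.length) :
    (x ++ y).getD P 0 = x.getD P 0 := List.getD_append _ _ _ _ h

theorem getD_snoc {x y : List ℤ} (i : ℕ) : (x ++ y).getD (x.length + i) 0 = y.getD i 0 := by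
  rw [List.getD_append_right _ _ _ _ (by omega), Nat.add_sub_cancel_left]

theorem Cells.append {E : ℕ} {e : ℕ → ℕ} {x y : List ℤ} (h : Cells E e x)
    (hl : ∀ i < y.length, (x.length + i) % (E + 1) ≠ E →
      (y.getD i 0).natAbs = cellW E e (x.length + i))
    (hz : ∀ i < y.length, y.getD i 0 = 0 →
      1 ≤ i ∧ i + 1 < y.length ∧ y.getD (i - 1) 0 = y.getD (i + 1) 0) : Cells E e (x ++ y) := by
  refine ⟨fun P hP hE => ?_, fun P hP h0 => ?_⟩
  · rcases Nat.lt_or_ge P x.length with hlt | hge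
    · rw [getD_snoc_lt hlt]; exact h.letter P hlt hE
    · obtain ⟨i, rfl⟩ := Nat.exists_eq_add_of_le hge
      rw [getD_snoc]
      exact hl i (by simpa using hP) hE
  · rw [List.length_append] at hP ⊢
    rcases Nat.lt_or_ge P x.length with hlt | hge
    · rw [getD_snoc_lt hlt] at h0
      obtain ⟨h1, h2, h3⟩ := h.zero P hlt h0
      exact ⟨h1, by omega, by rw [getD_snoc_lt (by omega), getD_snoc_lt h2, h3]⟩
    · obtain ⟨i, rfl⟩ := Nat.exists_eq_add_of_le hge
      rw [getD_snoc] at h0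
      obtain ⟨h1, h2, h3⟩ := hz i (by omega) h0
      refine ⟨by omega, by omega, ?_⟩
      rw [show x.length + i - 1 = x.length + (i - 1) by omega, add_assoc, getD_snoc, getD_snoc, h3]

theorem step_phase_cases {m j i y : ℕ} {A : ℕ → ℕ} {s : ℕ × Bool} (hi : i ≤ m)
    (h : Step m A (phase (m + 1) 0 ((j * (m + 1) + i : ℕ) : ℤ)) y s) :
    (i < m ∧ y = A (if j % 2 = 0 then i else m - 1 - i) ∧
      s = phase (m + 1) 0 ((j * (m + 1) + i + 1 : ℕ) : ℤ)) ∨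
    (i + 1 = m ∧ y = 2 * A (if j % 2 = 0 then i else 0) ∧
      s = phase (m + 1) 0 ((j * (m + 1) + i + 3 : ℕ) : ℤ)) ∨
    (i = m ∧ s = phase (m + 1) 0 ((j * (m + 1) + i + 1 : ℕ) : ℤ)) := by
  have e1 : i < m → phase (m + 1) 0 ((j * (m + 1) + i + 1 : ℕ) : ℤ) =
      if j % 2 = 0 then (i + 1, true) else (m - (i + 1), false) := fun h => by
    rw [add_assoc, phase_val m (by omega)]
  have e2 : i = m → phase (m + 1) 0 ((j * (m + 1) + i + 1 : ℕ) : ℤ) =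
      if j % 2 = 0 then (m, false) else (0, true) := fun h => by
    rw [h, show j * (m + 1) + m + 1 = (j + 1) * (m + 1) + 0 by ring, phase_val m (by omega)]
    rcases Nat.mod_two_eq_zero_or_one j with hj | hj
    · rw [if_pos hj, if_neg (by omega)]; rfl
    · rw [if_pos (by omega), if_neg (by omega)]
  have e3 : i + 1 = m → phase (m + 1) 0 ((j * (m + 1) + i + 3 : ℕ) : ℤ) =
      if j % 2 = 0 then (i, false) else (1, true) := fun h => by
    rw [show j * (m + 1) + i + 3 = (j + 1) * (m + 1) + 1 by rw [add_mul]; omega,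
      phase_val m (by omega)]
    rcases Nat.mod_two_eq_zero_or_one j with hj | hj
    · rw [if_pos hj, if_neg (by omega)]
      simp only [Prod.mk.injEq, and_true]; omega
    · rw [if_pos (by omega), if_neg (by omega)]
  rw [phase_val m hi] at h
  rcases Nat.mod_two_eq_zero_or_one j with hj | hj
  · simp only [hj, if_true] at h e1 e2 e3 ⊢
    rcases h with ⟨-, h1, h2, h3⟩ | ⟨-, h1, h2, h3⟩ | ⟨-, h1, h3⟩ | ⟨h, -⟩ | ⟨h, -⟩ | ⟨h, -⟩
    · exact Or.inl ⟨h1, h2, h3.trans (e1 h1).symm⟩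
    · exact Or.inr (Or.inl ⟨h1, h2, h3.trans (e3 h1).symm⟩)
    · exact Or.inr (Or.inr ⟨h1, h3.trans (e2 h1).symm⟩)
    all_goals cases h
  · simp only [hj, one_ne_zero, if_false] at h e1 e2 e3 ⊢
    rcases h with ⟨h, -⟩ | ⟨h, -⟩ | ⟨h, -⟩ | ⟨-, h0, h1, h2, h3⟩ | ⟨-, h1, h2, h3⟩ | ⟨-, h1, h3⟩
    iterate 3 cases h
    · refine Or.inl ⟨by omega, ?_, ?_⟩
      · rw [h2]; congr 1; omega
      · rw [h3, e1 (by omega)]; simp only [Prod.mk.injEq, and_true]; omega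
    · exact Or.inr (Or.inl ⟨by omega, h2, h3.trans (e3 (by omega)).symm⟩)
    · exact Or.inr (Or.inr ⟨by omega, h3.trans (e2 (by omega)).symm⟩)

/-- If the automaton of `e` accepts the absolute values of the labels `y`, then splitting the labels
which are read at a turn before the end of `e` gives a list that is cut into copies of `e`. -/
theorem exists_cells {E : ℕ} {e : ℕ → ℕ} (hE : 2 ≤ E) {y : List ℤ} (hy : ∀ k ∈ y, k ≠ 0)
    (h : Acc E e y.length (absW y)) :
    ∃ x, expand x = expand y ∧ Cells E e x ∧ ∃ k, x.length + 1 = (2 * k + 1) * (E + 1) := by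
  obtain ⟨α, h0, hn, run⟩ := h
  have key : ∀ t ≤ y.length, ∃ x, expand x = expand (y.take t) ∧ Cells E e x ∧
      α t = phase (E + 1) 0 (x.length : ℤ) := by
    intro t
    induction t with
    | zero =>
      intro _
      refine ⟨[], rfl, ⟨by simp, by simp⟩, ?_⟩
      rw [h0]; simpa using (phase_val E (j := 0) (i := 0) (by omega)).symm
    | succ t ih =>
      intro ht
      obtain ⟨x, hx, hc, hα⟩ := ih (by omega)
      have hs := run t ht
      have hk : y.getD t 0 ≠ 0 := getD_mem_ne hy ht
      have htake : y.take (t + 1) = y.take t ++ [y.getD t 0] := by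
        rw [List.take_add_one, List.getD_eq_getElem?_getD, List.getElem?_eq_getElem ht]; rfl
      obtain ⟨j, i, hji, hi⟩ := exists_div_mod E x.length
      rw [hα, hji] at hs
      rcases step_phase_cases hi hs with ⟨h1, h2, h3⟩ | ⟨h1, h2, h3⟩ | ⟨h1, h3⟩
      · refine ⟨x ++ [y.getD t 0], by rw [htake, expand_append, expand_append, hx], ?_, ?_⟩
        · refine hc.append (fun i' hi' _ => ?_) (fun i' hi' h0 => ?_)
          all_goals obtain rfl : i' = 0 := by simpa using hi'
          · rw [add_zero, hji, cellW_val hi, ← h2]; rfl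
          · exact absurd (by simpa using h0) hk
        · rw [h3, List.length_append, hji]; rfl
      · obtain ⟨c, hck⟩ : ∃ c, y.getD t 0 = 2 * c := by
          have : (2 : ℤ) ∣ y.getD t 0 := Int.dvd_natAbs.mp (by
            rw [show (y.getD t 0).natAbs = absW y t from rfl,
              h2]; push_cast; exact dvd_mul_right _ _)
          exact this
        have hc0 : c ≠ 0 := by rintro rfl; exact hk (by simpa using hck)
        have habs : c.natAbs = e (if j % 2 = 0 then i else 0) := by
          rw [absW, hck, Int.natAbs_mul] at h2
          exact Nat.eq_of_mul_eq_mul_left (by norm_num) h2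
        have e1 : x.length + 0 = j * (E + 1) + i := hji
        have e2 : x.length + 1 = j * (E + 1) + (i + 1) := by omega
        have e3 : x.length + 2 = (j + 1) * (E + 1) + 0 := by rw [add_mul]; omega
        refine ⟨x ++ [c, 0, c], ?_, ?_, ?_⟩
        · rw [htake, expand_append, expand_append, hx, hck]
          simp [connector_two_mul hc0, connector_zero]
        · refine hc.append (fun i' hi' hne => ?_) (fun i' hi' h0 => ?_)
          · have : i' = 0 ∨ i' = 1 ∨ i' = 2 := by simp at hi'; omega
            rcases this with rfl | rfl | rfl
            · rw [e1, cellW_val hi]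
              rw [List.getD_cons_zero, habs]
              congr 1
              split_ifs <;> omega
            · rw [e2, cell_mod (by omega)] at hne
              exact absurd h1 hne
            · rw [e3, cellW_val (by omega)]
              simp only [List.getD_cons_succ, List.getD_cons_zero]
              rw [habs]
              congr 1
              rcases Nat.mod_two_eq_zero_or_one j with hj | hj
              · rw [if_pos hj, if_neg (by omega)]; omega
              · rw [if_neg (by omega), if_pos (by omega)]
          · have : i' = 0 ∨ i' = 1 ∨ i' = 2 := by simp at hi'; omega
            rcases this with rfl | rfl | rfl
            · exact absurd (by simpa using h0) hc0
            · simp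
            · exact absurd (by simpa using h0) hc0
        · rw [h3, List.length_append, hji]; rfl
      · refine ⟨x ++ [y.getD t 0], by rw [htake, expand_append, expand_append, hx], ?_, ?_⟩
        · refine hc.append (fun i' hi' hne => ?_) (fun i' hi' h0 => ?_)
          all_goals obtain rfl : i' = 0 := by simpa using hi'
          · rw [add_zero, hji, cell_mod hi] at hne
            exact absurd h1 hne
          · exact absurd (by simpa using h0) hk
        · rw [h3, List.length_append, hji]; rfl
  obtain ⟨x, hx, hc, hα⟩ := key y.length le_rfl
  rw [List.take_length] at hx
  refine ⟨x, hx, hc, ?_⟩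
  obtain ⟨j, i, hji, hi⟩ := exists_div_mod E x.length
  rw [hα, hji, phase_val E hi] at hn
  rcases Nat.mod_two_eq_zero_or_one j with hj | hj
  · rw [if_pos hj] at hn
    obtain rfl : i = E := congrArg Prod.fst hn
    refine ⟨j / 2, ?_⟩
    rw [hji, show 2 * (j / 2) = j by omega]; ring
  · rw [if_neg (by omega)] at hn
    cases congrArg Prod.snd hn

theorem Cells.letter_ne {E : ℕ} {e : ℕ → ℕ} {x : List ℤ} (h : Cells E e x) (hE : 1 ≤ E)
    (he : ∀ i < E, 0 < e i) {P : ℕ} (hP : P < x.length) (hm : P % (E + 1) ≠ E) :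
    x.getD P 0 ≠ 0 := by
  intro h0
  have h1 := h.letter P hP hm
  rw [h0, cellW] at h1
  have hlt := Nat.mod_lt P (show 0 < E + 1 by omega)
  have : 0 < e (if (P / (E + 1)) % 2 = 0 then P % (E + 1) else E - 1 - P % (E + 1)) := by
    apply he; split_ifs <;> omega
  simp at h1
  omega

theorem Cells.mod_of_zero {E : ℕ} {e : ℕ → ℕ} {x : List ℤ} (h : Cells E e x) (hE : 1 ≤ E)
    (he : ∀ i < E, 0 < e i) {P : ℕ} (hP : P < x.length) (h0 : x.getD P 0 = 0) :
    P % (E + 1) = E := by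
  by_contra hm
  exact h.letter_ne hE he hP hm h0

theorem Cells.isolatedZeros {E : ℕ} {e : ℕ → ℕ} {x : List ℤ} (h : Cells E e x) (hE : 2 ≤ E)
    (he : ∀ i < E, 0 < e i) : IsolatedZeros x := by
  intro P hP h0
  obtain ⟨h1, h2, h3⟩ := h.zero P hP h0
  have hm := h.mod_of_zero (by omega) he hP h0
  obtain ⟨j, i, rfl, hi⟩ := exists_div_mod E P
  rw [cell_mod hi] at hm
  subst hm
  refine ⟨h1, h2, h3, h.letter_ne (by omega) he h2 ?_, fun h4 => h.letter_ne (by omega) he h4 ?_⟩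
  · rw [show j * (i + 1) + i + 1 = (j + 1) * (i + 1) + 0 by ring, cell_mod (by omega)]; omega
  · rw [show j * (i + 1) + i + 2 = (j + 1) * (i + 1) + 1 by ring, cell_mod (by omega)]; omega

/-- Lists cut into copies of the same word are determined by their expansions, because a zero occurs
only between two copies, at a place that is known beforehand. -/
theorem Cells.unique {E : ℕ} {e : ℕ → ℕ} {x x' : List ℤ} (h : Cells E e x) (h' : Cells E e x')
    (hE : 2 ≤ E) (he : ∀ i < E, 0 < e i) (hx : expand x = expand x') : x = x' := by
  refine expand_unique hx fun P hP hP' => ?_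
  by_cases hm : P % (E + 1) = E
  · right
    have hm' : (P + 1) % (E + 1) ≠ E := by
      obtain ⟨j, i, rfl, hi⟩ := exists_div_mod E P
      rw [cell_mod hi] at hm
      subst hm
      rw [show j * (i + 1) + i + 1 = (j + 1) * (i + 1) + 0 by ring, cell_mod (by omega)]; omega
    exact ⟨fun hlt => h.letter_ne (by omega) he hlt hm', fun hlt => h'.letter_ne (by omega)
      he hlt hm'⟩
  · left
    rw [h.letter P hP hm, h'.letter P hP' hm]

/-- Unfolding a list that is cut into copies of `e` gives such a list. -/
theorem Unf.cells {x c : List ℤ} {n : ℕ} {σ : ℕ → ℤˣ} (h : Unf x c n σ) {E : ℕ} {e : ℕ → ℕ}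
    (hE : 2 ≤ E) (hx : Cells E e x)
    (hk : ∃ k, x.length + 1 = (2 * k + 1) * (E + 1)) : Cells E e c := by
  obtain ⟨k, hk⟩ := hk
  have hlen := h.len
  -- the reflection of a position within `x`
  have refl : ∀ j i, i < E → j ≤ 2 * k →
      x.length - 1 - (j * (E + 1) + i) = (2 * k - j) * (E + 1) + (E - 1 - i) := by
    intro j i hi hj
    obtain ⟨d, hd⟩ := Nat.exists_eq_add_of_le hj
    rw [hd, Nat.add_sub_cancel_left]
    rw [hd, add_mul, add_mul] at hk
    omega
  have pos : 0 < x.length := by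
    have : (2 * k + 1) * (E + 1) ≥ 1 * (E + 1) := Nat.mul_le_mul_right _ (by omega)
    omega
  have hz : ∀ s, (if s % 2 = 0 then 0 else x.length - 1) % (E + 1) ≠ E ∧
      (if s % 2 = 0 then x.length - 1 else 0) % (E + 1) ≠ E := by
    have h1 := refl 0 0 (by omega) (by omega)
    have h2 : (x.length - 1) % (E + 1) ≠ E := by
      simp only [zero_mul, add_zero, Nat.sub_zero] at h1
      rw [h1, cell_mod (by omega)]; omega
    intro s
    split_ifs <;> simp <;> first | exact ⟨by omega, h2⟩ | exact ⟨h2, by omega⟩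
  refine ⟨fun P hP hm => ?_, fun P hP h0 => ?_⟩
  · obtain ⟨s, r, rfl, hr⟩ := exists_div_mod x.length P
    obtain ⟨hs1, hs2⟩ := h.le_of_lt hP
    obtain ⟨j, i, rfl, hi⟩ := exists_div_mod E r
    have epos : s * (x.length + 1) + (j * (E + 1) + i) = (s * (2 * k + 1) + j) * (E + 1) + i := by
      rw [hk]; ring
    rw [epos, cell_mod hi] at hm
    have hi' : i < E := by omega
    have hj : j ≤ 2 * k := by
      by_contra hj
      have : (2 * k + 1) * (E + 1) ≤ j * (E + 1) := Nat.mul_le_mul_right _ (by omega)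
      omega
    have hjb : (j + 1) * (E + 1) ≤ (2 * k + 1) * (E + 1) := Nat.mul_le_mul_right _ (by omega)
    rw [add_mul, one_mul] at hjb
    rw [h.natAbs_letter hs1 (by omega), absW, epos, cellW_val hi]
    rcases Nat.mod_two_eq_zero_or_one s with hs | hs
    · rw [if_pos hs, hx.letter _ (by omega) (by rw [cell_mod hi]; exact hm), cellW_val hi,
        show (s * (2 * k + 1) + j) % 2 = j % 2 by simp [Nat.add_mod, Nat.mul_mod, hs]]
    · rw [if_neg (by omega), refl j i hi' hj, hx.letter, cellW_val (by omega)]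
      · have e1 : (s * (2 * k + 1) + j) % 2 = (1 + j) % 2 := by
          simp [Nat.add_mod, Nat.mul_mod, hs]
        rw [e1]
        congr 1
        rcases Nat.mod_two_eq_zero_or_one j with hj2 | hj2
        · rw [if_pos (by omega), if_neg (by omega)]
        · rw [if_neg (by omega), if_pos (by omega)]; omega
      · rw [← refl j i hi' hj]; omega
      · rw [cell_mod (by omega)]; omega
  · obtain ⟨s, r, rfl, hr⟩ := exists_div_mod x.length P
    obtain ⟨hs1, hs2⟩ := h.le_of_lt hP
    rcases Nat.lt_or_ge r x.length with hr' | hr'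
    · have hb : (s + 1) * (x.length + 1) ≤ (n + 1) * (x.length + 1) :=
        Nat.mul_le_mul_right _ (by omega)
      rw [add_mul, one_mul] at hb
      rw [h.letter s hs1 r hr'] at h0
      have h0' := (mul_eq_zero.mp h0).resolve_left (by simp)
      rcases Nat.mod_two_eq_zero_or_one s with hs | hs
      · rw [if_pos hs] at h0'
        obtain ⟨g1, g2, g3⟩ := hx.zero r hr' h0'
        refine ⟨by omega, by omega, ?_⟩
        rw [show s * (x.length + 1) + r - 1 = s * (x.length + 1) + (r - 1) by omega, add_assoc,
          h.letter s hs1 _ (by omega), h.letter s hs1 _ g2, if_pos hs, if_pos hs, g3]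
      · rw [if_neg (by omega)] at h0'
        obtain ⟨g1, g2, g3⟩ := hx.zero (x.length - 1 - r) (by omega) h0'
        have hr1 : 1 ≤ r := by omega
        refine ⟨by omega, by omega, ?_⟩
        rw [show s * (x.length + 1) + r - 1 = s * (x.length + 1) + (r - 1) by omega, add_assoc,
          h.letter s hs1 _ (by omega), h.letter s hs1 _ (by omega), if_neg (by omega),
          if_neg (by omega), show x.length - 1 - (r - 1) = x.length - 1 - r + 1 by omega,
          show x.length - 1 - (r + 1) = x.length - 1 - r - 1 by omega, g3]
    · obtain rfl : r = x.length := by omega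
      have hs := hs2 rfl
      have hb : (s + 1 + 1) * (x.length + 1) ≤ (n + 1) * (x.length + 1) :=
        Nat.mul_le_mul_right _ (by omega)
      rw [add_mul, one_mul, add_mul, one_mul] at hb
      refine ⟨by omega, by omega, ?_⟩
      rw [show s * (x.length + 1) + x.length - 1 = s * (x.length + 1) + (x.length - 1) by omega,
        h.zero_neighbours pos hs h0, show s * (x.length + 1) + x.length + 1 =
        (s + 1) * (x.length + 1) + 0 by ring]


/-! ### Absolute values and links -/

/-- The entries of a list, counted from `1`. -/
def entry (x : List ℤ) (P : ℕ) : ℤ := x.getD (P - 1) 0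

/-- Two sequences agree when they have the same absolute values, change signs at the same places
and start alike; the values around an inner zero are equal. -/
theorem eq_of_links {f h : ℕ → ℤ} {K : ℕ}
    (hm : ∀ i, 1 ≤ i → i ≤ K → (f i).natAbs = (h i).natAbs)
    (hl : ∀ i, 1 ≤ i → i < K → (0 ≤ f i * f (i + 1) ↔ 0 ≤ h i * h (i + 1)))
    (hf : ∀ i, 1 ≤ i → i + 1 < K → f (i + 1) = 0 → f i = f (i + 2))
    (hh : ∀ i, 1 ≤ i → i + 1 < K → h (i + 1) = 0 → h i = h (i + 2))
    (h1 : f 1 = h 1) (h0 : f 1 ≠ 0) : ∀ i, 1 ≤ i → i ≤ K → f i = h i := by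
  have key : ∀ i, (1 ≤ i → i ≤ K → f i = h i) ∧ (i + 1 ≤ K → f (i + 1) = h (i + 1)) := by
    intro i
    induction i with
    | zero => exact ⟨fun h => by omega, fun _ => h1⟩
    | succ i ih =>
      refine ⟨fun _ => ih.2, fun hK => ?_⟩
      have e := ih.2 (by omega)
      by_cases hz : f (i + 1) = 0
      · have hi : 1 ≤ i := by
          rcases Nat.eq_zero_or_pos i with rfl | hi
          · exact absurd hz h0
          · exact hi
        rw [← hf i hi (by omega) hz, ← hh i hi (by omega) (e ▸ hz)]
        exact ih.1 hi (by omega)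
      · have m := hm (i + 1 + 1) (by omega) hK
        have l := hl (i + 1) (by omega) (by omega)
        rw [← e] at l
        rcases Int.natAbs_eq_natAbs_iff.mp m with m | m
        · exact m
        · by_cases hn : h (i + 1 + 1) = 0
          · rw [m, hn, neg_zero]
          · exfalso
            rw [m, mul_neg] at l
            have hne : f (i + 1) * h (i + 1 + 1) ≠ 0 := mul_ne_zero hz hn
            rcases lt_or_gt_of_ne hne with h3 | h3
            · exact absurd (l.mp (by omega)) (by omega)
            · exact absurd (l.mpr (by omega)) (by omega)
  exact fun i => (key i).1

/-- The entries of `x` and `y` have equal absolute values at places which agree up to sign modulo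
`2 * g`, and likewise for the changes of sign. -/
structure Matched (g : ℕ) (x y : List ℤ) : Prop where
  mag : ∀ u v : ℕ, 1 ≤ u → u ≤ x.length → 1 ≤ v → v ≤ y.length →
    ((2 * g : ℤ) ∣ u - v ∨ (2 * g : ℤ) ∣ u + v) → (entry x u).natAbs = (entry y v).natAbs
  link : ∀ u v : ℕ, 1 ≤ u → u < x.length → 1 ≤ v → v < y.length →
    ((2 * g : ℤ) ∣ u - v ∨ (2 * g : ℤ) ∣ u + v + 1) →
    (0 ≤ entry x u * entry x (u + 1) ↔ 0 ≤ entry y v * entry y (v + 1))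

theorem Matched.symm {g : ℕ} {x y : List ℤ} (h : Matched g x y) : Matched g y x := by
  refine ⟨fun u v h1 h2 h3 h4 h5 => (h.mag v u h3 h4 h1 h2 ?_).symm,
    fun u v h1 h2 h3 h4 h5 => (h.link v u h3 h4 h1 h2 ?_).symm⟩
  · rw [← dvd_neg, neg_sub, add_comm] at h5; exact h5
  · rw [← dvd_neg, neg_sub, add_comm (u : ℤ)] at h5; exact h5

/-- If `y` contains a full period, then `x` is matched with itself. -/
theorem Matched.self {g : ℕ} {x y : List ℤ} (h : Matched g x y) (hg : 1 ≤ g)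
    (hy : 2 * g ≤ y.length) : Matched g x x := by
  have hr : ∀ u : ℕ, (2 * g : ℤ) ∣ u - (u % (2 * g) : ℕ) := fun u =>
    ⟨u / (2 * g), by have := Int.emod_add_mul_ediv u (2 * g); push_cast; linarith⟩
  refine ⟨fun u v h1 h2 h3 h4 h5 => ?_, fun u v h1 h2 h3 h4 h5 => ?_⟩
  · obtain ⟨r, r1, r2, r3⟩ : ∃ r : ℕ, 1 ≤ r ∧ r ≤ y.length ∧ (2 * g : ℤ) ∣ u - r := by
      by_cases h0 : u % (2 * g) = 0
      · refine ⟨2 * g, by omega, hy, ?_⟩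
        have := hr u
        rw [h0] at this
        push_cast at this ⊢
        simpa using this
      · exact ⟨u % (2 * g), by omega, by have := Nat.mod_lt u (show 0 < 2 * g by omega); omega,
          hr u⟩
    rw [h.mag u r h1 h2 r1 r2 (Or.inl r3), h.mag v r h3 h4 r1 r2]
    rcases h5 with h5 | h5
    · left; have := dvd_sub r3 h5; rwa [show (u : ℤ) - r - (u - v) = v - r by ring] at this
    · right; have := dvd_sub h5 r3; rwa [show (u : ℤ) + v - (u - r) = v + r by ring] at this
  · obtain ⟨r, r1, r2, r3⟩ : ∃ r : ℕ, 1 ≤ r ∧ r < y.length ∧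
        ((2 * g : ℤ) ∣ u - r ∨ (2 * g : ℤ) ∣ u + r + 1) := by
      by_cases h0 : u % (2 * g) = 0
      · refine ⟨2 * g - 1, by omega, by omega, Or.inr ?_⟩
        have := hr u
        rw [h0] at this
        rw [show ((2 * g - 1 : ℕ) : ℤ) = 2 * g - 1 by omega,
          show (u : ℤ) + (2 * g - 1) + 1 = u + 2 * g by ring]
        push_cast at this
        simpa using this
      · exact ⟨u % (2 * g), by omega, by have := Nat.mod_lt u (show 0 < 2 * g by omega); omega,
          Or.inl (hr u)⟩
    rw [h.link u r h1 h2 r1 r2 r3, h.link v r h3 h4 r1 r2]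
    rcases h5 with h5 | h5 <;> rcases r3 with r3 | r3
    · left; have := dvd_sub r3 h5; rwa [show (u : ℤ) - r - (u - v) = v - r by ring] at this
    · right; have := dvd_sub r3 h5; rwa [show (u : ℤ) + r + 1 - (u - v) = v + r + 1 by ring] at this
    · right; have := dvd_sub h5 r3; rwa [show (u : ℤ) + v + 1 - (u - r) = v + r + 1 by ring] at this
    · left; have := dvd_sub h5 r3; rwa [show (u : ℤ) + v + 1 - (u + r + 1) = v - r by ring] at this

theorem IsolatedZeros.zero {x : List ℤ} (h : IsolatedZeros x) {P : ℕ} (h1 : 1 ≤ P)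
    (h2 : P ≤ x.length) (h0 : entry x P = 0) :
    2 ≤ P ∧ P < x.length ∧ entry x (P - 1) = entry x (P + 1) ∧ entry x (P + 1) ≠ 0 := by
  obtain ⟨g1, g2, g3, g4, -⟩ := h (P - 1) (by omega) h0
  refine ⟨by omega, by omega, g3.trans ?_, ?_⟩
  · rw [entry]; congr 1; omega
  · rwa [show P - 1 + 1 = P + 1 - 1 by omega] at g4

/-- A self-matched list is symmetric about the multiples of `g`, as far as it reaches. -/
theorem Matched.reflect {g : ℕ} {x : List ℤ} (h : Matched g x x) (hz : IsolatedZeros x) {i r : ℕ}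
    (h1 : r + 1 ≤ i * g) (h2 : i * g + r ≤ x.length) :
    entry x (i * g + r) = entry x (i * g - r) := by
  have hmag : ∀ s ≤ r, (entry x (i * g + s)).natAbs = (entry x (i * g - s)).natAbs := by
    intro s hs
    refine h.mag _ _ (by omega) (by omega) (by omega) (by omega) (Or.inr ⟨i, ?_⟩)
    rw [Nat.cast_sub (by omega)]; push_cast; ring
  have hlink : ∀ s, s < r → (0 ≤ entry x (i * g + s) * entry x (i * g + s + 1) ↔
      0 ≤ entry x (i * g - s) * entry x (i * g - s - 1)) := by
    intro s hs
    rw [h.link (i * g + s) (i * g - s - 1) (by omega) (by omega) (by omega) (by omega),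
      mul_comm, show i * g - s - 1 + 1 = i * g - s by omega]
    refine Or.inr ⟨i, ?_⟩
    rw [Nat.sub_sub, Nat.cast_sub (by omega)]; push_cast; ring
  have hzr : ∀ s, s + 1 < r → entry x (i * g + (s + 1)) = 0 →
      entry x (i * g + s) = entry x (i * g + (s + 2)) := by
    intro s hs h0
    obtain ⟨-, -, h3, -⟩ := hz.zero (by omega) (by omega) h0
    rwa [show i * g + (s + 1) - 1 = i * g + s by omega] at h3
  have hzl : ∀ s, s + 1 < r → entry x (i * g - (s + 1)) = 0 →
      entry x (i * g - s) = entry x (i * g - (s + 2)) := by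
    intro s hs h0
    obtain ⟨-, -, h3, -⟩ := hz.zero (by omega) (by omega) h0
    rw [show i * g - (s + 1) - 1 = i * g - (s + 2) by omega,
      show i * g - (s + 1) + 1 = i * g - s by omega] at h3
    exact h3.symm
  rcases Nat.eq_zero_or_pos r with rfl | hr
  · rfl
  by_cases hc : entry x (i * g) = 0
  · obtain ⟨-, -, h3, h4⟩ := hz.zero (by omega) (by omega) hc
    exact eq_of_links (f := fun s => entry x (i * g + s)) (h := fun s => entry x (i * g - s))
      (K := r)
      (fun s _ hs => hmag s hs) (fun s _ hs => hlink s hs) (fun s _ hs => hzr s hs)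
      (fun s _ hs => hzl s hs) h3.symm h4 r hr le_rfl
  · -- the sequences are shifted by one, so that they start at the centre of the reflection
    have := eq_of_links (f := fun s => entry x (i * g + (s - 1)))
      (h := fun s => entry x (i * g - (s - 1))) (K := r + 1)
      (fun s h1 hs => hmag (s - 1) (by omega)) (fun s h1 hs => ?_) (fun s h1 hs h0 => ?_)
      (fun s h1 hs h0 => ?_) rfl hc (r + 1) (by omega) le_rfl
    · exact this
    · have := hlink (s - 1) (by omega)
      rwa [show i * g + (s - 1) + 1 = i * g + (s + 1 - 1) by omega,
        show i * g - (s - 1) - 1 = i * g - (s + 1 - 1) by omega] at this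
    · have := hzr (s - 1) (by omega) (by rwa [show s - 1 + 1 = s + 1 - 1 by omega])
      rwa [show s - 1 + 2 = s + 2 - 1 by omega] at this
    · have := hzl (s - 1) (by omega) (by rwa [show s - 1 + 1 = s + 1 - 1 by omega])
      rwa [show s - 1 + 2 = s + 2 - 1 by omega] at this

/-- A self-matched list has period `2 * g`. -/
theorem Matched.periodic {g : ℕ} {x : List ℤ} (h : Matched g x x) (hz : IsolatedZeros x)
    (hg : 1 ≤ g) {P : ℕ} (h1 : 1 ≤ P) (h2 : P + 2 * g ≤ x.length) :
    entry x (P + 2 * g) = entry x P := by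
  obtain ⟨j, s, rfl, hs⟩ : ∃ j s, P = j * g + s ∧ s < g :=
    ⟨P / g, P % g, by rw [mul_comm]; exact (Nat.div_add_mod _ _).symm, Nat.mod_lt _ hg⟩
  have e1 : (j + 1) * g = j * g + g := by ring
  have e2 : (j + 2) * g = j * g + 2 * g := by ring
  have r1 := h.reflect hz (i := j + 1) (r := g - s) (by omega) (by omega)
  have r2 := h.reflect hz (i := j + 2) (r := s) (by omega) (by omega)
  rw [show (j + 1) * g - (g - s) = j * g + s by omega] at r1
  rw [← r1, show j * g + s + 2 * g = (j + 2) * g + s by omega, r2]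
  congr 1; omega

/-! ### Words `(w, …, w, e)` on the level of labels -/

/-- The list `(w, …, w, x)` with `p` copies of `w = (x, c, x⁻¹, d)`. -/
def xPow (x : List ℤ) (c d : ℤ) (p : ℕ) : List ℤ :=
  (List.replicate p (x ++ [c] ++ x.reverse ++ [d])).flatten ++ x

theorem xPow_zero (x : List ℤ) (c d : ℤ) : xPow x c d 0 = x := rfl

theorem xPow_succ (x : List ℤ) (c d : ℤ) (p : ℕ) :
    xPow x c d (p + 1) = (x ++ [c] ++ x.reverse ++ [d]) ++ xPow x c d p := by
  simp [xPow, List.replicate_succ]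

theorem expand_xPow (x : List ℤ) (c d : ℤ) (p : ℕ) :
    expand (xPow x c d p) = wPow (wVec (expand x) c d) p (expand x) := by
  induction p with
  | zero => rfl
  | succ p ih =>
    rw [xPow_succ, expand_append, ih]
    simp [wPow, wVec, List.replicate_succ, expand_reverse]

theorem xPow_length (x : List ℤ) (c d : ℤ) (p : ℕ) :
    (xPow x c d p).length + 1 = (2 * p + 1) * (x.length + 1) := by
  induction p with
  | zero => simp [xPow_zero]
  | succ p ih =>
    rw [xPow_succ, List.length_append, add_assoc, ih]
    simp only [List.length_append, List.length_reverse, List.length_singleton]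
    ring

/-- The periodic sequence with period `(x, c, x⁻¹, d)`. -/
def xSeq (x : List ℤ) (c d : ℤ) (P : ℕ) : ℤ :=
  (x ++ [c] ++ x.reverse ++ [d]).getD (P % (2 * (x.length + 1))) 0

theorem xPow_getD {x : List ℤ} {c d : ℤ} {p P : ℕ} (hP : P < (xPow x c d p).length) :
    (xPow x c d p).getD P 0 = xSeq x c d P := by
  have hl : (x ++ [c] ++ x.reverse ++ [d]).length = 2 * (x.length + 1) := by
    simp only [List.length_append, List.length_reverse, List.length_singleton]; ring
  induction p generalizing P with
  | zero =>
    rw [xPow_zero] at hP ⊢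
    rw [xSeq, Nat.mod_eq_of_lt (by omega), List.append_assoc, List.append_assoc, getD_snoc_lt hP]
  | succ p ih =>
    rw [xPow_succ] at hP ⊢
    rcases Nat.lt_or_ge P (2 * (x.length + 1)) with h | h
    · rw [getD_snoc_lt (by rw [hl]; exact h), xSeq, Nat.mod_eq_of_lt h]
    · obtain ⟨Q, rfl⟩ := Nat.exists_eq_add_of_le h
      rw [List.length_append, hl] at hP
      conv_lhs => rw [← hl, getD_snoc]
      rw [ih (by omega), xSeq, xSeq, Nat.add_mod_left]

/-- A self-matched list whose length is one less than an odd multiple of `g` is of the form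
`(w, …, w, e)`. -/
theorem eq_xPow {x : List ℤ} {g p : ℕ} (hg : 1 ≤ g) (hp : 1 ≤ p)
    (hlen : x.length + 1 = (2 * p + 1) * g) (h : Matched g x x) (hz : IsolatedZeros x) :
    x = xPow (x.take (g - 1)) (entry x g) (entry x (2 * g)) p := by
  have hpg : 3 * g ≤ x.length + 1 := by rw [hlen]; exact Nat.mul_le_mul_right _ (by omega)
  have hl : (x.take (g - 1)).length + 1 = g := by rw [List.length_take]; omega
  have hl2 := xPow_length (x.take (g - 1)) (entry x g) (entry x (2 * g)) p
  rw [hl] at hl2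
  -- the first period
  have hfirst : x.take (2 * g) =
      x.take (g - 1) ++ [entry x g] ++ (x.take (g - 1)).reverse ++ [entry x (2 * g)] := by
    refine ext_getD ?_ fun i hi => ?_
    · simp only [List.length_append, List.length_reverse, List.length_singleton, List.length_take]
      omega
    rw [List.length_take] at hi
    rw [getD_take (by omega)]
    have l1 : (x.take (g - 1) ++ [entry x g]).length = g := by simp; omega
    have l2 : (x.take (g - 1) ++ [entry x g] ++ (x.take (g - 1)).reverse).length = 2 * g - 1 := by
      simp; omega
    rcases Nat.lt_or_ge i (2 * g - 1) with h3 | h3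
    · rw [getD_snoc_lt (by omega)]
      rcases Nat.lt_or_ge i g with h4 | h4
      · rw [getD_snoc_lt (by omega)]
        rcases Nat.lt_or_ge i (g - 1) with h5 | h5
        · rw [getD_snoc_lt (by omega), getD_take h5]
        · obtain rfl : i = (x.take (g - 1)).length + 0 := by omega
          rw [getD_snoc, List.getD_cons_zero, entry]
          congr 1; omega
      · obtain ⟨r, hr⟩ := Nat.exists_eq_add_of_le h4
        have := getD_snoc (x := x.take (g - 1) ++ [entry x g]) (y := (x.take (g - 1)).reverse) r
        rw [l1, ← hr] at this
        rw [this, getD_reverse (by omega), getD_take (by omega)]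
        have h6 := h.reflect hz (i := 1) (r := r + 1) (by omega) (by omega)
        rw [entry, entry, show 1 * g + (r + 1) - 1 = i by omega] at h6
        rw [h6]
        congr 1; omega
    · obtain rfl : i = 2 * g - 1 + 0 := by omega
      conv_rhs => rw [← l2, getD_snoc]
      rfl
  have hper : ∀ k P, P = k → P < x.length → x.getD P 0 = x.getD (P % (2 * g)) 0 := by
    intro k
    induction k using Nat.strong_induction_on with
    | _ k ih =>
      rintro P rfl hP
      rcases Nat.lt_or_ge P (2 * g) with hlt | hge
      · rw [Nat.mod_eq_of_lt hlt]
      · obtain ⟨Q, rfl⟩ := Nat.exists_eq_add_of_le hge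
        have := h.periodic hz hg (P := Q + 1) (by omega) (by omega)
        rw [entry, entry, show Q + 1 + 2 * g - 1 = 2 * g + Q by omega, Nat.add_sub_cancel] at this
        rw [this, ih Q (by omega) Q rfl (by omega), Nat.add_mod_left]
  refine ext_getD (by omega) fun i hi => ?_
  rw [xPow_getD (by omega), xSeq, ← hfirst, hl, hper i i rfl hi]
  have := Nat.mod_lt i (show 0 < 2 * g by omega)
  rw [getD_take this]

/-! ### Matched lists -/

/-- If one length divides the other then the longer list is an unfolding of the shorter one. -/
theorem Matched.unf {x y : List ℤ} {n : ℕ} (h : Matched (x.length + 1) x y)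
    (hx : IsolatedZeros x) (hy : IsolatedZeros y) (h0 : 0 < x.length)
    (hlen : y.length + 1 = (n + 1) * (x.length + 1)) : ∃ σ, Unf x y n σ := by
  have hb : ∀ j ≤ n, (j + 1) * (x.length + 1) ≤ y.length + 1 := fun j hj => by
    rw [hlen]; exact Nat.mul_le_mul_right _ (by omega)
  have hidx : ∀ j u : ℕ, 1 ≤ u → u ≤ x.length →
      ((2 * (x.length + 1 : ℕ) : ℤ) ∣ (j * (x.length + 1) + u : ℕ) -
          (if j % 2 = 0 then u else x.length + 1 - u : ℕ) ∨
        (2 * (x.length + 1 : ℕ) : ℤ) ∣ (j * (x.length + 1) + u : ℕ) +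
          (if j % 2 = 0 then u else x.length + 1 - u : ℕ)) := by
    intro j u h1 h2
    split_ifs with hj
    · refine Or.inl ⟨(j / 2 : ℕ), ?_⟩
      obtain ⟨k, rfl⟩ : ∃ k, j = 2 * k := ⟨j / 2, by omega⟩
      rw [Nat.mul_div_cancel_left _ (by norm_num)]; push_cast; ring
    · refine Or.inr ⟨(j / 2 + 1 : ℕ), ?_⟩
      obtain ⟨k, rfl⟩ : ∃ k, j = 2 * k + 1 := ⟨j / 2, by omega⟩
      rw [show (2 * k + 1) / 2 = k by omega, Nat.cast_sub (by omega)]; push_cast; ring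
  have hex : ∀ j ≤ n, ∃ ε : ℤˣ, ∀ u, 1 ≤ u → u ≤ x.length → entry y (j * (x.length + 1) + u) =
      ε * entry x (if j % 2 = 0 then u else x.length + 1 - u) := by
    intro j hj
    have hbj := hb j hj
    rw [add_mul, one_mul] at hbj
    have hmag : ∀ u, 1 ≤ u → u ≤ x.length → (entry y (j * (x.length + 1) + u)).natAbs =
        (entry x (if j % 2 = 0 then u else x.length + 1 - u)).natAbs := fun u h1 h2 =>
      h.symm.mag _ _ (by omega) (by omega) (by split_ifs <;> omega) (by split_ifs <;> omega)
        (hidx j u h1 h2)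
    have hne : entry x (if j % 2 = 0 then 1 else x.length + 1 - 1) ≠ 0 := by
      intro h0
      have := hx.zero (by split_ifs <;> omega) (by split_ifs <;> omega) h0
      split_ifs at this <;> omega
    obtain ⟨ε, hε⟩ : ∃ ε : ℤˣ, entry y (j * (x.length + 1) + 1) =
        ε * entry x (if j % 2 = 0 then 1 else x.length + 1 - 1) := by
      rcases Int.natAbs_eq_natAbs_iff.mp (hmag 1 le_rfl h0) with h | h
      · exact ⟨1, by simpa using h⟩
      · exact ⟨-1, by simpa using h⟩
    have hεε : (ε : ℤ) * ε = 1 := by rcases units_int_cases ε with h | h <;> rw [h] <;> rfl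
    refine ⟨ε, eq_of_links (f := fun u => entry y (j * (x.length + 1) + u))
      (h := fun u => ε * entry x (if j % 2 = 0 then u else x.length + 1 - u)) (K := x.length)
      (fun u h1 h2 => ?_) (fun u h1 h2 => ?_) (fun u h1 h2 h3 => ?_) (fun u h1 h2 h3 => ?_) hε ?_⟩
    · simp only [Int.natAbs_mul, Int.units_natAbs, one_mul]
      exact hmag u h1 h2
    · have e1 : ∀ a b : ℤ, (ε * a) * (ε * b) = a * b := fun a b => by
        linear_combination a * b * hεε
      simp only [e1, ← add_assoc]
      have h3 := hidx j u h1 h2.le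
      split_ifs at h3 ⊢ with hj
      · refine h.symm.link _ _ (by omega) (by omega) h1 h2 (Or.inl ?_)
        obtain ⟨k, rfl⟩ : ∃ k, j = 2 * k := ⟨j / 2, by omega⟩
        exact ⟨k, by push_cast; ring⟩
      · rw [h.symm.link (j * (x.length + 1) + u) (x.length + 1 - (u + 1)) (by omega) (by omega)
          (by omega) (by omega), mul_comm, show x.length + 1 - (u + 1) + 1 =
            x.length + 1 - u by omega]
        obtain ⟨k, rfl⟩ : ∃ k, j = 2 * k + 1 := ⟨j / 2, by omega⟩
        refine Or.inr ⟨(k + 1 : ℕ), ?_⟩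
        rw [Nat.cast_sub (by omega)]; push_cast; ring
    · simpa [← add_assoc] using (hy.zero (by omega) (by omega) h3).2.2.1
    · have h4 := (mul_eq_zero.mp h3).resolve_left (by simp)
      congr 1
      split_ifs at h4 ⊢ with hj
      · exact (hx.zero (by omega) (by omega) h4).2.2.1
      · have h5 := (hx.zero (by omega) (by omega) h4).2.2.1
        rw [show x.length + 1 - u = x.length + 1 - (u + 1) + 1 by omega, ← h5]
        congr 1
    · rw [hε]; exact mul_ne_zero (by simp) hne
  choose! σ hσ using hex
  refine ⟨σ, hlen, fun j hj i hi => ?_, fun j hj h1 => ?_⟩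
  · have := hσ j hj (i + 1) (by omega) (by omega)
    rw [entry, ← add_assoc, Nat.add_sub_cancel] at this
    rw [this, entry]
    congr 1
    split_ifs
    · rfl
    · congr 1; omega
  · have hbj := hb (j + 1) hj
    have e : (j + 1) * (x.length + 1) = j * (x.length + 1) + x.length + 1 := by ring
    rw [add_mul, one_mul, e] at hbj
    have h2 := (hy.zero (P := (j + 1) * (x.length + 1)) (by omega) (by omega)
      (by rw [entry, e, Nat.add_sub_cancel]; exact h1)).2.2.1
    rw [hσ (j + 1) hj 1 le_rfl h0, e, Nat.add_sub_cancel, hσ j hj.le _ h0 le_rfl] at h2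
    have e2 : (if j % 2 = 0 then x.length else x.length + 1 - x.length) =
        if (j + 1) % 2 = 0 then 1 else x.length + 1 - 1 := by
      rcases Nat.mod_two_eq_zero_or_one j with hj | hj
      · rw [if_pos hj, if_neg (by omega)]; rfl
      · rw [if_neg (by omega), if_pos (by omega)]; omega
    rw [e2] at h2
    have hne : entry x (if (j + 1) % 2 = 0 then 1 else x.length + 1 - 1) ≠ 0 := by
      intro h0
      have := hx.zero (by split_ifs <;> omega) (by split_ifs <;> omega) h0
      split_ifs at this <;> omega
    exact Units.ext (mul_right_cancel₀ hne h2)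


/-- Two matched lists are comparable, or of the form `(w, …, w, x)`. -/
theorem Matched.dichotomy {x y : List ℤ} (h : Matched ((x.length + 1).gcd (y.length + 1)) x y)
    (hx : IsolatedZeros x) (hy : IsolatedZeros y) (hxe : Even x.length) (hye : Even y.length)
    (h0 : 0 < entry x 1 * entry y 1) :
    Tiling (expand x) 1 (expand y) ∨ Tiling (expand y) 1 (expand x) ∨
      ∃ z : List ℤ, ∃ c d : ℤ, ∃ p q : ℕ, IsolatedZeros z ∧ Even z.length ∧
        expand x = expand (xPow z c d p) ∧ expand y = expand (xPow z c d q) ∧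
        ¬ 2 * p + 1 ∣ 2 * q + 1 ∧ ¬ 2 * q + 1 ∣ 2 * p + 1 := by
  have tiling : ∀ {x y : List ℤ}, Matched ((x.length + 1).gcd (y.length + 1)) x y →
      IsolatedZeros x → IsolatedZeros y → 0 < entry x 1 * entry y 1 →
      x.length + 1 ∣ y.length + 1 → Tiling (expand x) 1 (expand y) := by
    intro x y h hx hy h0 hdvd
    have hpos : 0 < x.length := by
      rcases Nat.eq_zero_or_pos x.length with hl | hl
      · exfalso; simp [entry, List.length_eq_zero_iff.mp hl] at h0
      · exact hl
    rw [Nat.gcd_eq_left hdvd] at h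
    obtain ⟨n, hn⟩ := hdvd
    obtain ⟨n, rfl⟩ : ∃ n', n = n' + 1 := ⟨n - 1, by
      rcases Nat.eq_zero_or_pos n with rfl | h
      · omega
      · omega⟩
    obtain ⟨σ, hσ⟩ := h.unf hx hy hpos (hn.trans (mul_comm _ _))
    have h1 := hσ.letter 0 (by omega) 0 hpos
    simp only [zero_mul, zero_add, Nat.zero_mod, if_true] at h1
    have h2 : σ 0 = 1 := by
      rcases Int.units_eq_one_or (σ 0) with h3 | h3
      · exact h3
      · exfalso
        rw [h3] at h1
        simp only [entry, Nat.sub_self, h1] at h0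
        have := mul_self_nonneg (x.getD 0 0)
        push_cast at h0
        linarith
    have := tiling_of_unf hσ
    rwa [h2] at this
  obtain ⟨u, hu⟩ := Nat.gcd_dvd_left (x.length + 1) (y.length + 1)
  obtain ⟨v, hv⟩ := Nat.gcd_dvd_right (x.length + 1) (y.length + 1)
  have hou : Odd (x.length + 1) := hxe.add_one
  have hov : Odd (y.length + 1) := hye.add_one
  rw [hu, Nat.odd_mul] at hou
  rw [hv, Nat.odd_mul] at hov
  obtain ⟨p, rfl⟩ := hou.2
  obtain ⟨q, rfl⟩ := hov.2
  by_cases hd1 : 2 * p + 1 ∣ 2 * q + 1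
  · refine Or.inl (tiling h hx hy h0 ?_)
    have := mul_dvd_mul_left ((x.length + 1).gcd (y.length + 1)) hd1
    rwa [← hu, ← hv] at this
  by_cases hd2 : 2 * q + 1 ∣ 2 * p + 1
  · refine Or.inr (Or.inl (tiling ?_ hy hx (by rwa [mul_comm]) ?_))
    · rw [Nat.gcd_comm]; exact h.symm
    · have := mul_dvd_mul_left ((x.length + 1).gcd (y.length + 1)) hd2
      rwa [← hu, ← hv] at this
  refine Or.inr (Or.inr ?_)
  generalize (x.length + 1).gcd (y.length + 1) = g at *
  have hp : 1 ≤ p := by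
    rcases Nat.eq_zero_or_pos p with rfl | hp
    · exact absurd (one_dvd _) hd1
    · exact hp
  have hq : 1 ≤ q := by
    rcases Nat.eq_zero_or_pos q with rfl | hp
    · exact absurd (one_dvd _) hd2
    · exact hp
  have hg : 1 ≤ g := hou.1.pos
  have hxl : g * 3 ≤ x.length + 1 := by rw [hu]; exact Nat.mul_le_mul_left _ (by omega)
  have hyl : g * 3 ≤ y.length + 1 := by rw [hv]; exact Nat.mul_le_mul_left _ (by omega)
  have sx := h.self hg (by omega)
  have sy := h.symm.self hg (by omega)
  -- both lists begin with the same period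
  have heq : ∀ P, 1 ≤ P → P ≤ 2 * g → entry x P = entry y P := by
    have hne := left_ne_zero_of_mul h0.ne'
    refine eq_of_links
      (fun P h1 h2 => h.mag P P h1 (by omega) h1 (by omega) (Or.inl (by simp)))
      (fun P h1 h2 => h.link P P h1 (by omega) h1 (by omega) (Or.inl (by simp)))
      (fun P h1 h2 h3 => ?_) (fun P h1 h2 h3 => ?_) ?_ hne
    · simpa using (hx.zero (by omega) (by omega) h3).2.2.1
    · simpa using (hy.zero (by omega) (by omega) h3).2.2.1
    · rcases Int.natAbs_eq_natAbs_iff.mp (h.mag 1 1 le_rfl (by omega) le_rfl (by omega)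
        (Or.inl (by simp))) with h1 | h1
      · exact h1
      · rw [h1] at h0
        have := mul_self_nonneg (entry y 1)
        linarith
  refine ⟨x.take (g - 1), entry x g, entry x (2 * g), p, q, ?_, ?_,
    congrArg expand (eq_xPow hg hp (by rw [hu, mul_comm]) sx hx), congrArg expand ?_, hd1, hd2⟩
  · intro i hi h1
    have hl : (x.take (g - 1)).length = g - 1 := by rw [List.length_take]; omega
    rw [hl] at hi ⊢
    rw [getD_take hi] at h1
    obtain ⟨a1, a2, a3, a4, a5⟩ := hx i (by omega) h1
    have hlt : i + 1 < g - 1 := by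
      by_contra hlt
      -- the reflection of a last zero would be a zero at distance two
      have hr := sx.reflect hx (i := 1) (r := 1) (by omega) (by omega)
      have e : i = 1 * g - 1 - 1 := by omega
      apply a5 (by omega)
      rw [entry, entry, ← e, h1, show 1 * g + 1 - 1 = i + 2 by omega] at hr
      exact hr
    rw [getD_take (by omega), getD_take hlt]
    exact ⟨a1, hlt, a3, a4, fun h => by rw [getD_take h]; exact a5 (by omega)⟩
  · have hl : (x.take (g - 1)).length = g - 1 := by rw [List.length_take]; omega
    rw [hl]
    exact Nat.Odd.sub_odd hou.1 odd_one
  · have htake : x.take (g - 1) = y.take (g - 1) := by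
      refine ext_getD (by rw [List.length_take, List.length_take]; omega) fun i hi => ?_
      rw [List.length_take] at hi
      rw [getD_take (by omega), getD_take (by omega)]
      exact heq (i + 1) (by omega) (by omega)
    rw [htake, heq g hg (by omega), heq (2 * g) (by omega) le_rfl]
    exact eq_xPow hg hq (by rw [hv, mul_comm]) sy hy

/-! ### The Chinese remainder theorem -/

/-- The absolute values and links of `x` appear periodically in a word of length `K`. -/
structure Hosted (K : ℕ) (F : ℕ → ℕ) (b : ℕ → Prop) (x : List ℤ) : Prop where
  mag : ∀ P u : ℕ, 1 ≤ P → P ≤ K → 1 ≤ u → u ≤ x.length →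
    ((2 * (x.length + 1 : ℕ) : ℤ) ∣ P - u ∨ (2 * (x.length + 1 : ℕ) : ℤ) ∣ P + u) →
    F P = (entry x u).natAbs
  link : ∀ P u : ℕ, 1 ≤ P → P < K → 1 ≤ u → u < x.length →
    ((2 * (x.length + 1 : ℕ) : ℤ) ∣ P - u ∨ (2 * (x.length + 1 : ℕ) : ℤ) ∣ P + u + 1) →
    (b P ↔ 0 ≤ entry x u * entry x (u + 1))

theorem exists_crt {M N : ℕ} (hM : 0 < M) (hN : 0 < N) {u v : ℤ}
    (h : (2 * (M.gcd N : ℕ) : ℤ) ∣ u - v) : ∃ z : ℤ, 0 ≤ z ∧ z < 2 * (M.lcm N : ℕ) ∧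
      (2 * M : ℤ) ∣ z - u ∧ (2 * N : ℤ) ∣ z - v := by
  obtain ⟨k, hk⟩ := h
  have hb := Nat.gcd_eq_gcd_ab M N
  have hL : (0 : ℤ) < 2 * (M.lcm N : ℕ) := by have := Nat.lcm_pos hM hN; omega
  have hdvd : ∀ w : ℤ, (2 * (M.lcm N : ℕ) : ℤ) ∣ w - w % (2 * (M.lcm N : ℕ)) := fun w =>
    ⟨w / (2 * (M.lcm N : ℕ)), by have := Int.emod_add_mul_ediv w (2 * (M.lcm N : ℕ)); linarith⟩
  have d1 : (2 * M : ℤ) ∣ 2 * (M.lcm N : ℕ) :=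
    mul_dvd_mul_left _ (by exact_mod_cast Nat.dvd_lcm_left M N)
  have d2 : (2 * N : ℤ) ∣ 2 * (M.lcm N : ℕ) :=
    mul_dvd_mul_left _ (by exact_mod_cast Nat.dvd_lcm_right M N)
  set w : ℤ := u - 2 * M * (M.gcdA N * k) with hw
  have w1 : (2 * M : ℤ) ∣ w - u := ⟨-(M.gcdA N * k), by rw [hw]; ring⟩
  have w2 : (2 * N : ℤ) ∣ w - v := ⟨M.gcdB N * k, by
    rw [hw]; rw [hb] at hk; linear_combination hk⟩
  refine ⟨w % (2 * (M.lcm N : ℕ)), Int.emod_nonneg _ hL.ne', Int.emod_lt_of_pos _ hL, ?_, ?_⟩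
  · have := dvd_sub w1 (d1.trans (hdvd w))
    rwa [show w - u - (w - w % (2 * (M.lcm N : ℕ))) = w % (2 * (M.lcm N : ℕ)) - u by ring] at this
  · have := dvd_sub w2 (d2.trans (hdvd w))
    rwa [show w - v - (w - w % (2 * (M.lcm N : ℕ))) = w % (2 * (M.lcm N : ℕ)) - v by ring] at this

theorem not_dvd_of_between {M : ℕ} {w : ℤ} (h1 : 0 < w) (h2 : w < M) : ¬ (M : ℤ) ∣ w := fun h =>
  absurd (Int.le_of_dvd h1 h) (by omega)

/-- Places `u` of `x` and `v` of `y` which agree modulo `2 * gcd` lift to a common place `z` of the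
period `2 * lcm`, by the Chinese remainder theorem. If `z` is beyond the word, its reflection in the
middle of the period is not. -/
theorem Hosted.matched {K : ℕ} {F : ℕ → ℕ} {b : ℕ → Prop} {x y : List ℤ} (hx : Hosted K F b x)
    (hy : Hosted K F b y) (hK : (x.length + 1).lcm (y.length + 1) ≤ K + 1) :
    Matched ((x.length + 1).gcd (y.length + 1)) x y := by
  set M := x.length + 1 with hM
  set N := y.length + 1 with hN
  set L := M.lcm N with hL
  have hML : (M : ℤ) ∣ L := by exact_mod_cast Nat.dvd_lcm_left M N
  have h2M : (2 * M : ℤ) ∣ 2 * L := mul_dvd_mul_left _ hML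
  have h2N : (2 * N : ℤ) ∣ 2 * L := mul_dvd_mul_left _ (by exact_mod_cast Nat.dvd_lcm_right M N)
  have hMM : (M : ℤ) ∣ 2 * M := dvd_mul_left _ _
  refine ⟨fun u v h1 h2 h3 h4 h5 => ?_, fun u v h1 h2 h3 h4 h5 => ?_⟩
  · obtain ⟨v', hv', h5⟩ : ∃ v' : ℤ, (v' = v ∨ v' = -v) ∧ (2 * (M.gcd N : ℕ) : ℤ) ∣ u - v' := by
      rcases h5 with h5 | h5
      · exact ⟨v, Or.inl rfl, h5⟩
      · exact ⟨-v, Or.inr rfl, by rwa [sub_neg_eq_add]⟩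
    obtain ⟨z, z0, z1, z2, z3⟩ := exists_crt (by omega) (by omega) h5
    have hzu : (M : ℤ) ∣ z - u := hMM.trans z2
    have hnz : ∀ w : ℤ, (M : ℤ) ∣ w → z ≠ w := by
      rintro w hw rfl
      exact not_dvd_of_between (M := M) (w := u) (by omega) (by omega)
        (by simpa using dvd_sub hw hzu)
    have hz0 := hnz 0 (dvd_zero _)
    have hzL := hnz L hML
    rcases lt_or_ge z L with hlt | hge
    · have e : ((z.toNat : ℕ) : ℤ) = z := Int.toNat_of_nonneg z0
      rw [← hx.mag z.toNat u (by omega) (by omega) h1 h2 (Or.inl (by rw [e]; exact z2)),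
        ← hy.mag z.toNat v (by omega) (by omega) h3 h4]
      rw [e]
      rcases hv' with rfl | rfl
      · exact Or.inl z3
      · rw [sub_neg_eq_add] at z3; exact Or.inr z3
    · -- reflect in the middle of the period
      have e : (((2 * L - z).toNat : ℕ) : ℤ) = 2 * L - z := Int.toNat_of_nonneg (by omega)
      have r2 := dvd_sub h2M z2
      have r3 := dvd_sub h2N z3
      rw [← hx.mag (2 * L - z).toNat u (by omega) (by omega) h1 h2
          (Or.inr (by rw [e]; rwa [show (2 * L - (z - u) : ℤ) = 2 * L - z + u by ring] at r2)),
        ← hy.mag (2 * L - z).toNat v (by omega) (by omega) h3 h4]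
      rw [e]
      rcases hv' with rfl | rfl
      · rw [show (2 * L - (z - v) : ℤ) = 2 * L - z + v by ring] at r3; exact Or.inr r3
      · rw [show (2 * L - (z - -v) : ℤ) = 2 * L - z - v by ring] at r3; exact Or.inl r3
  · obtain ⟨v', hv', h5⟩ : ∃ v' : ℤ, (v' = v ∨ v' = -v - 1) ∧
        (2 * (M.gcd N : ℕ) : ℤ) ∣ u - v' := by
      rcases h5 with h5 | h5
      · exact ⟨v, Or.inl rfl, h5⟩
      · exact ⟨-v - 1, Or.inr rfl, by rwa [show (u : ℤ) - (-v - 1) = u + v + 1 by ring]⟩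
    obtain ⟨z, z0, z1, z2, z3⟩ := exists_crt (by omega) (by omega) h5
    have hzu : (M : ℤ) ∣ z - u := hMM.trans z2
    have hnz : ∀ w : ℤ, (M : ℤ) ∣ w → z ≠ w ∧ z ≠ w - 1 := by
      intro w hw
      constructor
      · rintro rfl
        exact not_dvd_of_between (M := M) (w := u) (by omega) (by omega)
          (by simpa using dvd_sub hw hzu)
      · rintro rfl
        refine not_dvd_of_between (M := M) (w := u + 1) (by omega) (by omega) ?_
        have := dvd_sub hw hzu
        rwa [show w - (w - 1 - u) = u + 1 by ring] at this
    have hz0 := hnz 0 (dvd_zero _)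
    have hzL := hnz L hML
    have hzL2 := hnz (2 * L) (hMM.trans h2M)
    rcases lt_or_ge z L with hlt | hge
    · have e : ((z.toNat : ℕ) : ℤ) = z := Int.toNat_of_nonneg z0
      rw [← hx.link z.toNat u (by omega) (by omega) h1 h2 (Or.inl (by rw [e]; exact z2)),
        ← hy.link z.toNat v (by omega) (by omega) h3 h4]
      rw [e]
      rcases hv' with rfl | rfl
      · exact Or.inl z3
      · rw [show z - (-v - 1) = z + v + 1 by ring] at z3; exact Or.inr z3
    · have e : (((2 * L - 1 - z).toNat : ℕ) : ℤ) = 2 * L - 1 - z := Int.toNat_of_nonneg (by omega)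
      have r2 := dvd_sub h2M z2
      have r3 := dvd_sub h2N z3
      rw [← hx.link (2 * L - 1 - z).toNat u (by omega) (by omega) h1 h2
          (Or.inr (by rw [e]; rwa [show (2 * L - (z - u) : ℤ) =
            2 * L - 1 - z + u + 1 by ring] at r2)),
        ← hy.link (2 * L - 1 - z).toNat v (by omega) (by omega) h3 h4]
      rw [e]
      rcases hv' with rfl | rfl
      · rw [show (2 * L - (z - v) : ℤ) = 2 * L - 1 - z + v + 1 by ring] at r3; exact Or.inr r3
      · rw [show (2 * L - (z - (-v - 1)) : ℤ) = 2 * L - 1 - z - v by ring] at r3; exact Or.inl r3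

theorem eq_zero_of_dvd_between {M : ℕ} {w : ℤ} (h : (2 * M : ℤ) ∣ w) (h1 : -(2 * M) < w)
    (h2 : w < 2 * M) : w = 0 :=
  Int.eq_zero_of_abs_lt_dvd h (by rw [abs_lt]; exact ⟨h1, h2⟩)

/-- The position in its copy of a letter which is congruent to `±u`. -/
theorem position_letter {M j i u : ℕ} (hi : i < M) (hu : 1 ≤ u) (huM : u < M)
    (h : (2 * M : ℤ) ∣ (j * M + i : ℕ) - u ∨ (2 * M : ℤ) ∣ (j * M + i : ℕ) + u) :
    1 ≤ i ∧ (if j % 2 = 0 then i else M - i) = u := by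
  rcases Nat.mod_two_eq_zero_or_one j with hj | hj
  · obtain ⟨k, rfl⟩ : ∃ k, j = 2 * k := ⟨j / 2, by omega⟩
    rw [if_pos hj]
    have hk : (2 * M : ℤ) ∣ ((2 * k * M : ℕ) : ℤ) := ⟨k, by push_cast; ring⟩
    rcases h with h | h
    · have := dvd_sub h hk
      have := eq_zero_of_dvd_between this (by push_cast; linarith) (by push_cast; linarith)
      push_cast at this
      omega
    · have := dvd_sub h hk
      have := eq_zero_of_dvd_between this (by push_cast; linarith) (by push_cast; linarith)
      push_cast at this
      omega
  · obtain ⟨k, rfl⟩ : ∃ k, j = 2 * k + 1 := ⟨j / 2, by omega⟩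
    rw [if_neg (by omega)]
    have hk : (2 * M : ℤ) ∣ ((2 * k + 1) * M + M : ℕ) := ⟨k + 1, by push_cast; ring⟩
    rcases h with h | h
    · have := dvd_sub h hk
      have := eq_zero_of_dvd_between this (by push_cast; linarith) (by push_cast; linarith)
      push_cast at this
      omega
    · have := dvd_sub h hk
      have := eq_zero_of_dvd_between this (by push_cast; linarith) (by push_cast; linarith)
      push_cast at this
      omega

/-- The position in its copy of an edge which is congruent to an inner edge `(u, u + 1)`. -/
theorem position_edge {M j i u : ℕ} (hi : i < M) (hu : 1 ≤ u) (huM : u + 1 < M)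
    (h : (2 * M : ℤ) ∣ (j * M + i : ℕ) - u ∨ (2 * M : ℤ) ∣ (j * M + i : ℕ) + u + 1) :
    1 ≤ i ∧ i + 1 < M ∧ (if j % 2 = 0 then i else M - 1 - i) = u := by
  rcases Nat.mod_two_eq_zero_or_one j with hj | hj
  · obtain ⟨k, rfl⟩ : ∃ k, j = 2 * k := ⟨j / 2, by omega⟩
    rw [if_pos hj]
    have hk : (2 * M : ℤ) ∣ ((2 * k * M : ℕ) : ℤ) := ⟨k, by push_cast; ring⟩
    rcases h with h | h
    · have := dvd_sub h hk
      have := eq_zero_of_dvd_between this (by push_cast; linarith) (by push_cast; linarith)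
      push_cast at this
      omega
    · have := dvd_sub h hk
      have := eq_zero_of_dvd_between this (by push_cast; linarith) (by push_cast; linarith)
      push_cast at this
      omega
  · obtain ⟨k, rfl⟩ : ∃ k, j = 2 * k + 1 := ⟨j / 2, by omega⟩
    rw [if_neg (by omega)]
    have hk : (2 * M : ℤ) ∣ ((2 * k + 1) * M + M : ℕ) := ⟨k + 1, by push_cast; ring⟩
    rcases h with h | h
    · have := dvd_sub h hk
      have := eq_zero_of_dvd_between this (by push_cast; linarith) (by push_cast; linarith)
      push_cast at this
      omega
    · have := dvd_sub h hk
      have := eq_zero_of_dvd_between this (by push_cast; linarith) (by push_cast; linarith)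
      push_cast at this
      omega

/-- An unfolding of `x` shows the absolute values and links of `x` periodically. -/
theorem Unf.hosted {x c : List ℤ} {n : ℕ} {σ : ℕ → ℤˣ} (h : Unf x c n σ) :
    Hosted c.length (fun P => (entry c P).natAbs) (fun P => 0 ≤ entry c P * entry c (P + 1)) x := by
  have hletter : ∀ j ≤ n, ∀ i, 1 ≤ i → i < x.length + 1 → entry c (j * (x.length + 1) + i) =
      σ j * entry x (if j % 2 = 0 then i else x.length + 1 - i) := by
    intro j hj i h1 h2
    rw [entry, entry, show j * (x.length + 1) + i - 1 = j * (x.length + 1) + (i - 1) by omega,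
      h.letter j hj _ (by omega)]
    congr 1
    split_ifs
    · rfl
    · congr 1; omega
  refine ⟨fun P u h1 h2 h3 h4 h5 => ?_, fun P u h1 h2 h3 h4 h5 => ?_⟩
  · obtain ⟨j, i, rfl, hi⟩ := exists_div_mod x.length P
    obtain ⟨hi1, hu⟩ := position_letter (by omega) h3 (by omega) h5
    have hj := (h.le_of_lt (j := j) (i := i - 1) (by omega)).1
    rw [hletter j hj i hi1 (by omega), hu, Int.natAbs_mul, Int.units_natAbs, one_mul]
  · obtain ⟨j, i, rfl, hi⟩ := exists_div_mod x.length P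
    obtain ⟨hi1, hi2, hu⟩ := position_edge (by omega) h3 (by omega) h5
    have hj := (h.le_of_lt (j := j) (i := i) (by omega)).1
    have hσ : (σ j : ℤ) * σ j = 1 := by rcases units_int_cases (σ j) with h | h <;> rw [h] <;> rfl
    have e : ∀ a b : ℤ, (σ j * a) * (σ j * b) = a * b := fun a b => by
      linear_combination a * b * hσ
    rw [add_assoc, hletter j hj i hi1 (by omega), hletter j hj (i + 1) (by omega) (by omega), e]
    split_ifs at hu ⊢
    · rw [hu]
    · rw [mul_comm, show x.length + 1 - (i + 1) = u by omega, show x.length + 1 - i =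
        u + 1 by omega]

/-- A run without turns before the ends, for the automaton of a list of nonzero labels. -/
theorem AccRun.hosted {x : List ℤ} {n : ℕ} {F : ℕ → ℕ} {b : ℕ → Bool} {α : ℕ → ℕ × Bool}
    (h : AccRun x.length (absW x) (bitW x) n F b α) (hx : ∀ k ∈ x, k ≠ 0)
    (hα : ∀ t ≤ n, α t = phase (x.length + 1) 0 t) :
    Hosted n (fun P => F (P - 1)) (fun P => b P = true) x := by
  refine ⟨fun P u h1 h2 h3 h4 h5 => ?_, fun P u h1 h2 h3 h4 h5 => ?_⟩
  · obtain ⟨j, i, rfl, hi⟩ := exists_div_mod x.length P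
    obtain ⟨hi1, hu⟩ := position_letter (by omega) h3 (by omega) h5
    have hs := h.run (j * (x.length + 1) + i - 1) (by omega)
    have e : j * (x.length + 1) + i - 1 = j * (x.length + 1) + (i - 1) := by omega
    rw [hα _ (by omega), hα _ (by omega), e] at hs
    rcases step_phase_cases (by omega) hs with ⟨g1, g2, -⟩ | ⟨g1, -, g3⟩ | ⟨g1, -⟩
    · simp only [e]
      rw [g2, absW, entry]
      congr 2
      split_ifs at hu ⊢ <;> omega
    · exfalso
      have e1 : (j * (x.length + 1) + (i - 1) + 3 : ℕ) = (j + 1) * (x.length + 1) + 1 := by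
        rw [add_mul]; omega
      have e2 : (j * (x.length + 1) + (i - 1) + 1 : ℕ) = j * (x.length + 1) + i := by omega
      rw [e1, e2, phase_val _ hi, phase_val _ (by omega)] at g3
      rcases Nat.mod_two_eq_zero_or_one j with hj | hj
      · rw [if_pos hj, if_neg (by omega)] at g3
        cases congrArg Prod.snd g3
      · rw [if_neg (by omega), if_pos (by omega)] at g3
        cases congrArg Prod.snd g3
    · omega
  · obtain ⟨j, i, rfl, hi⟩ := exists_div_mod x.length P
    obtain ⟨hi1, hi2, hu⟩ := position_edge (by omega) h3 (by omega) h5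
    have hb := h.bit (j * (x.length + 1) + i) h1 h2
    rw [hα _ h2.le, phase_val _ hi] at hb
    have e : ((if j % 2 = 0 then (i, true) else (x.length - i, false)) : ℕ × Bool).1 = u := by
      split_ifs at hu ⊢
      · exact hu
      · simp only; omega
    rw [e] at hb
    rw [hb (by omega) h4, bitW, decide_eq_true_iff, entry, entry, Nat.add_sub_cancel]
    have : x.getD (u - 1) 0 * x.getD u 0 ≠ 0 :=
      mul_ne_zero (getD_mem_ne hx (by omega)) (getD_mem_ne hx h4)
    omega


/-! ### Two vectors tiling a common vector -/

/-- Along an alternating word, a run for the automaton of that word turns only between copies. -/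
theorem Run.phase_of_alternating {m n : ℕ} {A F : ℕ → ℕ} {α : ℕ → ℕ × Bool} {k x : ℕ}
    (hm : 2 ≤ m) (hm2 : Even m) (h : Run m A n F α) (h0 : α 0 = (0, true))
    (hpos : ∀ i < m, 0 < A i) (hA : ∀ i < m, A i = alternating k x i)
    (hF : ∀ p < n, F p = alternating k x p) : ∀ t ≤ n, α t = phase (m + 1) 0 t := by
  intro t ht
  have hs : α 0 = phase (m + 1) 0 0 := by
    rw [h0]; simpa using (phase_val m (j := 0) (i := 0) (by omega)).symm
  have := h.phase_forward hs (j := t) (by omega) fun p _ hp =>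
    h.not_isZ_of_alternating hm hm2 h0 hpos hA (by omega) (hF p (by omega))
  simpa using this

theorem odd_quotient_of_phase_eq {m n : ℕ} (h : phase (m + 1) 0 (n : ℤ) = (m, true)) :
    ∃ k, n + 1 = (2 * k + 1) * (m + 1) := by
  obtain ⟨j, i, rfl, hi⟩ := exists_div_mod m n
  rw [phase_val m hi] at h
  rcases Nat.mod_two_eq_zero_or_one j with hj | hj
  · rw [if_pos hj] at h
    obtain rfl : i = m := congrArg Prod.fst h
    exact ⟨j / 2, by rw [show 2 * (j / 2) = j by omega]; ring⟩
  · rw [if_neg (by omega)] at h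
    cases congrArg Prod.snd h

theorem absW_pos {y : List ℤ} (hy : ∀ k ∈ y, k ≠ 0) : ∀ i < y.length, 0 < absW y i :=
  fun _ hi => Int.natAbs_pos.mpr (getD_mem_ne hy hi)

theorem unf_nil (y : List ℤ) : Unf [] y y.length (fun _ => 1) :=
  ⟨by simp, by simp, fun _ _ _ => rfl⟩

theorem tiling_nil {b : List ℤ} (hb : IsExpandedEven b) : Tiling [] 1 b := by
  obtain ⟨y, -, rfl⟩ := exists_labels hb
  exact tiling_of_unf (unf_nil y)

theorem Unf.getD_zero {x c : List ℤ} {n : ℕ} {σ : ℕ → ℤˣ} (h : Unf x c n σ) (h0 : σ 0 = 1)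
    (hx : 0 < x.length) : c.getD 0 0 = x.getD 0 0 := by
  have := h.letter 0 (by omega) 0 hx
  simpa [h0] using this

theorem IsolatedZeros.getD_zero_ne {x : List ℤ} (h : IsolatedZeros x) (hx : 0 < x.length) :
    x.getD 0 0 ≠ 0 := fun h0 => by have := (h 0 hx h0).1; omega

theorem Unf.dvd {x c : List ℤ} {n : ℕ} {σ : ℕ → ℤˣ} (h : Unf x c n σ) :
    x.length + 1 ∣ c.length + 1 := ⟨n + 1, by rw [h.len, mul_comm]⟩

theorem expand_getD_zero {x : List ℤ} (hx : 0 < x.length) :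
    (expand x).getD 0 0 = 2 * (x.getD 0 0).sign := by
  cases x with
  | nil => simp at hx
  | cons k x =>
    obtain ⟨t, ht⟩ := connector_head (k := k)
    simp [ht]

/-- Two vectors which tile a common vector are comparable, or of the form `(w, …, w, e)`. -/
theorem tilings_dichotomy {a b c : List ℤ} (ha : IsExpandedEven a) (hae : Even a.length)
    (hb : IsExpandedEven b) (hbe : Even b.length) (hc : IsExpandedEven c) (hce : Even c.length)
    (hac : Tiling a 1 c) (hbc : Tiling b 1 c) :
    Tiling a 1 b ∨ Tiling b 1 a ∨ ∃ z : List ℤ, ∃ c d : ℤ, ∃ p q : ℕ, IsolatedZeros z ∧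
      Even z.length ∧ a = expand (xPow z c d p) ∧ b = expand (xPow z c d q) ∧
      ¬ 2 * p + 1 ∣ 2 * q + 1 ∧ ¬ 2 * q + 1 ∣ 2 * p + 1 := by
  obtain ⟨ya, hya, rfl⟩ := exists_labels ha
  obtain ⟨yb, hyb, rfl⟩ := exists_labels hb
  obtain ⟨yc, hyc, rfl⟩ := exists_labels hc
  have hma := even_length_of_expand hae
  have hmb := even_length_of_expand hbe
  rcases Nat.eq_zero_or_pos ya.length with hla | hla
  · left
    rw [List.length_eq_zero_iff.mp hla]
    exact tiling_nil hb
  rcases Nat.eq_zero_or_pos yb.length with hlb | hlb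
  · right; left
    rw [List.length_eq_zero_iff.mp hlb]
    exact tiling_nil ha
  have hla2 : 2 ≤ ya.length := by rw [Nat.even_iff] at hma; omega
  have hlb2 : 2 ≤ yb.length := by rw [Nat.even_iff] at hmb; omega
  obtain ⟨X, n, σ, σ0, hX, eX⟩ := exists_unf_of_tiling hac ya rfl
  obtain ⟨Y, n', τ, τ0, hY, eY⟩ := exists_unf_of_tiling hbc yb rfl
  have hXe : Even X.length := even_length_of_expand (by rw [eX]; exact hce)
  have hYe : Even Y.length := even_length_of_expand (by rw [eY]; exact hce)
  obtain ⟨α, hα⟩ := hX.accRun hya hla2 (hX.even hXe) hyc eX.symm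
  obtain ⟨β, hβ⟩ := hY.accRun hyb hlb2 (hY.even hYe) hyc eY.symm
  have pa := absW_pos hya
  have pb := absW_pos hyb
  have pc := absW_pos hyc
  rcases common_cell hla2 hma hlb2 hmb pa pb pc ⟨α, hα.start, hα.finish, hα.run⟩
    ⟨β, hβ.start, hβ.finish, hβ.run⟩ with ⟨E, e, hE2, hE, he, hea, heb⟩ | ⟨k, x, hka, hkb⟩
  · -- cut both vectors into copies of the common cell
    obtain ⟨xa, exa, ca, la⟩ := exists_cells hE hya hea
    obtain ⟨xb, exb, cb, lb⟩ := exists_cells hE hyb heb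
    obtain ⟨X, n, σ, σ0, hX, eX⟩ := exists_unf_of_tiling hac xa exa
    obtain ⟨Y, n', τ, τ0, hY, eY⟩ := exists_unf_of_tiling hbc xb exb
    obtain rfl : X = Y :=
      (hX.cells hE ca la).unique (hY.cells hE cb lb) hE he (eX.trans eY.symm)
    have hlen : ∀ {x : List ℤ}, (∃ k, x.length + 1 = (2 * k + 1) * (E + 1)) → 0 < x.length := by
      rintro x ⟨k, hk⟩
      have : 1 * (E + 1) ≤ (2 * k + 1) * (E + 1) := Nat.mul_le_mul_right _ (by omega)
      omega
    have za := ca.isolatedZeros hE he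
    have zb := cb.isolatedZeros hE he
    have hm := hX.hosted.matched hY.hosted
      (Nat.le_of_dvd (by omega) (Nat.lcm_dvd hX.dvd hY.dvd))
    rw [← exa, ← exb]
    refine hm.dichotomy za zb (even_length_of_expand (by rw [exa]; exact hae))
      (even_length_of_expand (by rw [exb]; exact hbe)) ?_
    rw [entry, entry, Nat.sub_self, ← hX.getD_zero σ0 (hlen la), hY.getD_zero τ0 (hlen lb)]
    exact mul_self_pos.mpr (zb.getD_zero_ne (hlen lb))
  · -- in a shortest double run no letter is read at a turn before the end of a copy
    obtain ⟨N, F, f, α, β, D, hNC⟩ :=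
      DRun.exists_noncommon hla2 hlb2 pa pb ⟨hα, hβ, pc⟩
    have hF : ∀ p < N, F p = alternating k x p := by
      intro p hp
      by_cases h1 : α (p + 1) = rev (α p)
      · exact D.right.run.alternating_of_pass hlb2 hmb D.right.start hkb hp
          fun h2 => hNC p hp ⟨h1, h2⟩
      · exact D.left.run.alternating_of_pass hla2 hma D.left.start hka hp h1
    have hα' := D.left.run.phase_of_alternating hla2 hma D.left.start pa hka hF
    have hβ' := D.right.run.phase_of_alternating hlb2 hmb D.right.start pb hkb hF
    have da : ya.length + 1 ∣ N + 1 := by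
      obtain ⟨k, hk⟩ := odd_quotient_of_phase_eq (by rw [← hα' N le_rfl]; exact D.left.finish)
      exact ⟨2 * k + 1, by rw [hk, mul_comm]⟩
    have db : yb.length + 1 ∣ N + 1 := by
      obtain ⟨k, hk⟩ := odd_quotient_of_phase_eq (by rw [← hβ' N le_rfl]; exact D.right.finish)
      exact ⟨2 * k + 1, by rw [hk, mul_comm]⟩
    have hm := (D.left.hosted hya hα').matched (D.right.hosted hyb hβ')
      (Nat.le_of_dvd (by omega) (Nat.lcm_dvd da db))
    have hXY : (X.getD 0 0).sign = (Y.getD 0 0).sign := by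
      have h1 := expand_getD_zero (x := X) (by have := hX.len; nlinarith)
      have h2 := expand_getD_zero (x := Y) (by have := hY.len; nlinarith)
      rw [eX] at h1
      rw [eY] at h2
      omega
    refine hm.dichotomy (isolatedZeros_of_ne hya) (isolatedZeros_of_ne hyb) hma hmb ?_
    rw [entry, entry, Nat.sub_self, ← hX.getD_zero σ0 hla, ← hY.getD_zero τ0 hlb]
    have hne : X.getD 0 0 ≠ 0 := by rw [hX.getD_zero σ0 hla]; exact getD_mem_ne hya hla
    rw [← Int.sign_eq_one_iff_pos, Int.sign_mul, ← hXY, ← Int.sign_mul]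
    exact Int.sign_eq_one_iff_pos.mpr (mul_self_pos.mpr hne)


/-! ### Expansions are expanded even vectors -/

theorem prefix_triple {x y z : ℤ} {l : List ℤ} (h : [x, 0, y] <+: z :: l) :
    x = z ∧ ∃ t, l = 0 :: y :: t := by
  obtain ⟨t, ht⟩ := h
  simp only [List.cons_append, List.nil_append, List.cons.injEq] at ht
  exact ⟨ht.1, t, ht.2.symm⟩

theorem TailGood.cons {l : List ℤ} (h : TailGood l) (h0 : l.head? ≠ some 0) {s : ℤ}
    (hs : s = 1 ∨ s = -1) : TailGood (2 * s :: l) := by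
  obtain ⟨h1, h2, h3⟩ := h
  refine ⟨fun x hx => ?_, ?_, fun x y hxy => ?_⟩
  · rcases List.mem_cons.mp hx with rfl | hx
    · rcases hs with rfl | rfl <;> simp
    · exact h1 x hx
  · cases l with
    | nil => rcases hs with rfl | rfl <;> simp
    | cons y t => rwa [List.getLast?_cons_cons]
  · rcases List.infix_cons_iff.mp hxy with hp | hi
    · obtain ⟨-, t, rfl⟩ := prefix_triple hp
      exact absurd rfl h0
    · exact h3 x y hi

theorem TailGood.cons_zero {l : List ℤ} {s : ℤ} (h : TailGood (2 * s :: l))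
    (hs : s = 1 ∨ s = -1) : TailGood (2 * s :: 0 :: 2 * s :: l) := by
  obtain ⟨h1, h2, h3⟩ := h
  refine ⟨fun x hx => ?_, ?_, fun x y hxy => ?_⟩
  · rcases List.mem_cons.mp hx with rfl | hx
    · rcases hs with rfl | rfl <;> simp
    · rcases List.mem_cons.mp hx with rfl | hx
      · simp
      · exact h1 x hx
  · rwa [List.getLast?_cons_cons, List.getLast?_cons_cons]
  · rcases List.infix_cons_iff.mp hxy with hp | hi
    · obtain ⟨rfl, t, ht⟩ := prefix_triple hp
      simp only [List.cons.injEq, true_and] at ht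
      rw [← ht.1]
      omega
    · rcases List.infix_cons_iff.mp hi with hp | hi
      · obtain ⟨-, t, ht⟩ := prefix_triple hp
        simp only [List.cons.injEq] at ht
        omega
      · exact h3 x y hi

theorem tailGood_intersperse (n : ℕ) {l : List ℤ} (h : TailGood l) (h0 : l.head? ≠ some 0) {s : ℤ}
    (hs : s = 1 ∨ s = -1) : TailGood ((List.replicate (n + 1) (2 * s)).intersperse 0 ++ l) := by
  induction n with
  | zero => exact h.cons h0 hs
  | succ n ih =>
    rw [intersperse_replicate_succ]
    have : ∃ t, (List.replicate (n + 1) (2 * s)).intersperse 0 = 2 * s :: t := by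
      cases n with
      | zero => exact ⟨[], rfl⟩
      | succ n => exact ⟨_, intersperse_replicate_succ n _⟩
    obtain ⟨t, ht⟩ := this
    rw [ht, List.cons_append] at ih
    rw [ht]
    exact ih.cons_zero hs

theorem isExpandedEven_iff {a : List ℤ} :
    IsExpandedEven a ↔ TailGood a ∧ a.head? ≠ some 0 :=
  ⟨fun h => ⟨⟨h.1, h.2.2.1, h.2.2.2⟩, h.2.1⟩, fun h => ⟨h.1.1, h.2, h.1.2.1, h.1.2.2⟩⟩

theorem isExpandedEven_expand {y : List ℤ} (hy : ∀ k ∈ y, k ≠ 0) : IsExpandedEven (expand y) := by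
  induction y with
  | nil => exact ⟨by simp, by simp, by simp, fun x y h => by simp at h⟩
  | cons k y ih =>
    obtain ⟨h1, h2⟩ := isExpandedEven_iff.mp (ih fun j hj => hy j (by simp [hj]))
    have hk := hy k (by simp)
    refine isExpandedEven_iff.mpr ⟨?_, ?_⟩
    · rw [expand_cons, connector_of_ne hk]
      obtain ⟨n, hn⟩ : ∃ n, k.natAbs = n + 1 := ⟨k.natAbs - 1, by omega⟩
      rw [hn]
      refine tailGood_intersperse n h1 h2 ?_
      rcases lt_or_gt_of_ne hk with h | h
      · exact Or.inr (Int.sign_eq_neg_one_of_neg h)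
      · exact Or.inl (Int.sign_eq_one_of_pos h)
    · rw [expand_head]
      simpa using hk

theorem IsolatedZeros.isExpandedEven {x : List ℤ} (h : IsolatedZeros x) :
    IsExpandedEven (expand x) := by
  obtain ⟨y, hy, he, -⟩ := exists_merge (x.length + 1) x (by omega) h
  rw [← he]
  exact isExpandedEven_expand hy

theorem IsExpandedEven.signed {a : List ℤ} (h : IsExpandedEven a) (ε : ℤˣ) :
    IsExpandedEven (signed ε a) := by
  obtain ⟨y, hy, rfl⟩ := exists_labels h
  rw [signed_expand]
  refine isExpandedEven_expand fun k hk => ?_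
  obtain ⟨j, hj, rfl⟩ := List.mem_map.mp hk
  exact mul_ne_zero (by simp) (hy j hj)

theorem IsExpandedEven.reverse {a : List ℤ} (h : IsExpandedEven a) : IsExpandedEven a.reverse := by
  obtain ⟨y, hy, rfl⟩ := exists_labels h
  rw [expand_reverse]
  exact isExpandedEven_expand fun k hk => hy k (List.mem_reverse.mp hk)

theorem SameClass.symm {a b : List ℤ} (h : SameClass a b) : SameClass b a := by
  obtain ⟨ε, rfl | rfl⟩ := h
  · exact ⟨ε, Or.inl (signed_self_signed _ _).symm⟩
  · exact ⟨ε, Or.inr (by rw [signed_reverse, List.reverse_reverse, signed_self_signed])⟩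

theorem SameClass.trans {a b c : List ℤ} (h : SameClass a b) (h' : SameClass b c) :
    SameClass a c := by
  obtain ⟨ε, rfl | rfl⟩ := h <;> obtain ⟨δ, rfl | rfl⟩ := h' <;> refine ⟨ε * δ, ?_⟩
  · exact Or.inl (signed_signed _ _ _)
  · exact Or.inr (signed_signed _ _ _)
  · exact Or.inr (by rw [signed_reverse, signed_signed])
  · exact Or.inl (by rw [signed_reverse, signed_signed, List.reverse_reverse])

theorem SameClass.refl (a : List ℤ) : SameClass a a := ⟨1, Or.inl (signed_one a).symm⟩

theorem SameClass.good {a b : List ℤ} (h : SameClass a b) (hb : IsExpandedEven b) :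
    IsExpandedEven a := by
  obtain ⟨ε, rfl | rfl⟩ := h
  · exact hb.signed ε
  · exact hb.reverse.signed ε

theorem SameClass.length {a b : List ℤ} (h : SameClass a b) : a.length = b.length := by
  obtain ⟨ε, rfl | rfl⟩ := h <;> simp


/-! ### Continued fractions and the classification of 2-bridge knots -/

theorem cfrac_size {x : ℤ} {t : List ℤ} (h : TailGood (x :: t)) :
    (x ≠ 0 → |cfrac (x :: t)| < 1 ∧ 0 < (x : ℚ) * cfrac (x :: t)) ∧
      (x = 0 → 1 < |cfrac (x :: t)|) := by
  have size : ∀ {x : ℤ} {t : List ℤ}, TailGood (x :: t) → x ≠ 0 →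
      0 < |cfrac (x :: t)| ∧ |cfrac (x :: t)| < 1 ∧ 0 < (x : ℚ) * cfrac (x :: t) := by
    intro x t h hx
    obtain ⟨h1, h2⟩ := (cfrac_bound _ h x t rfl).2.1 hx
    have h3 : |(x : ℚ)| = 2 := by
      rcases h.1 x (by simp) with rfl | rfl | rfl
      · norm_num
      · exact absurd rfl hx
      · norm_num
    have h4 : (x : ℚ) * cfrac (x :: t) = 2 * |cfrac (x :: t)| := by
      rw [← abs_of_pos h1, abs_mul, h3]
    rw [h4] at h1 h2
    refine ⟨by linarith, by linarith, by linarith⟩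
  refine ⟨fun hx => (size h hx).2, ?_⟩
  rintro rfl
  obtain ⟨z, t', rfl, hz, -⟩ := (cfrac_bound _ h 0 t rfl).2.2 rfl
  obtain ⟨h1, h2, -⟩ := size h.tail hz
  rw [cfrac.eq_2 0, Int.cast_zero, zero_add, abs_div, abs_one]
  exact (one_lt_div h1).mpr h2

/-- An expanded even vector can be read off its continued fraction: its first entry is determined by
the size and the sign of the value. -/
theorem cfrac_injective : ∀ {a b : List ℤ}, TailGood a → TailGood b → cfrac a = cfrac b → a = b :=
    by
  have ne0 : ∀ {x : ℤ} {t : List ℤ}, TailGood (x :: t) → cfrac (x :: t) ≠ 0 := by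
    intro x t h h0
    obtain ⟨h1, h2⟩ := cfrac_size h
    rw [h0] at h1 h2
    by_cases hx : x = 0
    · have := h2 hx; simp at this; linarith
    · have := (h1 hx).2; simp at this
  intro a
  induction a with
  | nil =>
    intro b _ hb he
    cases b with
    | nil => rfl
    | cons y s => exact absurd he.symm (ne0 hb)
  | cons x t ih =>
    intro b ha hb he
    cases b with
    | nil => exact absurd he (ne0 ha)
    | cons y s =>
      obtain ⟨a1, a2⟩ := cfrac_size ha
      obtain ⟨b1, b2⟩ := cfrac_size hb
      rw [← he] at b1 b2
      have hxy : x = y := by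
        by_cases hx : x = 0
        · by_contra hne
          have := a2 hx
          have := (b1 (fun h => hne (hx.trans h.symm))).1
          linarith
        · obtain ⟨g1, g2⟩ := a1 hx
          have hy : y ≠ 0 := fun h => by have := b2 h; linarith
          have g3 := (b1 hy).2
          rcases ha.1 x (by simp) with rfl | rfl | rfl <;>
            rcases hb.1 y (by simp) with rfl | rfl | rfl <;>
            first | rfl | contradiction | (push_cast at g2 g3; exfalso; linarith)
      subst hxy
      have h1 := (cfrac_bound _ ha x t rfl).1
      have h2 := (cfrac_bound _ hb x s rfl).1
      have h3 : cfrac t = cfrac s := by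
        simp only [cfrac] at he
        rw [one_div, one_div, inv_inj] at he
        exact add_left_cancel he
      rw [ih ha.tail hb.tail h3]

theorem cfrac_signed (ε : ℤˣ) (a : List ℤ) : cfrac (signed ε a) = (ε : ℤ) * cfrac a := by
  induction a with
  | nil => simp [cfrac]
  | cons x t ih =>
    rw [signed_cons, cfrac, cfrac, ih]
    rcases units_int_cases ε with h | h <;> rw [h]
    · simp
    · push_cast
      rw [show (-1 * x + -1 * cfrac t : ℚ) = -(x + cfrac t) by ring, div_neg]; ring

/-- The matrix whose first column is the denominator and the numerator of the continued fraction. -/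
def cmat (a : List ℤ) : Matrix (Fin 2) (Fin 2) ℤ := (a.map fun x => !![x, 1; 1, 0]).prod

theorem cmat_cons (x : ℤ) (a : List ℤ) : cmat (x :: a) = !![x, 1; 1, 0] * cmat a := rfl

theorem cmat_reverse (a : List ℤ) : cmat a.reverse = (cmat a).transpose := by
  rw [cmat, cmat, Matrix.transpose_list_prod, List.map_map, ← List.map_reverse]
  congr 1
  refine List.map_congr_left fun x _ => ?_
  ext i j
  fin_cases i <;> fin_cases j <;> rfl

theorem cmat_det {a : List ℤ} (h : Even a.length) : (cmat a).det = 1 := by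
  have : ∀ a : List ℤ, (cmat a).det = (-1) ^ a.length := by
    intro a
    induction a with
    | nil => simp [cmat]
    | cons x t ih =>
      rw [cmat_cons, Matrix.det_mul, ih, Matrix.det_fin_two_of, List.length_cons, pow_succ]; ring
  rw [this, h.neg_one_pow]

theorem cfrac_eq_cmat {a : List ℤ} (h : TailGood a) :
    (cmat a 0 0 : ℚ) ≠ 0 ∧ cfrac a = (cmat a 1 0 : ℚ) / cmat a 0 0 := by
  induction a with
  | nil => simp [cmat, cfrac]
  | cons x t ih =>
    obtain ⟨h1, h2⟩ := ih h.tail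
    have h3 := (cfrac_bound _ h x t rfl).1
    have e0 : cmat (x :: t) 0 0 = x * cmat t 0 0 + cmat t 1 0 := by
      rw [cmat_cons]; simp [Matrix.mul_apply, Fin.sum_univ_two]
    have e1 : cmat (x :: t) 1 0 = cmat t 0 0 := by
      rw [cmat_cons]; simp [Matrix.mul_apply, Fin.sum_univ_two]
    have e2 : (cmat (x :: t) 0 0 : ℚ) = cmat t 0 0 * (x + cfrac t) := by
      rw [e0, h2]; push_cast; field_simp
    refine ⟨by rw [e2]; exact mul_ne_zero h1 h3, ?_⟩
    rw [cfrac, e2, e1]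
    field_simp

/-- The matrix entries are coprime, so they are the numerator and the denominator up to a common
sign. -/
theorem exists_num_den {a : List ℤ} (h : IsExpandedEven a) (he : Even a.length) :
    ∃ δ : ℤ, δ * δ = 1 ∧ (cfrac a).num = δ * cmat a 1 0 ∧ ((cfrac a).den : ℤ) = δ * cmat a 0 0 := by
  obtain ⟨h1, h2⟩ := cfrac_eq_cmat (isExpandedEven_iff.mp h).1
  have hdet := cmat_det he
  rw [Matrix.det_fin_two] at hdet
  have hcop : ∀ δ : ℤ, δ * δ = 1 → Nat.Coprime (δ * cmat a 1 0).natAbs (δ * cmat a 0 0).natAbs := by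
    intro δ hδ
    rw [← Int.isCoprime_iff_nat_coprime]
    exact ⟨-δ * cmat a 0 1, δ * cmat a 1 1, by
      linear_combination (cmat a 0 0 * cmat a 1 1 - cmat a 0 1 * cmat a 1 0) * hδ + hdet⟩
  have h1' : cmat a 0 0 ≠ 0 := by exact_mod_cast h1
  rcases lt_or_gt_of_ne h1' with hlt | hgt
  · have hq : cfrac a = ((-1 * cmat a 1 0 : ℤ) : ℚ) / ((-1 * cmat a 0 0 : ℤ) : ℚ) := by
      rw [h2]; push_cast; rw [neg_one_mul, neg_one_mul, neg_div_neg_eq]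
    refine ⟨-1, by norm_num, ?_, ?_⟩
    · rw [hq]; exact Rat.num_div_eq_of_coprime (by linarith) (hcop _ (by norm_num))
    · rw [hq]; exact Rat.den_div_eq_of_coprime (by linarith) (hcop _ (by norm_num))
  · have hq : cfrac a = ((1 * cmat a 1 0 : ℤ) : ℚ) / ((1 * cmat a 0 0 : ℤ) : ℚ) := by
      rw [h2]; push_cast; rw [one_mul, one_mul]
    refine ⟨1, by norm_num, ?_, ?_⟩
    · rw [hq]; exact Rat.num_div_eq_of_coprime (by linarith) (hcop _ (by norm_num))
    · rw [hq]; exact Rat.den_div_eq_of_coprime (by linarith) (hcop _ (by norm_num))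

/-- Reading the vector backwards keeps the denominator and inverts the numerator up to sign. -/
theorem cfrac_reverse {a : List ℤ} (h : IsExpandedEven a) (he : Even a.length) :
    (cfrac a.reverse).den = (cfrac a).den ∧
      ((cfrac a).den : ℤ) ∣ (cfrac a.reverse).num * (cfrac a).num + 1 := by
  obtain ⟨δ, d1, d2, d3⟩ := exists_num_den h he
  obtain ⟨δ', d1', d2', d3'⟩ := exists_num_den h.reverse (by simpa using he)
  rw [cmat_reverse, Matrix.transpose_apply] at d2' d3'
  have hdet := cmat_det he
  rw [Matrix.det_fin_two] at hdet
  have hpos := (cfrac a).den_pos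
  have hpos' := (cfrac a.reverse).den_pos
  have hδ : δ' = δ := by
    rcases mul_self_eq_one_iff.mp d1 with rfl | rfl <;>
      rcases mul_self_eq_one_iff.mp d1' with rfl | rfl <;> first | rfl | (exfalso; omega)
  subst hδ
  refine ⟨by omega, δ' * cmat a 1 1, ?_⟩
  rw [d2, d2', d3]
  linear_combination (cmat a 0 1 * cmat a 1 0 - cmat a 0 0 * cmat a 1 1) * d1 - hdet

theorem abs_num_lt_den {a : List ℤ} (h : IsExpandedEven a) :
    |(cfrac a).num| < (cfrac a).den := by
  obtain ⟨h1, h2⟩ := isExpandedEven_iff.mp h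
  have : |cfrac a| < 1 := by
    cases a with
    | nil => simp [cfrac]
    | cons x t => exact ((cfrac_size h1).1 (by simpa using h2)).1
  have hd : (0 : ℚ) < (cfrac a).den := by exact_mod_cast (cfrac a).den_pos
  rw [← Rat.num_div_den (cfrac a), abs_div, abs_of_pos hd, div_lt_one hd] at this
  exact_mod_cast this

theorem even_num {a : List ℤ} (h : IsExpandedEven a) (he : Even a.length) :
    (2 : ℤ) ∣ (cfrac a).num := by
  obtain ⟨u, v, hv, e⟩ := (cfrac_parity a (isExpandedEven_iff.mp h).1).1 he
  have hv0 : (v : ℚ) ≠ 0 := by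
    intro h0
    have : v = 0 := by exact_mod_cast h0
    rw [this] at hv; exact absurd hv (by decide)
  have hd : ((cfrac a).den : ℚ) ≠ 0 := by exact_mod_cast (cfrac a).den_pos.ne'
  have h1 : (cfrac a).num * v = 2 * (u * (cfrac a).den) := by
    have h2 : ((cfrac a).num : ℚ) / (cfrac a).den = 2 * u / v := (Rat.num_div_den _).trans e
    rw [div_eq_div_iff hd hv0] at h2
    have h3 : (cfrac a).num * v = 2 * u * (cfrac a).den := by exact_mod_cast h2
    rw [h3]; ring
  have hc : IsCoprime (2 : ℤ) v := by
    obtain ⟨k, rfl⟩ := hv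
    exact ⟨-k, 1, by ring⟩
  exact hc.dvd_of_dvd_mul_right ⟨_, h1⟩

/-- Numerators which are congruent modulo the common odd denominator, up to sign, are equal up to
sign, because they are even and smaller than the denominator in absolute value. -/
theorem eq_of_num_modEq {a b : List ℤ} (ha : IsExpandedEven a) (hae : Even a.length)
    (hb : IsExpandedEven b) (hbe : Even b.length) (hd : (cfrac a).den = (cfrac b).den)
    (hodd : Odd (cfrac a).den) {ε : ℤˣ}
    (h : ((cfrac a).den : ℤ) ∣ (cfrac a).num - ε * (cfrac b).num) : a = signed ε b := by
  have h2 : (2 : ℤ) ∣ (cfrac a).num - ε * (cfrac b).num :=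
    dvd_sub (even_num ha hae) ((even_num hb hbe).mul_left _)
  have hc : IsCoprime (2 : ℤ) (cfrac a).den := by
    obtain ⟨k, hk⟩ := hodd
    rw [hk]; exact ⟨-k, 1, by push_cast; ring⟩
  have h3 := hc.mul_dvd h2 h
  have ba := abs_lt.mp (abs_num_lt_den ha)
  have bb := abs_lt.mp (abs_num_lt_den hb)
  rw [← hd] at bb
  have h4 : (cfrac a).num = ε * (cfrac b).num := by
    have := eq_zero_of_dvd_between h3 ?_ ?_
    · linarith
    all_goals rcases units_int_cases ε with e | e <;> rw [e] <;> linarith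
  refine cfrac_injective (isExpandedEven_iff.mp ha).1 (isExpandedEven_iff.mp (hb.signed ε)).1 ?_
  rw [cfrac_signed, ← Rat.num_div_den (cfrac a), h4, hd]
  push_cast
  rw [mul_div_assoc, Rat.num_div_den]

/-- The class of an expanded even vector of even length is determined by its 2-bridge knot. -/
theorem sameClass_of_phi_eq {a b : EvenVec} (h : Phi a = Phi b) : SameClass a.1 b.1 := by
  obtain ⟨hd, h⟩ : SameKnot ⟨cfrac a.1, odd_den_cfrac a⟩ ⟨cfrac b.1, odd_den_cfrac b⟩ :=
    Quotient.exact h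
  simp only at hd h
  obtain ⟨hrd, hr⟩ := cfrac_reverse b.2.1 b.2.2
  rw [← hd] at hr hrd
  have hre : Even b.1.reverse.length := by simpa using b.2.2
  -- the numerator of `b` is a unit, with inverse up to sign the numerator of `b` reversed
  have hinv : ∀ ε : ℤˣ, ((cfrac a.1).den : ℤ) ∣ (cfrac a.1).num * (cfrac b.1).num - ε →
      ((cfrac a.1).den : ℤ) ∣ (cfrac a.1).num - (-ε : ℤˣ) * (cfrac b.1.reverse).num := by
    intro ε h1
    have := dvd_sub (hr.mul_left (cfrac a.1).num) (h1.mul_left (cfrac b.1.reverse).num)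
    refine this.trans (dvd_of_eq ?_)
    push_cast; ring
  rcases h with h | h | h | h
  · exact ⟨1, Or.inl (eq_of_num_modEq a.2.1 a.2.2 b.2.1 b.2.2 hd (odd_den_cfrac a)
      (by simpa using h.symm.dvd))⟩
  · exact ⟨-1, Or.inl (eq_of_num_modEq a.2.1 a.2.2 b.2.1 b.2.2 hd (odd_den_cfrac a)
      (by simpa using h.symm.dvd))⟩
  · exact ⟨-1, Or.inr (eq_of_num_modEq a.2.1 a.2.2 b.2.1.reverse hre hrd.symm (odd_den_cfrac a)
      (hinv 1 (by simpa using h.symm.dvd)))⟩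
  · exact ⟨1, Or.inr (eq_of_num_modEq a.2.1 a.2.2 b.2.1.reverse hre hrd.symm (odd_den_cfrac a)
      (by simpa using hinv (-1) (by simpa using h.symm.dvd)))⟩


/-! ### Comparing the words `(w, …, w, e)` -/

theorem xSeq_add (x : List ℤ) (c d : ℤ) (k P : ℕ) :
    xSeq x c d (2 * (x.length + 1) * k + P) = xSeq x c d P := by
  rw [xSeq, xSeq, Nat.mul_add_mod]

theorem xSeq_of_lt {x : List ℤ} {c d : ℤ} {i : ℕ} (hi : i ≤ x.length) :
    xSeq x c d i = if i < x.length then x.getD i 0 else c := by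
  rw [xSeq, Nat.mod_eq_of_lt (by omega), List.append_assoc, List.append_assoc]
  split_ifs with h
  · rw [getD_snoc_lt h]
  · obtain rfl : i = x.length + 0 := by omega
    rw [getD_snoc]; rfl

theorem xSeq_of_ge {x : List ℤ} {c d : ℤ} {i : ℕ} (hi : i ≤ x.length) :
    xSeq x c d (x.length + 1 + i) = if i < x.length then x.getD (x.length - 1 - i) 0 else d := by
  have hl : (x ++ [c]).length = x.length + 1 := by simp
  rw [xSeq, Nat.mod_eq_of_lt (by omega), ← hl, List.append_assoc, getD_snoc]
  split_ifs with h
  · rw [getD_snoc_lt (by simpa using h), getD_reverse h]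
  · obtain rfl : i = x.reverse.length + 0 := by simp; omega
    rw [getD_snoc]; rfl

/-- The periodic sequence is symmetric about the places between the copies. -/
theorem xSeq_reflect {x : List ℤ} {c d : ℤ} {P Q : ℕ} (h : 2 * (x.length + 1) ∣ P + Q + 2) :
    xSeq x c d P = xSeq x c d Q := by
  have key : ∀ r s : ℕ, r < 2 * (x.length + 1) → s < 2 * (x.length + 1) →
      2 * (x.length + 1) ∣ r + s + 2 → r ≤ x.length → xSeq x c d r = xSeq x c d s := by
    intro r s hr hs hd hrx
    have hs2 : s = x.length + 1 + (x.length - 1 - r) ∧ r < x.length ∨ r = x.length ∧ s = r := by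
      obtain ⟨k, hk⟩ := hd
      have h1 : k < 3 := by
        by_contra hk3
        have : 2 * (x.length + 1) * 3 ≤ 2 * (x.length + 1) * k := Nat.mul_le_mul_left _ (by omega)
        omega
      interval_cases k <;> omega
    rcases hs2 with ⟨rfl, hlt⟩ | ⟨-, rfl⟩
    · rw [xSeq_of_lt hrx, xSeq_of_ge (by omega), if_pos hlt, if_pos (by omega)]
      congr 1; omega
    · rfl
  have hP := Nat.div_add_mod P (2 * (x.length + 1))
  have hQ := Nat.div_add_mod Q (2 * (x.length + 1))
  have lP := Nat.mod_lt P (show 0 < 2 * (x.length + 1) by omega)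
  have lQ := Nat.mod_lt Q (show 0 < 2 * (x.length + 1) by omega)
  have hd : 2 * (x.length + 1) ∣ P % (2 * (x.length + 1)) + Q % (2 * (x.length + 1)) + 2 := by
    have h3 := dvd_add (dvd_mul_right (2 * (x.length + 1)) (P / (2 * (x.length + 1))))
      (dvd_mul_right (2 * (x.length + 1)) (Q / (2 * (x.length + 1))))
    refine (Nat.dvd_add_right h3).mp ?_
    convert h using 1
    omega
  rw [← hP, ← hQ, xSeq_add, xSeq_add]
  rcases Nat.lt_or_ge x.length (P % (2 * (x.length + 1))) with h1 | h1
  · rcases Nat.lt_or_ge x.length (Q % (2 * (x.length + 1))) with h2 | h2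
    · obtain ⟨k, hk⟩ := hd
      have h4 : k = 2 := by
        have h5 : k < 3 := by
          by_contra hk3
          have : 2 * (x.length + 1) * 3 ≤ 2 * (x.length + 1) * k := Nat.mul_le_mul_left _ (by omega)
          omega
        interval_cases k <;> omega
      subst h4
      congr 1
      omega
    · exact (key _ _ lQ lP (by rwa [add_comm (Q % _)]) h2).symm
  · exact key _ _ lP lQ hd h1

/-- A word `(w, …, w, x)` unfolds to longer ones. -/
theorem unf_xPow (x : List ℤ) (c d : ℤ) {p r n : ℕ} (h : 2 * r + 1 = (n + 1) * (2 * p + 1)) :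
    Unf (xPow x c d p) (xPow x c d r) n (fun _ => 1) := by
  have l1 := xPow_length x c d p
  have l2 := xPow_length x c d r
  have hlen : (xPow x c d r).length + 1 = (n + 1) * ((xPow x c d p).length + 1) := by
    rw [l1, l2, h]; ring
  refine ⟨hlen, fun j hj i hi => ?_, fun _ _ _ => rfl⟩
  have hb : (j + 1) * ((xPow x c d p).length + 1) ≤ (xPow x c d r).length + 1 := by
    rw [hlen]; exact Nat.mul_le_mul_right _ (by omega)
  rw [add_mul, one_mul] at hb
  rw [xPow_getD (by omega), Units.val_one, one_mul, l1]
  rcases Nat.mod_two_eq_zero_or_one j with hj2 | hj2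
  · rw [if_pos hj2, xPow_getD hi]
    obtain ⟨k, rfl⟩ : ∃ k, j = 2 * k := ⟨j / 2, by omega⟩
    rw [show 2 * k * ((2 * p + 1) * (x.length + 1)) + i =
      2 * (x.length + 1) * (k * (2 * p + 1)) + i by ring, xSeq_add]
  · rw [if_neg (by omega), xPow_getD (by omega)]
    obtain ⟨k, rfl⟩ : ∃ k, j = 2 * k + 1 := ⟨j / 2, by omega⟩
    apply xSeq_reflect
    refine ⟨(k + 1) * (2 * p + 1), ?_⟩
    have e : (2 * k + 1) * ((2 * p + 1) * (x.length + 1)) + (2 * p + 1) * (x.length + 1) =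
      2 * (x.length + 1) * ((k + 1) * (2 * p + 1)) := by ring
    rw [← e, ← l1]
    omega

theorem unf_xPow_self (x : List ℤ) (c d : ℤ) (r : ℕ) : Unf x (xPow x c d r) (2 * r) (fun _ => 1) :=
  unf_xPow x c d (p := 0) (by ring)

theorem xPow_nil_getD {c d : ℤ} {p i : ℕ} (hi : i < (xPow [] c d p).length) :
    (xPow [] c d p).getD i 0 = if i % 2 = 0 then c else d := by
  rw [xPow_getD hi, xSeq]
  rcases Nat.mod_two_eq_zero_or_one i with h | h <;> simp [h]

theorem xPow_nil_ne {c d : ℤ} (hc : c ≠ 0) (hd : d ≠ 0) {p : ℕ} : ∀ k ∈ xPow [] c d p, k ≠ 0 := by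
  intro k hk
  obtain ⟨i, hi, rfl⟩ := List.getElem_of_mem hk
  rw [← List.getD_eq_getElem _ 0 hi, xPow_nil_getD hi]
  split_ifs <;> assumption

theorem IsExpandedEven.getD_zero_ne {a : List ℤ} (h : IsExpandedEven a) (h0 : a ≠ []) :
    a.getD 0 0 ≠ 0 := by
  cases a with
  | nil => exact absurd rfl h0
  | cons k a => simpa using h.2.1

/-- Without a letter between them, the connectors of an expanded even vector are nonzero. -/
theorem ne_zero_of_xPow_nil {c d : ℤ} {p : ℕ} (hp : 1 ≤ p)
    (h : IsExpandedEven (expand (xPow [] c d p))) : c ≠ 0 ∧ d ≠ 0 := by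
  have hl := xPow_length [] c d p
  simp only [List.length_nil, zero_add, mul_one, Nat.add_right_cancel_iff] at hl
  have aux : ∀ x : List ℤ, 0 < x.length → IsExpandedEven (expand x) → x.getD 0 0 ≠ 0 := by
    intro x hx hg h0
    have h1 := expand_getD_zero hx
    rw [h0] at h1
    refine hg.getD_zero_ne (fun he => ?_) (by simpa using h1)
    cases x with
    | nil => simp at hx
    | cons k x =>
      rw [expand_cons] at he
      exact connector_ne_nil k (List.append_eq_nil_iff.mp he).1
  constructor
  · have := aux _ (by omega) h
    rwa [xPow_nil_getD (by omega), Nat.zero_mod, if_pos rfl] at this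
  · have := aux (xPow [] c d p).reverse (by rw [List.length_reverse]; omega)
      (by rw [← expand_reverse]; exact h.reverse)
    rwa [getD_reverse (by omega), xPow_nil_getD (by omega), if_neg (by omega)] at this

/-- If `x` is nonempty then the zeros are isolated by the letters of `x`. Otherwise there are none,
because `c` and `d` both occur as neighbours in a list with `p ≥ 1` that expands to an expanded even
vector. -/
theorem isolatedZeros_xPow {x : List ℤ} (hx : ∀ k ∈ x, k ≠ 0) (hxe : Even x.length) {c d : ℤ}
    {p : ℕ} (hp : 1 ≤ p) (h : IsExpandedEven (expand (xPow x c d p))) (r : ℕ) :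
    IsolatedZeros (xPow x c d r) := by
  rcases Nat.eq_zero_or_pos x.length with h0 | h0
  · rw [List.length_eq_zero_iff.mp h0] at h ⊢
    obtain ⟨hc, hd⟩ := ne_zero_of_xPow_nil hp h
    exact isolatedZeros_of_ne (xPow_nil_ne hc hd)
  · exact (unf_xPow_self x c d r).isolatedZeros hx (by rw [Nat.even_iff] at hxe; omega)

/-- An unfolding of a list of nonzero labels is cut into copies of it. -/
theorem Unf.cells_self {x c : List ℤ} {n : ℕ} {σ : ℕ → ℤˣ} (h : Unf x c n σ)
    (hx : ∀ k ∈ x, k ≠ 0) (hx2 : 2 ≤ x.length) : Cells x.length (absW x) c := by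
  refine ⟨fun P hP hm => ?_, fun P hP h0 => ?_⟩
  · obtain ⟨j, i, rfl, hi⟩ := exists_div_mod x.length P
    rw [cell_mod hi] at hm
    rw [h.natAbs_letter (h.le_of_lt hP).1 (by omega), cellW_val hi]
  · obtain ⟨h1, h2, h3, -⟩ := h.isolatedZeros hx hx2 P hP h0
    exact ⟨h1, h2, h3⟩

/-- The vector `(w, …, w, e)` with `p` copies of `w` tiles the one with `q` copies only if
`2 * p + 1` divides `2 * q + 1`. -/
theorem dvd_of_tiling_xPow {x : List ℤ} (hx : ∀ k ∈ x, k ≠ 0) (hxe : Even x.length) {c d : ℤ}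
    {p q : ℕ} (hp : 1 ≤ p) (hpe : IsExpandedEven (expand (xPow x c d p)))
    (h : Tiling (expand (xPow x c d p)) 1 (expand (xPow x c d q))) : 2 * p + 1 ∣ 2 * q + 1 := by
  have lp := xPow_length x c d p
  have lq := xPow_length x c d q
  obtain ⟨X, n, σ, -, hX, eX⟩ := exists_unf_of_tiling h _ rfl
  rcases Nat.eq_zero_or_pos x.length with h0 | h0
  · obtain rfl := List.length_eq_zero_iff.mp h0
    obtain ⟨hc, hd⟩ := ne_zero_of_xPow_nil hp hpe
    simp only [List.length_nil, zero_add, mul_one, Nat.add_right_cancel_iff] at lp lq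
    have hXe : Even X.length := by
      have h1 := expand_length X
      rw [eX, expand_length, lq] at h1
      rw [Nat.even_iff]; omega
    have hpe : Even (xPow [] c d p).length := by rw [lp]; exact even_two_mul p
    obtain ⟨α, hα⟩ := hX.accRun (xPow_nil_ne hc hd) (by omega) (hX.even hXe)
      (xPow_nil_ne hc hd) eX.symm
    have alt : ∀ {p i : ℕ}, i < (xPow [] c d p).length →
        absW (xPow [] c d p) i = alternating c.natAbs d.natAbs i := by
      intro p i hi
      rw [absW, xPow_nil_getD hi, alternating]
      split_ifs <;> rfl
    have hph := hα.run.phase_of_alternating (by omega) hpe hα.start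
      (absW_pos (xPow_nil_ne hc hd)) (fun i hi => alt hi) (fun i hi => alt hi) _ le_rfl
    obtain ⟨k, hk⟩ := odd_quotient_of_phase_eq (hph.symm.trans hα.finish)
    rw [lp, lq] at hk
    exact ⟨2 * k + 1, by rw [hk, mul_comm]⟩
  · have hx2 : 2 ≤ x.length := by rw [Nat.even_iff] at hxe; omega
    have cX := hX.cells hx2 ((unf_xPow_self x c d p).cells_self hx hx2) ⟨p, lp⟩
    obtain rfl := cX.unique ((unf_xPow_self x c d q).cells_self hx hx2) hx2 (absW_pos hx) eX
    have := hX.dvd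
    rw [lp, lq] at this
    exact Nat.dvd_of_mul_dvd_mul_right (by omega) this

theorem expand_xPow_prefix {x : List ℤ} {c d : ℤ} {p q : ℕ} (h : p ≤ q) :
    expand (xPow x c d p) <+: expand (xPow x c d q) := by
  have step : ∀ q, expand (xPow x c d q) <+: expand (xPow x c d (q + 1)) := by
    intro q
    induction q with
    | zero =>
      rw [xPow_succ, xPow_zero, List.append_assoc, List.append_assoc, List.append_assoc,
        expand_append]
      exact List.prefix_append _ _
    | succ q ih =>
      rw [xPow_succ, xPow_succ x c d (q + 1), expand_append _ (xPow x c d q),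
        expand_append _ (xPow x c d (q + 1))]
      exact (List.prefix_append_right_inj _).mpr ih
  induction q, h using Nat.le_induction with
  | base => exact List.prefix_rfl
  | succ q _ ih => exact ih.trans (step q)


/-! ### The order -/

theorem Tiling.prefix {a c : List ℤ} (h : Tiling a 1 c) : a <+: c := by
  cases h with
  | last => rw [signed_one]
  | step ε' k c hk h =>
    rw [signed_one, List.append_assoc]
    exact List.prefix_append _ _

/-- A tiling of `c` gives a tiling of every representative of the class of `c`. -/
theorem Tiling.transfer {a c c₀ : List ℤ} (ha : IsExpandedEven a) (hc : IsExpandedEven c)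
    (hce : Even c.length) (h : Tiling a 1 c) (hcc : SameClass c₀ c) :
    ∃ a', SameClass a' a ∧ Tiling a' 1 c₀ := by
  obtain ⟨x, -, rfl⟩ := exists_labels ha
  obtain ⟨X, n, σ, -, hX, rfl⟩ := exists_unf_of_tiling h x rfl
  have key : ∀ {x X : List ℤ} {n : ℕ} {σ : ℕ → ℤˣ} (δ : ℤˣ), Unf x X n σ →
      ∃ ε : ℤˣ, Tiling (signed ε (expand x)) 1 (signed δ (expand X)) := by
    intro x X n σ δ hX
    have h1 : Unf x (signed δ X) n _ :=
      Unf.of_signed (δ := δ) (by rw [signed_self_signed]; exact hX)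
    obtain ⟨σ', h2, h3⟩ := h1.normalize
    have h4 := tiling_of_unf h3
    rw [h2, ← signed_expand, ← signed_expand] at h4
    exact ⟨_, h4⟩
  obtain ⟨δ, rfl | rfl⟩ := hcc
  · obtain ⟨ε, hε⟩ := key δ hX
    exact ⟨_, ⟨ε, Or.inl rfl⟩, hε⟩
  · obtain ⟨ε, hε⟩ := key δ (hX.reverse (hX.even (even_length_of_expand hce)))
    rw [← expand_reverse, ← expand_reverse] at hε
    exact ⟨_, ⟨ε, Or.inr rfl⟩, hε⟩

theorem exists_tiling_of_le {a b : EvenVec} (h : Phi a ≤ Phi b) {b' : List ℤ}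
    (hb : SameClass b' b.1) : ∃ a', SameClass a' a.1 ∧ Tiling a' 1 b' := by
  obtain ⟨c₁, a₁, hc, ha, c₂, a₂, hc₂, ha₂, ht⟩ := h
  have h1 : SameClass b' c₂.1 := hb.trans ((sameClass_of_phi_eq hc).trans hc₂.symm)
  obtain ⟨a', h2, h3⟩ := ht.transfer a₂.2.1 c₂.2.1 c₂.2.2 h1
  exact ⟨a', h2.trans (ha₂.trans (sameClass_of_phi_eq ha).symm), h3⟩

theorem le_of_tiling {a b : EvenVec} {a' b' : List ℤ} (ha : SameClass a' a.1)
    (hb : SameClass b' b.1) (h : Tiling a' 1 b') : Phi a ≤ Phi b :=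
  ⟨b, a, rfl, rfl, ⟨b', hb.good b.2.1, hb.length ▸ b.2.2⟩, ⟨a', ha.good a.2.1, ha.length ▸ a.2.2⟩,
    hb, ha, h⟩

/-- The representative of the class of `a` that tiles the vector with `q` copies of `w` is an
initial segment of it, and so is, or conversely, the vector with `p` copies; having the same length,
the two coincide. -/
theorem not_le_of_not_dvd {a b : EvenVec} {x : List ℤ} {c d : ℤ} {p q : ℕ} (hx : ∀ k ∈ x, k ≠ 0)
    (hxe : Even x.length) (ha : SameClass (expand (xPow x c d p)) a.1)
    (hb : SameClass (expand (xPow x c d q)) b.1) (h : ¬ 2 * p + 1 ∣ 2 * q + 1) :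
    ¬ Phi a ≤ Phi b := by
  intro hle
  obtain ⟨a', ha', ht⟩ := exists_tiling_of_le hle hb
  have hp : 1 ≤ p := by
    rcases Nat.eq_zero_or_pos p with rfl | hp
    · exact absurd (one_dvd _) h
    · exact hp
  have hl : a'.length = (expand (xPow x c d p)).length := ha'.length.trans ha.length.symm
  -- both vectors are initial segments of the longer one
  have heq : a' = expand (xPow x c d p) := by
    rcases Nat.le_total p q with hpq | hpq
    · exact (List.prefix_of_prefix_length_le ht.prefix (expand_xPow_prefix hpq)
        hl.le).eq_of_length hl
    · have h1 := expand_xPow_prefix (x := x) (c := c) (d := d) hpq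
      have h2 : expand (xPow x c d q) = expand (xPow x c d p) :=
        h1.eq_of_length (le_antisymm h1.length_le (hl ▸ ht.prefix.length_le))
      rw [← h2] at hl ⊢
      exact ht.prefix.eq_of_length hl
  subst heq
  exact h (dvd_of_tiling_xPow hx hxe hp (ha.good a.2.1) ht)

/-- The vector with `r` copies of `w`, where `2 * r + 1 = (2 * p + 1) * (2 * q + 1)`, is an upper
bound. -/
theorem bddAbove_xPow {a b : EvenVec} {x : List ℤ} {c d : ℤ} {p q : ℕ} (hx : ∀ k ∈ x, k ≠ 0)
    (hxe : Even x.length) (hp : 1 ≤ p) (ha : SameClass (expand (xPow x c d p)) a.1)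
    (hb : SameClass (expand (xPow x c d q)) b.1) : BddAbove {Phi a, Phi b} := by
  obtain ⟨r, hr⟩ : ∃ r, 2 * r + 1 = (2 * p + 1) * (2 * q + 1) := ⟨2 * p * q + p + q, by ring⟩
  have hX := isolatedZeros_xPow hx hxe hp (ha.good a.2.1) r
  have hXe : Even (expand (xPow x c d r)).length := by
    have h1 := xPow_length x c d r
    have h2 := expand_length (xPow x c d r)
    have h3 : Odd ((2 * r + 1) * (x.length + 1)) := (odd_two_mul_add_one r).mul hxe.add_one
    rw [← h1, Nat.odd_iff] at h3
    rw [Nat.even_iff]; omega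
  refine ⟨Phi ⟨_, hX.isExpandedEven, hXe⟩, ?_⟩
  rintro K (rfl | rfl)
  · exact le_of_tiling ha (SameClass.refl _)
      (tiling_of_unf (unf_xPow x c d (p := p) (n := 2 * q) (by rw [hr]; ring)))
  · exact le_of_tiling hb (SameClass.refl _)
      (tiling_of_unf (unf_xPow x c d (p := q) (n := 2 * p) (by rw [hr])))

end TwoBridge

theorem theorem2 (a b : TwoBridge.EvenVec) :
    (¬ TwoBridge.Phi a ≤ TwoBridge.Phi b ∧ ¬ TwoBridge.Phi b ≤ TwoBridge.Phi a ∧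
      BddAbove {TwoBridge.Phi a, TwoBridge.Phi b}) ↔
    ∃ a' b' e : TwoBridge.EvenVec, ∃ c d : ℤ, ∃ p q : ℕ,
      TwoBridge.SameClass a'.1 a.1 ∧ TwoBridge.SameClass b'.1 b.1 ∧
      a'.1 = TwoBridge.wPow (TwoBridge.wVec e.1 c d) p e.1 ∧
      b'.1 = TwoBridge.wPow (TwoBridge.wVec e.1 c d) q e.1 ∧
      ¬ (2 * p + 1 ∣ 2 * q + 1) ∧ ¬ (2 * q + 1 ∣ 2 * p + 1) := by
  open TwoBridge in
  constructor
  · rintro ⟨h1, h2, J, hJ⟩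
    obtain ⟨c, a₁, rfl, -⟩ := hJ (Set.mem_insert _ _)
    obtain ⟨a', ha', hta⟩ := exists_tiling_of_le (hJ (Set.mem_insert _ _)) (SameClass.refl c.1)
    obtain ⟨b', hb', htb⟩ :=
      exists_tiling_of_le (hJ (Set.mem_insert_of_mem _ rfl)) (SameClass.refl c.1)
    have ga := ha'.good a.2.1
    have gb := hb'.good b.2.1
    have la : Even a'.length := ha'.length ▸ a.2.2
    have lb : Even b'.length := hb'.length ▸ b.2.2
    rcases tilings_dichotomy ga la gb lb c.2.1 c.2.2 hta htb with
      h | h | ⟨z, k, l, p, q, hz, hze, ea, eb, hpq, hqp⟩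
    · exact absurd (le_of_tiling ha' hb' h) h1
    · exact absurd (le_of_tiling hb' ha' h) h2
    · have hze' : Even (expand z).length := by
        rw [Nat.even_iff] at hze ⊢; rw [expand_length, hze]
      exact ⟨⟨a', ga, la⟩, ⟨b', gb, lb⟩, ⟨expand z, hz.isExpandedEven, hze'⟩, k, l, p, q, ha', hb',
        ea.trans (expand_xPow z k l p), eb.trans (expand_xPow z k l q), hpq, hqp⟩
  · rintro ⟨⟨a', ga, la⟩, ⟨b', gb, lb⟩, ⟨e, ge, le⟩, c, d, p, q, ha', hb', rfl, rfl, hpq, hqp⟩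
    obtain ⟨x, hx, rfl⟩ := exists_labels ge
    have hxe := even_length_of_expand le
    simp only [← expand_xPow] at ha' hb'
    have hp : 1 ≤ p := by
      rcases Nat.eq_zero_or_pos p with rfl | hp
      · exact absurd (one_dvd _) hpq
      · exact hp
    exact ⟨not_le_of_not_dvd hx hxe ha' hb' hpq, not_le_of_not_dvd hx hxe hb' ha' hqp,
      bddAbove_xPow hx hxe hp ha' hb'⟩
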